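/- Let $K(x)=-D^2g(x)=-\frac1\pi\bigl(xx^{\top}-\tfrac12|x|^2\,\mathrm{Id}\bigr)|x|^{-4}$ for $x\in\mathbb R^2\setminus\{0\}$, where $g(x)=-\frac1{2\pi}\log|x|$ (the kernel of the two-dimensional quasi-static Maxwell volume integral equation). Let $Q=[-\pi,\pi]^2$ and $\Lambda_0=\frac{\Gamma(1/4)^4}{32\pi^2}$. Numerical symbol. Let $F(\tau)=\sum_{m\in\mathbb Z^2\setminus\{0\}}K(m)e^{im\cdot\tau}$; the series converges in $L^2(Q)$, and $F$ denotes the representative of its sum that is $2\pi\mathbb Z^2$-periodic and continuous on $\mathbb R^2\setminus2\pi\mathbb Z^2$ (its existence is part of the claim). Let $\Lambda_+^{(2)}=\sup_{\tau\in Q\setminus\{0\}}\max\mathrm{Sp}\,F(\tau)$ and $\Lambda_-^{(2)}=\inf_{\tau\in Q\setminus\{0\}}\min\mathrm{Sp}\,F(\tau)$. Integral equation. For a bounded open set $\Omega\subset\mathbb R^2$ let $A_\Omega u(x)=\mathrm{p.v.}\!\int_\Omega K(x-y)u(y)\,dy$, the limit in $L^2(\Omega;\mathbb C^2)$ as $\varepsilon\to0$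 of the integrals over $\{y\in\Omega:|x-y|>\varepsilon\}$. The equation $(\lambda\,\mathrm{Id}-A_\Omega)u=f$ is well posed if $A_\Omega$ is a bounded operator on $L^2(\Omega;\mathbb C^2)$ and for every $f\in L^2(\Omega;\mathbb C^2)$ there is a unique solution $u\in L^2(\Omega;\mathbb C^2)$, with $\|u\|\le C\|f\|$ for a constant $C$ independent of $f$. DDA scheme. For $N\ge1$ and a grid origin $a^N\in\mathbb R^2$ let $x^N_m=a^N+m/N$ $(m\in\mathbb Z^2)$, $\omega^N=\{m\in\mathbb Z^2: x_m^N\in\Omega\}$, and let $T^N$ be the matrix with the $2\times2$ blocks $N^{-2}K(x^N_m-x^N_n)$ for $m\ne n$ and $0$ for $m=n$ $(m,n\in\omega^N)$, acting on $\ell^2(\omega^N;\mathbb C^2)$. The scheme $(\lambda\,\mathrm{Id}-T^N)U=F$ is stable if there are $C$ and $N_0$ such that for all $N\ge N_0$ the matrix $\lambda\,\mathrm{Id}-T^N$ is invertible with $\|(\lambda\,\mathrm{Id}-T^N)^{-1}\|\le C$; otherwise it is unstable. Then: (1) $0.5471<\Lambda_0<0.5472$. There are real-valued functions $a,b$, the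 sums (in the same sense as for $F$) of the Fourier series $a(\tau)=\sum_{m\neq0}\frac{m_2^2-m_1^2}{2\pi|m|^4}e^{im\cdot\tau}$ and $b(\tau)=-\sum_{m\ne0}\frac{m_1m_2}{\pi|m|^4}e^{im\cdot\tau}$, such that for $\tau\in Q\setminus\{0\}$ $$F(\tau)=\begin{pmatrix}a(\tau)&b(\tau)\\ b(\tau)&-a(\tau)\end{pmatrix},$$ with eigenvalues $\pm\sqrt{a(\tau)^2+b(\tau)^2}$. Moreover $b=0$ on $\partial Q$ and $a(\pi,0)=\Lambda_0$, so that the eigenvalues of $F(\pi,0)$ are $\pm\Lambda_0$. (2) $\Lambda_\pm^{(2)}$ are finite, $\Lambda_+^{(2)}\ge\Lambda_0$ and $\Lambda_-^{(2)}=-\Lambda_+^{(2)}$. (3) For every non-empty bounded open set $\Omega\subset\mathbb R^2$ and every $\lambda\in(-0.5471,-0.5)\cup(0.5,0.5471)$, the DDA scheme is unstable for every choice of the grid origins $a^N$, whereas the integral equation $(\lambda\,\mathrm{Id}-A_\Omega)u=f$ is well posed in $L^2(\Omega;\mathbb C^2)$. -/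

import Mathlib

open MeasureTheory Filter Topology

noncomputable section

namespace DDA

/-- The Euclidean plane. -/
abbrev Plane : Type := EuclideanSpace ℝ (Fin 2)

/-- The value space `ℂ²` with its Hermitian norm. -/
abbrev C2 : Type := EuclideanSpace ℂ (Fin 2)

/-- The quasi-static Maxwell kernel in the plane, `K(x) = -D²g(x)` for `x ≠ 0`, where
`g(x) = -(1 / 2π) log |x|` is the fundamental solution of the negative Laplacian. Explicitly
`K(x) = -(1/π) (x xᵀ - (1/2) |x|² Id) |x|⁻⁴`. (The value at `x = 0` is never used.) -/
def kernel (x : Plane) : Matrix (Fin 2) (Fin 2) ℂ :=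
  Matrix.of fun i j =>
    ((-(1 / Real.pi) * (x i * x j - (if i = j then ‖x‖ ^ 2 / 2 else 0)) / ‖x‖ ^ 4 : ℝ) : ℂ)

/-! ### The singular integral equation -/

/-- The Hilbert space `L²(Ω; ℂ²)`. -/
abbrev L2 (Ω : Set Plane) : Type := Lp C2 2 (volume.restrict Ω)

/-- The truncated singular integral `∫_{y ∈ Ω, |x - y| > ε} K(x - y) u(y) dy`. -/
def truncated (Ω : Set Plane) (ε : ℝ) (u : Plane → C2) (x : Plane) : C2 :=
  ∫ y in Ω ∩ {y | ε < ‖x - y‖}, Matrix.toEuclideanCLM (𝕜 := ℂ) (kernel (x - y)) (u y)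

/-- `A` is the operator `A_Ω` of the principal value integral: for every `u ∈ L²(Ω; ℂ²)` the
truncated integrals of `u` converge to `A u` in `L²(Ω; ℂ²)` as `ε → 0`. -/
def IsPVOperator (Ω : Set Plane) (A : L2 Ω →L[ℂ] L2 Ω) : Prop :=
  ∀ u : L2 Ω, Tendsto
    (fun ε : ℝ => eLpNorm (fun x => truncated Ω ε u x - A u x) 2 (volume.restrict Ω))
    (𝓝[>] 0) (𝓝 0)

/-- Well-posedness in `L²(Ω; ℂ²)` of `(lam Id - A_Ω) u = f`: the principal value integral defines a
bounded operator `A_Ω`, and the equation has for each `f` exactly one solution, which depends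
continuously on `f`. -/
def IEWellPosed (Ω : Set Plane) (lam : ℂ) : Prop :=
  ∃ A : L2 Ω →L[ℂ] L2 Ω, IsPVOperator Ω A ∧
    (∀ f : L2 Ω, ∃! u : L2 Ω, lam • u - A u = f) ∧
    ∃ C : ℝ, ∀ u : L2 Ω, ‖u‖ ≤ C * ‖lam • u - A u‖

/-! ### The delta-delta (DDA) scheme -/

/-- A point of the integer lattice, as a point of the plane. -/
def latticePoint (m : Fin 2 → ℤ) : Plane := WithLp.toLp 2 fun i => (m i : ℝ)

/-- The grid point `x_m = o + m / N` of the grid of mesh width `1 / N` with origin `o`. -/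
def gridPoint (o : Plane) (N : ℕ+) (m : Fin 2 → ℤ) : Plane :=
  o + ((N : ℕ) : ℝ)⁻¹ • latticePoint m

/-- `ω^N = {m ∈ ℤ² : x_m ∈ Ω}`. -/
def gridIndex (Ω : Set Plane) (o : Plane) (N : ℕ+) : Set (Fin 2 → ℤ) :=
  {m | gridPoint o N m ∈ Ω}

theorem finite_gridIndex {Ω : Set Plane} (hΩ : Bornology.IsBounded Ω) (o : Plane) (N : ℕ+) :
    (gridIndex Ω o N).Finite := by
  obtain ⟨R, hR⟩ := hΩ.subset_closedBall 0
  have hN : (0 : ℝ) < ((N : ℕ) : ℝ) := by exact_mod_cast N.pos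
  obtain ⟨B, hB⟩ := exists_nat_ge (((N : ℕ) : ℝ) * (R + ‖o‖))
  refine (Set.finite_Icc (fun _ : Fin 2 => -(B : ℤ)) (fun _ => (B : ℤ))).subset fun m hm => ?_
  have h1 : ‖gridPoint o N m‖ ≤ R := by simpa using hR hm
  have h2 : ‖((N : ℕ) : ℝ)⁻¹ • latticePoint m‖ ≤ R + ‖o‖ := by
    have h3 : ((N : ℕ) : ℝ)⁻¹ • latticePoint m = gridPoint o N m - o := by simp [gridPoint]
    rw [h3]
    exact (norm_sub_le _ _).trans (by linarith)
  rw [norm_smul, norm_inv, Real.norm_of_nonneg hN.le, inv_mul_le_iff₀ hN] at h2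
  have h4 : ∀ i, |(m i : ℝ)| ≤ B := fun i =>
    ((PiLp.norm_apply_le (latticePoint m) i).trans h2).trans hB
  have h5 : ∀ i, |m i| ≤ (B : ℤ) := fun i => by exact_mod_cast h4 i
  exact ⟨fun i => (abs_le.mp (h5 i)).1, fun i => (abs_le.mp (h5 i)).2⟩

/-- The system matrix `T^N`, of size `2|ω^N| × 2|ω^N|`: its block at `(m, n)` is
`N⁻² K(x_m - x_n)` for `m ≠ n`, and zero for `m = n`. -/
def systemMatrix (Ω : Set Plane) (o : Plane) (N : ℕ+) :
    Matrix (gridIndex Ω o N × Fin 2) (gridIndex Ω o N × Fin 2) ℂ :=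
  Matrix.of fun p q =>
    if p.1 = q.1 then 0
    else (((N : ℕ) : ℂ) ^ 2)⁻¹ *
      kernel (gridPoint o N p.1 - gridPoint o N q.1) p.2 q.2

open Classical in
/-- The resolvent estimate at mesh width `1 / N`: the matrix `lam Id - T^N` is invertible and its
inverse has operator norm at most `C` on `ℓ²(ω^N; ℂ²)`. -/
def ResolventBound {Ω : Set Plane} (hΩ : Bornology.IsBounded Ω) (o : Plane) (lam : ℂ) (N : ℕ+)
    (C : ℝ) : Prop :=
  haveI : Fintype (gridIndex Ω o N) := (finite_gridIndex hΩ o N).fintype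
  IsUnit (lam • 1 - systemMatrix Ω o N) ∧
    ‖Matrix.toEuclideanCLM (n := gridIndex Ω o N × Fin 2) (𝕜 := ℂ)
        (lam • 1 - systemMatrix Ω o N)⁻¹‖ ≤ C

/-- Stability in `ℓ²(ω^N; ℂ²)` as `N → ∞` of the scheme `(lam Id - T^N) U = F` on the grids with
origins `o N`: the inverses exist and are uniformly bounded for all large `N`. -/
def SchemeStable {Ω : Set Plane} (hΩ : Bornology.IsBounded Ω) (o : ℕ+ → Plane) (lam : ℂ) : Prop :=
  ∃ C : ℝ, ∀ᶠ N : ℕ+ in atTop, ResolventBound hΩ (o N) lam N C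

/-! ### The numerical symbol -/

/-- The period square `Q = [-π, π]²`. -/
def Q : Set Plane := {τ | ∀ i, τ i ∈ Set.Icc (-Real.pi) Real.pi}

/-- The lattice `2πℤ²`. -/
def periodLattice : Set Plane := Set.range fun m => (2 * Real.pi) • latticePoint m

/-- `f` is the sum of the Fourier series `∑_{m ≠ 0} k(m) exp(i m·τ)`. For the coefficients of
interest the series does not converge absolutely; it is summed in `L²(Q)`, and `f` is the
representative of the sum that is `2πℤ²`-periodic and continuous off `2πℤ²`. -/
structure IsFourierSum (k : (Fin 2 → ℤ) → ℂ) (f : Plane → ℂ) : Prop where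
  periodic : ∀ m τ, f (τ + (2 * Real.pi) • latticePoint m) = f τ
  continuousOn : ContinuousOn f periodLatticeᶜ
  tendsto : Tendsto
    (fun s : Finset (Fin 2 → ℤ) => eLpNorm
      (fun τ => (∑ m ∈ s.erase 0, k m * Complex.exp (Complex.I * ∑ i, (m i : ℂ) * (τ i : ℂ))) - f τ)
      2 (volume.restrict Q))
    atTop (𝓝 0)

/-- `F` is the numerical symbol `F(τ) = ∑_{m ≠ 0} K(m) exp(i m·τ)`, i.e. the symbol of the infinite
block Toeplitz matrix `(K(m - n))` with zero diagonal blocks. -/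
def IsNumericalSymbol (F : Plane → Matrix (Fin 2) (Fin 2) ℂ) : Prop :=
  ∀ i j, IsFourierSum (fun m => kernel (latticePoint m) i j) (fun τ => F τ i j)

/-- The real eigenvalues of a complex `2 × 2` matrix. -/
def realEigenvalues (M : Matrix (Fin 2) (Fin 2) ℂ) : Set ℝ :=
  {x | Module.End.HasEigenvalue (Matrix.toLin' M) (x : ℂ)}

/-- `Λ₊ = sup_{τ ∈ Q, τ ≠ 0} max Sp F(τ)`. -/
def IsLambdaPlus (F : Plane → Matrix (Fin 2) (Fin 2) ℂ) (L : ℝ) : Prop :=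
  IsLUB {x | ∃ τ ∈ Q, τ ≠ 0 ∧ IsGreatest (realEigenvalues (F τ)) x} L

/-- `Λ₋ = inf_{τ ∈ Q, τ ≠ 0} min Sp F(τ)`. -/
def IsLambdaMinus (F : Plane → Matrix (Fin 2) (Fin 2) ℂ) (L : ℝ) : Prop :=
  IsGLB {x | ∃ τ ∈ Q, τ ≠ 0 ∧ IsLeast (realEigenvalues (F τ)) x} L

/-- `Λ₀ = Γ(1/4)⁴ / (32 π²)`. -/
def Lambda0 : ℝ := Real.Gamma (1 / 4) ^ 4 / (32 * Real.pi ^ 2)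

/-- The coefficients `(m₂² - m₁²) / (2π |m|⁴)`. -/
def coeffA (m : Fin 2 → ℤ) : ℂ :=
  ((m 1 : ℂ) ^ 2 - (m 0 : ℂ) ^ 2) / (2 * Real.pi * ((m 0 : ℂ) ^ 2 + (m 1 : ℂ) ^ 2) ^ 2)

/-- The coefficients `-m₁ m₂ / (π |m|⁴)`. -/
def coeffB (m : Fin 2 → ℤ) : ℂ :=
  -((m 0 : ℂ) * (m 1 : ℂ)) / (Real.pi * ((m 0 : ℂ) ^ 2 + (m 1 : ℂ) ^ 2) ^ 2)

end DDA

end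

/-! Put z = m₁ + i m₂. The matrix K(m) is real, symmetric and traceless, with rows (α, β) and (β,
-α), and α - iβ = -(1/2π) z⁻². So one scalar series on the torus, S(x) = ∑ (m₁ + i m₂)⁻² e^{2πi m·x}
(`torusSeries`), carries the whole symbol: a = -Re S/(2π), b = Im S/(2π), with eigenvalues
±|S|/(2π).

The series for S does not converge absolutely. A single row of it has a closed form
(`rowSum_eq_of_ne_zero`) of size about y e^{-2π|n|y} near y = 0, and the sum of these over n is
bounded uniformly in y. So the sum by rows is bounded, and continuous where x₀ ≠ 0. A quarter turn
of the lattice only changes the sign of the coefficients, which yields continuity away from the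
origin. Since continuous functions with equal Fourier coefficients agree, the lattice symmetries
pass to S: it is real on the edges of the period square and vanishes at the corner (1/2, 1/2).

At (1/2, 0) the row sums are rows of the Eisenstein series G₂, and S(1/2, 0) = -℘(1/2)/2 for the
lattice ℤ[i] (`torusSeries_eq_weierstrassP`). For this lattice g₃ = 0 and ℘'² = 4℘(℘² - e²) with e =
℘(1/2), so a substitution relates the half period to a Beta integral and e = Γ(1/4)⁴/(8π)
(`eq_Gamma_pow_four`). The decimal bounds come from the q-expansion of G₂ at 2i.

Instability: along an edge the symbol is diag(a, -a), and a runs from Λ₀ to 0, so every `lam` with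
|lam| ≤ Λ₀ is an eigenvalue of some F(x). Trigonometric polynomials concentrated near x give
finitely supported approximate eigenvectors of the infinite Toeplitz matrix
(`exists_approx_eigenvector`). As K is homogeneous of degree -2, each T^N is a finite section of
that matrix, and for large N every grid contains a translate of a given finite set
(`not_schemeStable`).

Well-posedness: the principal value operator has norm at most 1/2 (`exists_isPVOperator`). In the
coordinates w₁ ± i w₂ it becomes -1/(2π) times the Beurling transform and its conjugate. The kernel
z⁻² on an annulus and the difference of two normalized disc indicators are, up to sign, the ∂ and ∂̄
derivatives of one compactly supported Lipschitz function. Since ‖∂v‖ = ‖∂̄v‖ in L²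
(`integral_wirtinger`), truncated Beurling integrals are controlled by disc averages, which have
norm at most π. A Neumann series then solves the equation for |lam| > 1/2. -/

noncomputable section
namespace DDA
-- Closed form of the Fourier series along one row of the lattice.
open Complex in
/-- The Fourier coefficient `(m + i n)⁻²`, equal to `0` at the origin. -/
def invSq (m n : ℤ) : ℂ := (((m : ℂ) + n * I) ^ 2)⁻¹

lemma invSq_eq_eisSummand (m n : ℤ) :
    invSq m n = EisensteinSeries.eisSummand 2 ![n, m] UpperHalfPlane.I := by
  simp [invSq, EisensteinSeries.eisSummand, add_comm]

lemma summable_invSq (n : ℤ) : Summable fun m => invSq m n :=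
  (EisensteinSeries.e2Summand_summable n UpperHalfPlane.I).congr fun m => (invSq_eq_eisSummand m n).symm

lemma invSq_neg_neg (m n : ℤ) : invSq (-m) (-n) = invSq m n := by
  simp only [invSq]; push_cast; congr 1; ring

lemma invSq_neg_right (m n : ℤ) : invSq m (-n) = (starRingEnd ℂ) (invSq m n) := by
  simp only [invSq, map_inv₀, map_pow, map_add, map_mul, Complex.conj_I, map_intCast]
  push_cast; congr 1; ring

/-- Multiplication by -i preserves the Gaussian integers and (-i)⁻² = -1. This sign is the source of
the symmetry of the symbol under quarter turns. -/
lemma invSq_rot (m n : ℤ) : invSq n (-m) = -invSq m n := by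
  have : ((n : ℂ) + ((-m : ℤ) : ℂ) * Complex.I) = -Complex.I * ((m : ℂ) + n * Complex.I) := by
    push_cast; linear_combination (n : ℂ) * Complex.I_sq
  simp only [invSq]
  rw [this, mul_pow, neg_sq, Complex.I_sq, mul_inv]; norm_num

lemma norm_fourier_apply (m : ℤ) (x : UnitAddCircle) : ‖(fourier m x : ℂ)‖ = 1 := by
  rw [fourier_apply]; exact Circle.norm_coe _

/-- The partial Fourier sum over the `n`-th row of the lattice. -/
def rowSum (n : ℤ) (x : UnitAddCircle) : ℂ := ∑' m : ℤ, invSq m n * fourier m x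

lemma summable_rowSum (n : ℤ) (x : UnitAddCircle) :
    Summable fun m : ℤ => invSq m n * fourier m x :=
  .of_norm <| by simpa only [norm_mul, norm_fourier_apply, mul_one] using (summable_invSq n).norm

lemma continuous_rowSum (n : ℤ) : Continuous (rowSum n) :=
  continuous_tsum (fun m => by fun_prop) (summable_invSq n).norm fun m x => by
    rw [norm_mul, norm_fourier_apply, mul_one]

lemma rowSum_neg (n : ℤ) (x : UnitAddCircle) : rowSum (-n) x = rowSum n (-x) := by
  rw [rowSum, rowSum, ← (Equiv.neg ℤ).tsum_eq]
  refine tsum_congr fun m => ?_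
  simp [invSq_neg_neg, fourier_apply]

/-- Absolute summability gives convergence in the sup norm, hence in L², where taking a coefficient
is continuous and the characters are orthonormal. -/
lemma fourierCoeff_tsum {c : ℤ → ℂ} (hc : Summable fun k => ‖c k‖) (m : ℤ) :
    fourierCoeff (fun x : UnitAddCircle => ∑' k, c k * fourier k x) m = c m := by
  have hcont : Continuous fun x : UnitAddCircle => ∑' k, c k * fourier k x :=
    continuous_tsum (fun k => by fun_prop) hc fun k x => by
      rw [norm_mul, norm_fourier_apply, mul_one]
  have h1 : HasSum (fun k : ℤ => c k • (fourier k : C(UnitAddCircle, ℂ))) ⟨_, hcont⟩ := by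
    have hs : Summable fun k : ℤ => c k • (fourier k : C(UnitAddCircle, ℂ)) :=
      .of_norm <| by simpa only [norm_smul, fourier_norm, mul_one] using hc
    have e : (⟨_, hcont⟩ : C(UnitAddCircle, ℂ)) = ∑' k, c k • fourier k := by
      ext x
      simpa using ((ContinuousMap.evalCLM ℂ x).hasSum hs.hasSum).tsum_eq
    exact e ▸ hs.hasSum
  have h2 := (ContinuousMap.toLp (E := ℂ) 2 AddCircle.haarAddCircle ℂ).hasSum h1
  have h3 := (innerSL ℂ (fourierLp 2 m : Lp ℂ 2 (@AddCircle.haarAddCircle 1 _))).hasSum h2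
  have h4 : ∀ f : C(UnitAddCircle, ℂ), innerSL ℂ (fourierLp 2 m : Lp ℂ 2 (@AddCircle.haarAddCircle 1 _))
      (ContinuousMap.toLp (E := ℂ) 2 AddCircle.haarAddCircle ℂ f) = fourierCoeff f m := by
    intro f
    rw [innerSL_apply_apply, ← fourierCoeff_toLp, ← fourierBasis_repr, HilbertBasis.repr_apply_apply,
      coe_fourierBasis]
  have h5 : ∀ k : ℤ, innerSL ℂ (fourierLp 2 m : Lp ℂ 2 (@AddCircle.haarAddCircle 1 _))
      (ContinuousMap.toLp (E := ℂ) 2 AddCircle.haarAddCircle ℂ (c k • fourier k)) =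
      if k = m then c m else 0 := by
    intro k
    rw [map_smul, map_smul, innerSL_apply_apply]
    have := orthonormal_iff_ite.mp (orthonormal_fourier (T := 1)) m k
    rw [fourierLp] at this
    rw [this]
    by_cases h : k = m
    · subst h; simp
    · simp [h, Ne.symm h]
  rw [h4] at h3
  simp only [h5] at h3
  exact h3.unique (hasSum_ite_eq m _)

lemma fourierCoeff_rowSum (n m : ℤ) : fourierCoeff (rowSum n) m = invSq m n :=
  fourierCoeff_tsum (summable_invSq n).norm m

/-- Formally (d/dx - 2πn)² multiplies the `m`-th Fourier coefficient by -4π²(m + i n)². So the row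
sum is -4π² times the periodic fundamental solution of this operator: an affine function times
e^{2πnx} on one period, fixed by continuity and by the jump -4π² of the derivative. The proof goes
backwards, from the Fourier coefficients of the closed form. -/
lemma rowSum_eq_of_ne_zero {n : ℤ} (hn : n ≠ 0) {x : ℝ} (hx : x ∈ Set.Ico (0 : ℝ) 1) :
    rowSum n (x : UnitAddCircle) = ((4 * Real.pi ^ 2 * Real.exp (2 * Real.pi * n * x) *
      (x / (Real.exp (2 * Real.pi * n) - 1) -
        Real.exp (2 * Real.pi * n) / (Real.exp (2 * Real.pi * n) - 1) ^ 2) : ℝ) : ℂ) := by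
  set E : ℝ := Real.exp (2 * Real.pi * n) with hE
  have hE1 : E - 1 ≠ 0 := by
    rw [sub_ne_zero, hE, Ne, Real.exp_eq_one_iff]
    have := Real.pi_ne_zero
    have : (n : ℝ) ≠ 0 := by exact_mod_cast hn
    positivity
  set g : ℝ → ℂ := fun x => ((4 * Real.pi ^ 2 * Real.exp (2 * Real.pi * n * x) *
      (x / (E - 1) - E / (E - 1) ^ 2) : ℝ) : ℂ) with hg
  have hgc : Continuous g := by fun_prop
  have hper : g 0 = g (0 + 1) := by
    simp only [hg, mul_zero, Real.exp_zero, zero_add, mul_one, ← hE]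
    norm_cast
    field_simp; ring
  let G : C(UnitAddCircle, ℂ) := ⟨AddCircle.liftIco 1 0 g,
    AddCircle.liftIco_continuous hper hgc.continuousOn⟩
  have hGx : ∀ y ∈ Set.Ico (0 : ℝ) 1, G (y : UnitAddCircle) = g y := fun y hy =>
    AddCircle.liftIco_coe_apply (p := (1 : ℝ)) (a := 0) (f := g) (by simpa using hy)
  have hcoeff : ∀ m, fourierCoeff G m = invSq m n := by
    intro m
    rw [fourierCoeff_eq_intervalIntegral _ _ 0]
    have hκ : ((n : ℂ) - m * Complex.I) ≠ 0 := by
      intro h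
      have := congrArg Complex.re h
      simp at this
      exact hn this
    set κ : ℂ := 2 * Real.pi * ((n : ℂ) - m * Complex.I) with hκd
    have hκ0 : κ ≠ 0 := by
      have := Real.pi_ne_zero
      simp only [hκd]
      exact mul_ne_zero (mul_ne_zero two_ne_zero (by exact_mod_cast this)) hκ
    -- One integration by parts gives this primitive; the exponential in `g` and the character of
    -- index `-m` combine into exp(κy).
    have hint : ∀ y : ℝ, HasDerivAt (fun y : ℝ => 4 * (Real.pi : ℂ) ^ 2 * (Complex.exp (κ * y) *
        (((y : ℂ) / (E - 1) - E / (E - 1) ^ 2) / κ - 1 / (E - 1) / κ ^ 2)))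
        (4 * (Real.pi : ℂ) ^ 2 * Complex.exp (κ * y) * ((y : ℂ) / (E - 1) - E / (E - 1) ^ 2)) y := by
      intro y
      have h0 : HasDerivAt (fun y : ℝ => (y : ℂ)) 1 y := Complex.ofRealCLM.hasDerivAt
      have h1 : HasDerivAt (fun y : ℝ => Complex.exp (κ * y)) (Complex.exp (κ * y) * (κ * 1)) y :=
        (h0.const_mul κ).cexp
      have h2 := ((((h0.div_const ((E : ℂ) - 1)).sub_const ((E : ℂ) / (E - 1) ^ 2)).div_const κ).sub_const
        (1 / ((E : ℂ) - 1) / κ ^ 2))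
      refine ((h1.mul h2).const_mul _).congr_deriv ?_
      field_simp
      ring
    have heq : ∫ y in (0 : ℝ)..0 + 1, (fourier (-m) (y : UnitAddCircle) : ℂ) • G y =
        ∫ y in (0 : ℝ)..1,
          4 * (Real.pi : ℂ) ^ 2 * Complex.exp (κ * y) * ((y : ℂ) / (E - 1) - E / (E - 1) ^ 2) := by
      rw [zero_add]
      refine intervalIntegral.integral_congr_ae ?_
      have : ∀ᵐ y : ℝ, y ≠ 1 := by simp [ae_iff, measure_singleton]
      filter_upwards [this] with y hy1 hy
      rw [Set.uIoc_of_le zero_le_one] at hy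
      rw [hGx y ⟨hy.1.le, lt_of_le_of_ne hy.2 hy1⟩, fourier_coe_apply, hg, smul_eq_mul]
      push_cast
      have : Complex.exp (κ * y) = Complex.exp (2 * Real.pi * Complex.I * (-m : ℂ) * y / 1) *
          Complex.exp (2 * Real.pi * n * y) := by
        rw [← Complex.exp_add]; congr 1; rw [hκd]; ring
      rw [this]; ring
    have hκ1 : Complex.exp κ = E := by
      rw [hE, hκd]; push_cast
      have : (2 * Real.pi * ((n : ℂ) - m * Complex.I)) =
        2 * Real.pi * n + ((-m : ℤ) : ℂ) * (2 * Real.pi * Complex.I) := by push_cast; ring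
      rw [this, Complex.exp_periodic.int_mul]
    have hE1' : (E : ℂ) - 1 ≠ 0 := by exact_mod_cast hE1
    rw [heq, intervalIntegral.integral_eq_sub_of_hasDerivAt (fun y _ => hint y)
      (Continuous.intervalIntegrable (by fun_prop) _ _)]
    simp only [Complex.ofReal_one, mul_one, hκ1, Complex.ofReal_zero, mul_zero, Complex.exp_zero]
    have h5 : invSq m n = -(4 * (Real.pi : ℂ) ^ 2) / κ ^ 2 := by
      have h6 : ((m : ℂ) + n * Complex.I) = Complex.I * ((n : ℂ) - m * Complex.I) := by
        linear_combination (m : ℂ) * Complex.I_sq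
      have hp : (Real.pi : ℂ) ≠ 0 := by exact_mod_cast Real.pi_ne_zero
      rw [invSq, h6, mul_pow, Complex.I_sq, hκd]
      field_simp
      norm_num
    rw [h5]
    simp only [one_div, inv_one, one_smul]
    field_simp
    ring
  -- A continuous function with summable Fourier coefficients is the pointwise sum of its Fourier
  -- series.
  have hs : Summable (fourierCoeff G) := by
    simpa only [funext hcoeff] using summable_invSq n
  have := has_pointwise_sum_fourier_series_of_summable hs (x : UnitAddCircle)
  simp only [hcoeff, smul_eq_mul] at this
  rw [hGx x hx] at this
  exact this.tsum_eq
end DDA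

end

/-! ### Uniform bounds on the row sums, and summation over the rows. -/

noncomputable section
namespace DDA
lemma exists_coe_eq_of_ne_zero {x : UnitAddCircle} (hx : x ≠ 0) :
    ∃ y ∈ Set.Ioo (0 : ℝ) 1, (y : UnitAddCircle) = x := by
  have h := AddCircle.coe_image_Ico_eq (1 : ℝ) 0
  obtain ⟨y, hy, rfl⟩ := h.symm ▸ Set.mem_univ x
  refine ⟨y, ⟨lt_of_le_of_ne hy.1 fun h0 => hx (by simp [← h0]), by simpa using hy.2⟩, rfl⟩

/-- The two-sided geometric series. -/
lemma hasSum_pow_natAbs {r : ℝ} (h0 : 0 ≤ r) (h1 : r < 1) :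
    HasSum (fun n : ℤ => r ^ n.natAbs) ((1 - r)⁻¹ + r * (1 - r)⁻¹) := by
  refine HasSum.of_nat_of_neg_add_one ?_ ?_
  · simpa using hasSum_geometric_of_lt_one h0 h1
  · have := (hasSum_geometric_of_lt_one h0 h1).mul_left r
    refine this.congr_fun fun n => ?_
    have : (-((n : ℤ) + 1)).natAbs = n + 1 := by omega
    rw [this, pow_succ, mul_comm]

lemma exp_neg_two_pi_lt_half : Real.exp (-(2 * Real.pi)) ≤ 1 / 2 := by
  have h := Real.add_one_le_exp (2 * Real.pi)
  have := Real.pi_gt_three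
  rw [Real.exp_neg, one_div]
  exact inv_anti₀ two_pos (by linarith)

/-- A bound for `tsum` of the geometric series of ratio `exp (-2πy)`, weighted by `y`. -/
lemma mul_geometric_le {y : ℝ} (h0 : 0 < y) (h1 : y ≤ 1) :
    y * ((1 - Real.exp (-(2 * Real.pi * y)))⁻¹ +
      Real.exp (-(2 * Real.pi * y)) * (1 - Real.exp (-(2 * Real.pi * y)))⁻¹) ≤ 3 := by
  have hpi := Real.pi_gt_three
  set t := 2 * Real.pi * y with ht
  have ht0 : 0 < t := by positivity
  have hr1 : Real.exp (-t) < 1 := by rw [Real.exp_lt_one_iff]; linarith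
  have hr : Real.exp (-t) ≤ 1 / (1 + t) := by
    rw [Real.exp_neg, one_div]
    exact inv_anti₀ (by positivity) (by linarith [Real.add_one_le_exp t])
  have h2 : t / (1 + t) ≤ 1 - Real.exp (-t) := by
    have : t / (1 + t) = 1 - 1 / (1 + t) := by field_simp; ring
    linarith
  have h3 : (1 - Real.exp (-t))⁻¹ ≤ (1 + t) / t := by
    rw [← inv_div]; exact inv_anti₀ (by positivity) h2
  have h4 : 0 < (1 - Real.exp (-t))⁻¹ := inv_pos.mpr (by linarith)
  calc y * ((1 - Real.exp (-t))⁻¹ + Real.exp (-t) * (1 - Real.exp (-t))⁻¹)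
      ≤ y * ((1 + t) / t + 1 * ((1 + t) / t)) := by gcongr
    _ = (1 + 2 * Real.pi * y) / Real.pi := by rw [ht]; field_simp; ring
    _ ≤ 3 := by
      rw [div_le_iff₀ (by linarith)]
      nlinarith

/-- The weight in the bound for `rowSum`. -/
def rowWeight (y : ℝ) (n : ℤ) : ℝ := Real.exp (-(2 * Real.pi * y)) ^ n.natAbs

/-- In the closed form with E = e^{-2πN} ≤ 1/2, the main term keeps its factor `y`, which later
offsets the blow-up of the geometric series in e^{-2πy} as `y` tends to 0. The other term is already
of size E. -/
lemma norm_rowSum_le_of_pos {N : ℕ} (hN : 0 < N) {y : ℝ} (hy : y ∈ Set.Ioo (0 : ℝ) 1) :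
    ‖rowSum (-N) (y : UnitAddCircle)‖ ≤
      16 * Real.pi ^ 2 * (y * rowWeight y N + rowWeight 1 N) := by
  have hn : (-(N : ℤ)) ≠ 0 := by omega
  rw [rowSum_eq_of_ne_zero hn ⟨hy.1.le, hy.2⟩, Complex.norm_real, Real.norm_eq_abs]
  have hw : Real.exp (2 * Real.pi * ((-(N : ℤ) : ℤ) : ℝ) * y) = rowWeight y N := by
    rw [rowWeight, ← Real.exp_nat_mul]; congr 1; push_cast [Int.natAbs_natCast]; ring
  have hE : Real.exp (2 * Real.pi * ((-(N : ℤ) : ℤ) : ℝ)) = rowWeight 1 N := by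
    rw [rowWeight, ← Real.exp_nat_mul]; congr 1; push_cast [Int.natAbs_natCast]; ring
  rw [hw, hE]
  have hE0 : 0 < rowWeight 1 N := by unfold rowWeight; positivity
  have hE2 : rowWeight 1 N ≤ 1 / 2 := by
    refine le_trans ?_ exp_neg_two_pi_lt_half
    rw [rowWeight, mul_one, Int.natAbs_natCast]
    exact pow_le_of_le_one (Real.exp_pos _).le
      (Real.exp_le_one_iff.mpr (by linarith [Real.pi_pos])) hN.ne'
  have hw0 : 0 < rowWeight y N := by unfold rowWeight; positivity
  have hw1 : rowWeight y N ≤ 1 := by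
    unfold rowWeight
    exact pow_le_one₀ (Real.exp_pos _).le
      (Real.exp_le_one_iff.mpr (by nlinarith [Real.pi_pos, hy.1]))
  set E := rowWeight 1 N
  set w := rowWeight y N
  have h1 : y / (E - 1) - E / (E - 1) ^ 2 = -(y * (1 - E)⁻¹ + E * ((1 - E)⁻¹) ^ 2) := by
    have : E - 1 ≠ 0 := by linarith
    have : 1 - E ≠ 0 := by linarith
    have h : E - 1 = -(1 - E) := by ring
    rw [h]; field_simp; ring
  have hi0 : 0 < (1 - E)⁻¹ := inv_pos.mpr (by linarith)
  have hi : (1 - E)⁻¹ ≤ 2 := by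
    rw [inv_le_comm₀ (by linarith) two_pos]; linarith
  have hy0 := hy.1
  rw [h1, mul_neg, abs_neg, abs_of_nonneg (by positivity)]
  have h2 : y * (1 - E)⁻¹ + E * ((1 - E)⁻¹) ^ 2 ≤ 4 * y + 4 * E := by
    have : ((1 - E)⁻¹) ^ 2 ≤ 2 ^ 2 := by gcongr
    nlinarith
  calc 4 * Real.pi ^ 2 * w * (y * (1 - E)⁻¹ + E * ((1 - E)⁻¹) ^ 2)
      ≤ 4 * Real.pi ^ 2 * w * (4 * y + 4 * E) := by gcongr
    _ = 16 * Real.pi ^ 2 * (y * w + w * E) := by ring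
    _ ≤ 16 * Real.pi ^ 2 * (y * w + 1 * E) := by gcongr
    _ = _ := by ring

/-- An upper bound for `‖rowSum n y‖`. -/
def rowBound (y : ℝ) (n : ℤ) : ℝ :=
  16 * Real.pi ^ 2 * (y * rowWeight y n + (1 - y) * rowWeight (1 - y) n) +
    (16 * Real.pi ^ 2 + ∑' m : ℤ, ‖invSq m 0‖) * rowWeight 1 n

lemma norm_rowSum_le {y : ℝ} (hy : y ∈ Set.Ioo (0 : ℝ) 1) (n : ℤ) :
    ‖rowSum n (y : UnitAddCircle)‖ ≤ rowBound y n := by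
  have hw : ∀ z m, 0 < rowWeight z m := fun z m => by unfold rowWeight; positivity
  have hC : 0 ≤ ∑' m : ℤ, ‖invSq m 0‖ := tsum_nonneg fun _ => norm_nonneg _
  have hy0 := hy.1
  have hy1 : 0 < 1 - y := by linarith [hy.2]
  have := hw y n; have := hw (1 - y) n; have := hw 1 n
  rcases lt_trichotomy n 0 with hn | rfl | hn
  · obtain ⟨N, rfl⟩ : ∃ N : ℕ, n = -(N : ℤ) := ⟨n.natAbs, by omega⟩
    refine (norm_rowSum_le_of_pos (by omega) hy).trans ?_
    have e : ∀ z, rowWeight z (-(N : ℤ)) = rowWeight z N := fun z => by simp [rowWeight]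
    simp only [rowBound, e] at *
    have : 0 ≤ 16 * Real.pi ^ 2 * ((1 - y) * rowWeight (1 - y) N) := by positivity
    have : 0 ≤ (∑' m : ℤ, ‖invSq m 0‖) * rowWeight 1 N := by positivity
    linarith
  · have h1 : ‖rowSum 0 (y : UnitAddCircle)‖ ≤ ∑' m : ℤ, ‖invSq m 0‖ := by
      refine (norm_tsum_le_tsum_norm (summable_rowSum 0 _).norm).trans_eq ?_
      exact tsum_congr fun m => by rw [norm_mul, norm_fourier_apply, mul_one]
    refine h1.trans ?_
    have : rowWeight 1 0 = 1 := by simp [rowWeight]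
    rw [rowBound, this]
    have : 0 ≤ 16 * Real.pi ^ 2 * (y * rowWeight y 0 + (1 - y) * rowWeight (1 - y) 0) := by positivity
    nlinarith [Real.pi_pos]
  · obtain ⟨N, rfl⟩ : ∃ N : ℕ, n = (N : ℤ) := ⟨n.natAbs, by omega⟩
    -- Reversing the sign of the row amounts to `y ↦ 1 - y` on the circle.
    have h1 : rowSum N (y : UnitAddCircle) = rowSum (-N) ((1 - y : ℝ) : UnitAddCircle) := by
      have h0 : ((1 : ℝ) : UnitAddCircle) = 0 := AddCircle.coe_period 1
      rw [rowSum_neg]; congr 1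
      simp [h0]
    rw [h1]
    refine (norm_rowSum_le_of_pos (by omega) ⟨hy1, by linarith⟩).trans ?_
    simp only [rowBound] at *
    have : 0 ≤ 16 * Real.pi ^ 2 * (y * rowWeight y N) := by positivity
    have : 0 ≤ (∑' m : ℤ, ‖invSq m 0‖) * rowWeight 1 N := by positivity
    linarith

lemma summable_rowWeight {y : ℝ} (hy : 0 < y) : Summable (rowWeight y) :=
  (hasSum_pow_natAbs (Real.exp_pos _).le
    (Real.exp_lt_one_iff.mpr (by nlinarith [Real.pi_pos]))).summable

lemma mul_tsum_rowWeight_le {y : ℝ} (h0 : 0 < y) (h1 : y ≤ 1) : y * ∑' n, rowWeight y n ≤ 3 := by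
  have := (hasSum_pow_natAbs (Real.exp_pos (-(2 * Real.pi * y))).le
    (Real.exp_lt_one_iff.mpr (by nlinarith [Real.pi_pos]))).tsum_eq
  simp only [rowWeight]
  rw [this]
  exact mul_geometric_le h0 h1

lemma summable_rowBound {y : ℝ} (hy : y ∈ Set.Ioo (0 : ℝ) 1) : Summable (rowBound y) :=
  ((((summable_rowWeight hy.1).mul_left y).add
    ((summable_rowWeight (sub_pos.mpr hy.2)).mul_left (1 - y))).mul_left _).add
    ((summable_rowWeight one_pos).mul_left _)

/-- The bound is independent of `y`: the factors `y` and `1 - y` compensate the geometric series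
that they multiply. -/
lemma tsum_rowBound_le {y : ℝ} (hy : y ∈ Set.Ioo (0 : ℝ) 1) :
    ∑' n, rowBound y n ≤ 16 * Real.pi ^ 2 * 6 + (16 * Real.pi ^ 2 + ∑' m : ℤ, ‖invSq m 0‖) * 3 := by
  have s1 := (summable_rowWeight hy.1).mul_left y
  have s2 := (summable_rowWeight (sub_pos.mpr hy.2)).mul_left (1 - y)
  have s3 := summable_rowWeight one_pos
  have hC : 0 ≤ ∑' m : ℤ, ‖invSq m 0‖ := tsum_nonneg fun _ => norm_nonneg _
  simp only [rowBound]
  rw [Summable.tsum_add ((s1.add s2).mul_left _) (s3.mul_left _), tsum_mul_left, tsum_mul_left,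
    Summable.tsum_add s1 s2, tsum_mul_left, tsum_mul_left]
  have h1 := mul_tsum_rowWeight_le hy.1 hy.2.le
  have h2 := mul_tsum_rowWeight_le (sub_pos.mpr hy.2) (by linarith [hy.1])
  have h3 := mul_tsum_rowWeight_le one_pos le_rfl
  gcongr
  · linarith
  · linarith

/-- The two-dimensional torus. -/
abbrev T2 : Type := UnitAddTorus (Fin 2)

/-- The Fourier series with coefficients `(m + i n)⁻²`, summed by rows. -/
def rowSeries (x : T2) : ℂ := ∑' n : ℤ, rowSum n (x 0) * fourier n (x 1)

lemma summable_norm_rowSum {x : UnitAddCircle} (hx : x ≠ 0) : Summable fun n => ‖rowSum n x‖ := by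
  obtain ⟨y, hy, rfl⟩ := exists_coe_eq_of_ne_zero hx
  exact (summable_rowBound hy).of_nonneg_of_le (fun _ => norm_nonneg _) (norm_rowSum_le hy)

lemma exists_norm_rowSum_tsum_le : ∃ C, ∀ x : UnitAddCircle, x ≠ 0 → ∑' n, ‖rowSum n x‖ ≤ C :=
  ⟨_, fun x hx => by
    obtain ⟨y, hy, rfl⟩ := exists_coe_eq_of_ne_zero hx
    exact ((summable_norm_rowSum hx).tsum_le_tsum (norm_rowSum_le hy) (summable_rowBound hy)).trans
      (tsum_rowBound_le hy)⟩

lemma exists_norm_rowSeries_le : ∃ C, ∀ x : T2, x 0 ≠ 0 → ‖rowSeries x‖ ≤ C := by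
  obtain ⟨C, hC⟩ := exists_norm_rowSum_tsum_le
  refine ⟨C, fun x hx => le_trans ?_ (hC _ hx)⟩
  have : ∀ n, ‖rowSum n (x 0) * fourier n (x 1)‖ = ‖rowSum n (x 0)‖ := fun n => by
    rw [norm_mul, norm_fourier_apply, mul_one]
  refine (norm_tsum_le_tsum_norm ?_).trans_eq (tsum_congr this)
  simpa only [this] using summable_norm_rowSum hx

lemma rowWeight_anti {y z : ℝ} (h : y ≤ z) (n : ℤ) : rowWeight z n ≤ rowWeight y n := by
  unfold rowWeight
  gcongr

/-- On an arc δ < x₀ < 1 - δ the rows have a common summable majorant, so the series converges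
uniformly there. -/
lemma continuousAt_rowSeries {x : T2} (hx : x 0 ≠ 0) : ContinuousAt rowSeries x := by
  obtain ⟨y, hy, hyx⟩ := exists_coe_eq_of_ne_zero hx
  obtain ⟨δ, hδ0, hδ1, hδ2⟩ : ∃ δ, 0 < δ ∧ δ < y ∧ y < 1 - δ := by
    obtain ⟨δ, h0, h1⟩ := exists_between (lt_min hy.1 (sub_pos.mpr hy.2))
    exact ⟨δ, h0, h1.trans_le (min_le_left _ _), by linarith [h1.trans_le (min_le_right _ _)]⟩
  have hopen : IsOpen {x : T2 | x 0 ∈ ((↑) : ℝ → UnitAddCircle) '' Set.Ioo δ (1 - δ)} := by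
    have hmap : IsOpenMap ((↑) : ℝ → UnitAddCircle) := QuotientAddGroup.isOpenMap_coe
    exact (hmap _ isOpen_Ioo).preimage (continuous_apply (0 : Fin 2))
  refine ContinuousOn.continuousAt ?_ (hopen.mem_nhds ⟨y, ⟨hδ1, hδ2⟩, hyx⟩)
  refine continuousOn_tsum (u := fun n =>
    16 * Real.pi ^ 2 * (1 * rowWeight δ n + 1 * rowWeight δ n) +
    (16 * Real.pi ^ 2 + ∑' m : ℤ, ‖invSq m 0‖) * rowWeight 1 n) (fun n => ?_) ?_ ?_
  · exact (((continuous_rowSum n).comp (continuous_apply 0)).mul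
      (by fun_prop)).continuousOn
  · have := summable_rowWeight hδ0
    exact (((this.mul_left _).add (this.mul_left _)).mul_left _).add
      ((summable_rowWeight one_pos).mul_left _)
  · rintro n x ⟨z, hz, hzx⟩
    have hw : ∀ z m, 0 < rowWeight z m := fun z m => by unfold rowWeight; positivity
    have hz' : z ∈ Set.Ioo (0 : ℝ) 1 := ⟨hδ0.trans hz.1, by linarith [hz.2]⟩
    rw [norm_mul, norm_fourier_apply, mul_one, ← hzx]
    refine (norm_rowSum_le hz' n).trans ?_
    unfold rowBound
    have h1 := rowWeight_anti hz.1.le n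
    have h2 := rowWeight_anti (show δ ≤ 1 - z by linarith [hz.2]) n
    have h3 := hw δ n
    have h4 : z ≤ 1 := hz'.2.le
    have h5 : 1 - z ≤ 1 := by linarith [hz'.1]
    have h6 : 0 ≤ z := hz'.1.le
    have h7 : 0 ≤ 1 - z := by linarith
    have := (hw z n).le
    have := (hw (1 - z) n).le
    gcongr
end DDA

end

/-! ### The continuous representative on the torus and its symmetries. -/

noncomputable section
namespace DDA
attribute [local instance] instMeasureSpaceUnitAddCircle
  instIsAddHaarMeasureUnitAddCircleVolume instIsProbabilityMeasureUnitAddCircleVolume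

open UnitAddTorus

lemma half_ne_zero : ((1 / 2 : ℝ) : UnitAddCircle) ≠ 0 := by
  rw [Ne, AddCircle.coe_eq_zero_iff_of_mem_Ico (by norm_num)]
  norm_num

lemma neg_half : -((1 / 2 : ℝ) : UnitAddCircle) = ((1 / 2 : ℝ) : UnitAddCircle) := by
  have h0 : ((1 : ℝ) : UnitAddCircle) = 0 := AddCircle.coe_period 1
  rw [neg_eq_iff_add_eq_zero, ← AddCircle.coe_add, ← h0]
  norm_num

instance : Nontrivial UnitAddCircle := ⟨⟨_, 0, half_ne_zero⟩⟩

instance : NullSingletonClass (volume : Measure UnitAddCircle) := inferInstance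

lemma ae_coord_ne_zero (i : Fin 2) : ∀ᵐ x : T2, x i ≠ 0 :=
  compl_mem_ae_iff.2 (Measure.pi_hyperplane _ i 0)

lemma aestronglyMeasurable_of_continuousOn_coord {f : T2 → ℂ} (i : Fin 2)
    (hf : ContinuousOn f {x | x i ≠ 0}) : AEStronglyMeasurable f (volume : Measure T2) := by
  have hopen : IsOpen {x : T2 | x i ≠ 0} := isOpen_ne.preimage (continuous_apply i)
  have := hf.aestronglyMeasurable (μ := volume) hopen.measurableSet
  rwa [Measure.restrict_eq_self_of_ae_mem] at this
  exact ae_coord_ne_zero i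

lemma mFourier_apply_two (m : Fin 2 → ℤ) (x : T2) :
    mFourier m x = fourier (m 0) (x 0) * fourier (m 1) (x 1) := by
  simp [mFourier, Fin.prod_univ_two]

lemma norm_mFourier_apply (m : Fin 2 → ℤ) (x : T2) : ‖mFourier m x‖ = 1 := by
  rw [mFourier_apply_two, norm_mul, norm_fourier_apply, norm_fourier_apply, one_mul]

/-- Square integrable functions on the torus with the same Fourier coefficients agree. -/
lemma ae_eq_of_mFourierCoeff_eq {f g : T2 → ℂ} (hf : MemLp f 2) (hg : MemLp g 2)
    (h : ∀ m, mFourierCoeff f m = mFourierCoeff g m) : f =ᵐ[volume] g := by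
  have key : hf.toLp f = hg.toLp g := by
    apply mFourierBasis.repr.injective
    ext m
    rw [mFourierBasis_repr, mFourierBasis_repr]
    have h1 : mFourierCoeff (hf.toLp f) m = mFourierCoeff f m :=
      integral_congr_ae (by filter_upwards [hf.coeFn_toLp] with x hx; rw [hx])
    have h2 : mFourierCoeff (hg.toLp g) m = mFourierCoeff g m :=
      integral_congr_ae (by filter_upwards [hg.coeFn_toLp] with x hx; rw [hx])
    rw [h1, h2, h]
  exact (hf.coeFn_toLp.symm.trans (by rw [key])).trans hg.coeFn_toLp

lemma eqOn_of_mFourierCoeff_eq {f g : T2 → ℂ} (hf : MemLp f 2) (hg : MemLp g 2)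
    (h : ∀ m, mFourierCoeff f m = mFourierCoeff g m) {U : Set T2} (hU : IsOpen U)
    (hfc : ContinuousOn f U) (hgc : ContinuousOn g U) : Set.EqOn f g U :=
  Measure.eqOn_open_of_ae_eq (ae_restrict_of_ae (ae_eq_of_mFourierCoeff_eq hf hg h)) hU hfc hgc

lemma continuousOn_rowSeries : ContinuousOn rowSeries {x | x 0 ≠ 0} := fun _ hx =>
  (continuousAt_rowSeries hx).continuousWithinAt

lemma memLp_rowSeries : MemLp rowSeries 2 (volume : Measure T2) := by
  obtain ⟨C, hC⟩ := exists_norm_rowSeries_le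
  exact MemLp.of_bound (aestronglyMeasurable_of_continuousOn_coord 0 continuousOn_rowSeries) C
    ((ae_coord_ne_zero 0).mono hC)

/-- By Fubini: for almost every first coordinate the sum over rows converges absolutely, so the
integral in the second coordinate isolates one row, and the integral in the first isolates one of
its coefficients. -/
lemma mFourierCoeff_rowSeries (m : Fin 2 → ℤ) :
    mFourierCoeff rowSeries m = invSq (m 0) (m 1) := by
  have hi : Integrable (fun x : T2 => mFourier (-m) x • rowSeries x) := by
    refine (memLp_rowSeries.integrable (by norm_num)).bdd_mul (c := 1) ?_ ?_
    · exact (mFourier (-m)).continuous.aestronglyMeasurable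
    · exact Eventually.of_forall fun x => (norm_mFourier_apply _ x).le
  have e := (volume_preserving_finTwoArrow UnitAddCircle).symm
  rw [mFourierCoeff, ← e.integral_comp' (g := fun x : T2 => mFourier (-m) x • rowSeries x)]
  have hi' := (e.integrable_comp_emb (MeasurableEquiv.measurableEmbedding _)).mpr hi
  rw [show (volume : Measure (UnitAddCircle × UnitAddCircle)) = volume.prod volume from rfl] at hi' ⊢
  refine (integral_prod _ hi').trans ?_
  rw [ ← fourierCoeff_rowSum (m 1) (m 0)]
  refine integral_congr_ae ?_
  have h0 : ∀ᵐ x : UnitAddCircle, x ≠ 0 := compl_mem_ae_iff.2 (measure_singleton _)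
  filter_upwards [h0] with x hx
  have := fourierCoeff_tsum (summable_norm_rowSum hx) (m 1)
  rw [smul_eq_mul, ← this, fourierCoeff, ← integral_const_mul]
  refine integral_congr_ae (Eventually.of_forall fun y => ?_)
  simp only [Function.comp_apply, MeasurableEquiv.finTwoArrow, rowSeries, mFourier_apply_two]
  simp
  ring
/-- Quarter turn of the torus. -/
def quarterTurn : T2 ≃+ T2 where
  toFun x := ![x 1, -x 0]
  invFun x := ![-x 1, x 0]
  left_inv x := by ext i; fin_cases i <;> simp
  right_inv x := by ext i; fin_cases i <;> simp
  map_add' x y := by ext i; fin_cases i <;> simp [add_comm]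

/-- Reflection of the second coordinate of the torus. -/
def reflect : T2 ≃+ T2 where
  toFun x := ![x 0, -x 1]
  invFun x := ![x 0, -x 1]
  left_inv x := by ext i; fin_cases i <;> simp
  right_inv x := by ext i; fin_cases i <;> simp
  map_add' x y := by ext i; fin_cases i <;> simp [add_comm]

lemma continuous_quarterTurn : Continuous quarterTurn := by
  refine continuous_pi fun i => ?_
  fin_cases i
  · exact continuous_apply 1
  · exact (continuous_apply 0).neg

lemma continuous_reflect : Continuous reflect := by
  refine continuous_pi fun i => ?_
  fin_cases i
  · exact continuous_apply 0
  · exact (continuous_apply 1).neg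

lemma measurePreserving_addEquiv (σ : T2 ≃+ T2) (hσ : Continuous σ) :
    MeasurePreserving σ (volume : Measure T2) volume :=
  AddMonoidHom.measurePreserving (f := (σ : T2 →+ T2)) hσ σ.surjective rfl

lemma mFourierCoeff_comp_addEquiv (σ : T2 ≃+ T2) (hσ : Continuous σ) (f : T2 → ℂ)
    {m m' : Fin 2 → ℤ} (h : ∀ x, mFourier (-m) x = mFourier (-m') (σ x)) :
    mFourierCoeff (f ∘ σ) m = mFourierCoeff f m' := by
  have hemb : MeasurableEmbedding σ :=
    (hσ.isClosedEmbedding σ.injective).measurableEmbedding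
  rw [mFourierCoeff, mFourierCoeff,
    ← (measurePreserving_addEquiv σ hσ).integral_comp hemb fun x => mFourier (-m') x • f x]
  simp only [h, Function.comp_apply]

lemma quarterTurn_zero (x : T2) : quarterTurn x 0 = x 1 := rfl
lemma quarterTurn_one (x : T2) : quarterTurn x 1 = -x 0 := rfl
lemma reflect_zero (x : T2) : reflect x 0 = x 0 := rfl
lemma reflect_one (x : T2) : reflect x 1 = -x 1 := rfl

lemma mFourierCoeff_comp_quarterTurn (f : T2 → ℂ) (m : Fin 2 → ℤ) :
    mFourierCoeff (f ∘ quarterTurn) m = mFourierCoeff f ![m 1, -m 0] :=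
  mFourierCoeff_comp_addEquiv _ continuous_quarterTurn f fun x => by
    rw [mFourier_apply_two, mFourier_apply_two, quarterTurn_zero, quarterTurn_one]
    simp [fourier_apply, mul_comm]

lemma mFourierCoeff_comp_reflect (f : T2 → ℂ) (m : Fin 2 → ℤ) :
    mFourierCoeff (f ∘ reflect) m = mFourierCoeff f ![m 0, -m 1] :=
  mFourierCoeff_comp_addEquiv _ continuous_reflect f fun x => by
    rw [mFourier_apply_two, mFourier_apply_two, reflect_zero, reflect_one]
    simp [fourier_apply]

lemma mFourierCoeff_conj (f : T2 → ℂ) (m : Fin 2 → ℤ) :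
    mFourierCoeff (fun x => (starRingEnd ℂ) (f x)) m = (starRingEnd ℂ) (mFourierCoeff f (-m)) := by
  rw [mFourierCoeff, mFourierCoeff, ← integral_conj]
  congr 1; ext x
  rw [smul_eq_mul, smul_eq_mul, map_mul, mFourier_neg, neg_neg]

lemma mFourierCoeff_neg_fun (f : T2 → ℂ) (m : Fin 2 → ℤ) :
    mFourierCoeff (fun x => -f x) m = -mFourierCoeff f m := by
  simp [mFourierCoeff, integral_neg]

/-- Both sides have the coefficients (m + i n)⁻² by `invSq_rot` and are continuous where no
coordinate vanishes. This is the compatibility that glues the two formulas in `torusSeries`. -/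
lemma rowSeries_quarterTurn {x : T2} (h0 : x 0 ≠ 0) (h1 : x 1 ≠ 0) :
    -rowSeries (quarterTurn x) = rowSeries x := by
  refine eqOn_of_mFourierCoeff_eq (f := fun x => -rowSeries (quarterTurn x))
    (U := {x | x 0 ≠ 0} ∩ {x | x 1 ≠ 0}) ?_ memLp_rowSeries
    (fun m => ?_) ?_ ?_ (continuousOn_rowSeries.mono Set.inter_subset_left) ⟨h0, h1⟩
  · exact (memLp_rowSeries.comp_measurePreserving
      (measurePreserving_addEquiv _ continuous_quarterTurn)).neg
  · rw [mFourierCoeff_neg_fun, show (fun x => rowSeries (quarterTurn x)) = rowSeries ∘ quarterTurn from rfl,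
      mFourierCoeff_comp_quarterTurn, mFourierCoeff_rowSeries, mFourierCoeff_rowSeries]
    simp [invSq_rot]
  · exact (isOpen_ne.preimage (continuous_apply 0)).inter (isOpen_ne.preimage (continuous_apply 1))
  · exact (continuousOn_rowSeries.comp continuous_quarterTurn.continuousOn
      fun x hx => hx.2).neg

/-- The function on the torus with Fourier coefficients `(m + i n)⁻²`, continuous away from `0`. -/
def torusSeries (x : T2) : ℂ :=
  if x 0 ≠ 0 then rowSeries x else -rowSeries (quarterTurn x)

lemma torusSeries_of_zero {x : T2} (h : x 0 ≠ 0) : torusSeries x = rowSeries x := if_pos h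

lemma torusSeries_of_one {x : T2} (h : x 1 ≠ 0) :
    torusSeries x = -rowSeries (quarterTurn x) := by
  by_cases h0 : x 0 = 0
  · simp [torusSeries, h0]
  · rw [torusSeries_of_zero h0, rowSeries_quarterTurn h0 h]

lemma T2_ne_zero_iff {x : T2} : x ≠ 0 ↔ x 0 ≠ 0 ∨ x 1 ≠ 0 := by
  rw [Ne, funext_iff, Fin.forall_fin_two, not_and_or]; rfl

lemma continuousAt_torusSeries {x : T2} (hx : x ≠ 0) : ContinuousAt torusSeries x := by
  rcases T2_ne_zero_iff.mp hx with h | h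
  · refine (continuousAt_rowSeries h).congr ?_
    filter_upwards [(isOpen_ne.preimage (continuous_apply (0 : Fin 2))).mem_nhds h] with y hy
    exact (torusSeries_of_zero hy).symm
  · refine ((continuousAt_rowSeries (x := quarterTurn x) h).comp
      continuous_quarterTurn.continuousAt).neg.congr ?_
    filter_upwards [(isOpen_ne.preimage (continuous_apply (1 : Fin 2))).mem_nhds h] with y hy
    exact (torusSeries_of_one hy).symm

lemma exists_norm_torusSeries_le : ∃ C, ∀ x : T2, x ≠ 0 → ‖torusSeries x‖ ≤ C := by
  obtain ⟨C, hC⟩ := exists_norm_rowSeries_le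
  refine ⟨C, fun x hx => ?_⟩
  rcases T2_ne_zero_iff.mp hx with h | h
  · rw [torusSeries_of_zero h]; exact hC x h
  · rw [torusSeries_of_one h, norm_neg]; exact hC _ h

lemma torusSeries_ae_eq : torusSeries =ᵐ[volume] rowSeries :=
  (ae_coord_ne_zero 0).mono fun _ hx => torusSeries_of_zero hx

lemma memLp_torusSeries : MemLp torusSeries 2 (volume : Measure T2) :=
  (memLp_congr_ae torusSeries_ae_eq).mpr memLp_rowSeries

lemma mFourierCoeff_torusSeries (m : Fin 2 → ℤ) :
    mFourierCoeff torusSeries m = invSq (m 0) (m 1) := by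
  rw [← mFourierCoeff_rowSeries]
  exact integral_congr_ae (torusSeries_ae_eq.mono fun x hx => by simp only [hx])

lemma continuousOn_torusSeries : ContinuousOn torusSeries {0}ᶜ := fun _ hx =>
  (continuousAt_torusSeries hx).continuousWithinAt

lemma torusSeries_quarterTurn {x : T2} (hx : x ≠ 0) :
    torusSeries (quarterTurn x) = -torusSeries x := by
  refine eqOn_of_mFourierCoeff_eq (f := torusSeries ∘ quarterTurn) (g := fun x => -torusSeries x)
    (U := {0}ᶜ) (memLp_torusSeries.comp_measurePreserving
      (measurePreserving_addEquiv _ continuous_quarterTurn)) memLp_torusSeries.neg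
    (fun m => ?_) isOpen_compl_singleton ?_ continuousOn_torusSeries.neg hx
  · rw [mFourierCoeff_neg_fun, mFourierCoeff_comp_quarterTurn, mFourierCoeff_torusSeries,
      mFourierCoeff_torusSeries]
    simp [invSq_rot]
  · exact continuousOn_torusSeries.comp continuous_quarterTurn.continuousOn
      fun x hx h => hx (by simpa using h)

lemma torusSeries_reflect {x : T2} (hx : x ≠ 0) :
    torusSeries (reflect x) = (starRingEnd ℂ) (torusSeries x) := by
  refine eqOn_of_mFourierCoeff_eq (f := torusSeries ∘ reflect)
    (g := fun x => (starRingEnd ℂ) (torusSeries x))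
    (U := {0}ᶜ) (memLp_torusSeries.comp_measurePreserving
      (measurePreserving_addEquiv _ continuous_reflect)) memLp_torusSeries.star
    (fun m => ?_) isOpen_compl_singleton ?_
      (Complex.continuous_conj.comp_continuousOn continuousOn_torusSeries) hx
  · rw [mFourierCoeff_conj, mFourierCoeff_comp_reflect, mFourierCoeff_torusSeries,
      mFourierCoeff_torusSeries]
    rw [Pi.neg_apply, Pi.neg_apply, invSq_neg_neg, ← invSq_neg_right]; rfl
  · exact continuousOn_torusSeries.comp continuous_reflect.continuousOn
      fun x hx h => hx (by simpa using h)

/-- The reflection conjugates the series. If the second coordinate is its own negative, the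
reflection fixes the point; if the first one is, the reflection acts on the point as two quarter
turns, whose signs cancel. -/
lemma torusSeries_im_eq_zero {x : T2} (hx : x ≠ 0) {i : Fin 2} (hi : -x i = x i) :
    (torusSeries x).im = 0 := by
  have key : torusSeries (reflect x) = torusSeries x := by
    fin_cases i
    · have h1 : reflect x = quarterTurn (quarterTurn x) := by
        ext j; fin_cases j
        · exact hi.symm
        · rfl
      have hq : quarterTurn x ≠ 0 := by simpa using hx
      rw [h1, torusSeries_quarterTurn hq, torusSeries_quarterTurn hx, neg_neg]
    · congr 1; ext j; fin_cases j
      · rfl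
      · exact hi
  exact Complex.conj_eq_iff_im.mp ((torusSeries_reflect hx).symm.trans key)

/-- The point is fixed by the quarter turn, which changes the sign of the series. -/
lemma torusSeries_half_half :
    torusSeries ![((1 / 2 : ℝ) : UnitAddCircle), ((1 / 2 : ℝ) : UnitAddCircle)] = 0 := by
  set x : T2 := ![((1 / 2 : ℝ) : UnitAddCircle), ((1 / 2 : ℝ) : UnitAddCircle)]
  have hx : x ≠ 0 := T2_ne_zero_iff.mpr (Or.inl half_ne_zero)
  have h1 : quarterTurn x = x := by
    ext j; fin_cases j
    · rfl
    · exact neg_half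
  have := torusSeries_quarterTurn hx
  rw [h1] at this
  exact CharZero.eq_neg_self_iff.mp this
end DDA

end

/-! ### Passage from the torus to the plane, and uniqueness of Fourier sums. -/

noncomputable section
namespace DDA
attribute [local instance] instMeasureSpaceUnitAddCircle
  instIsAddHaarMeasureUnitAddCircleVolume instIsProbabilityMeasureUnitAddCircleVolume

open UnitAddTorus

/-- The quotient map from the plane to `ℝ² / 2πℤ²`. -/
def proj (τ : Plane) : T2 := fun i => ((τ i / (2 * Real.pi) : ℝ) : UnitAddCircle)

lemma continuous_proj : Continuous proj :=
  continuous_pi fun i => (AddCircle.continuous_mk' 1).comp (by fun_prop)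

lemma proj_add_period (τ : Plane) (m : Fin 2 → ℤ) :
    proj (τ + (2 * Real.pi) • latticePoint m) = proj τ := by
  have hpi : (2 * Real.pi) ≠ 0 := by positivity
  ext i
  have : (τ + (2 * Real.pi) • latticePoint m) i / (2 * Real.pi) = τ i / (2 * Real.pi) + m i • (1 : ℝ) := by
    simp only [latticePoint, PiLp.add_apply, PiLp.smul_apply, smul_eq_mul, zsmul_eq_mul, mul_one]
    field_simp
  simp only [proj]
  rw [this, AddCircle.coe_add, AddCircle.coe_zsmul, AddCircle.coe_period]
  simp

lemma proj_eq_zero_iff {τ : Plane} : proj τ = 0 ↔ τ ∈ periodLattice := by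
  have hpi : (2 * Real.pi) ≠ 0 := by positivity
  constructor
  · intro h
    have h1 : ∀ i, ∃ n : ℤ, n • (1 : ℝ) = τ i / (2 * Real.pi) := fun i =>
      (AddCircle.coe_eq_zero_iff 1).mp (congrFun h i)
    choose m hm using h1
    refine ⟨m, ?_⟩
    ext i
    have := hm i
    simp only [latticePoint, PiLp.smul_apply, smul_eq_mul, zsmul_eq_mul, mul_one] at this ⊢
    rw [this]; field_simp
  · rintro ⟨m, rfl⟩
    have := proj_add_period 0 m
    rw [zero_add] at this
    simp only [this]
    ext i; simp [proj]

lemma isOpen_compl_periodLattice : IsOpen periodLatticeᶜ := by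
  have : periodLattice = proj ⁻¹' {0} := by ext τ; exact proj_eq_zero_iff.symm
  rw [this]
  exact (isClosed_singleton.preimage continuous_proj).isOpen_compl

lemma mFourier_proj (m : Fin 2 → ℤ) (τ : Plane) :
    mFourier m (proj τ) = Complex.exp (Complex.I * ∑ i, (m i : ℂ) * (τ i : ℂ)) := by
  have hpi : (Real.pi : ℂ) ≠ 0 := by exact_mod_cast Real.pi_ne_zero
  rw [mFourier_apply_two]
  simp only [proj]
  rw [fourier_coe_apply, fourier_coe_apply, ← Complex.exp_add,
    Fin.sum_univ_two]
  congr 1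
  push_cast
  field_simp

/-- Up to a null set `Q` is a fundamental domain, of area (2π)², while the torus has mass 1. Hence
L² norms over `Q` are 2π times those on the torus. -/
lemma measurePreserving_proj : MeasurePreserving proj
    (ENNReal.ofReal (((2 * Real.pi) ^ 2)⁻¹) • volume.restrict Q) volume := by
  have hpi : 0 < 2 * Real.pi := by positivity
  set Q' : Set Plane := {τ | ∀ i, τ i ∈ Set.Ioc (-Real.pi) Real.pi} with hQ'
  have e := EuclideanSpace.volume_preserving_symm_measurableEquiv_toLp (Fin 2)
  have hQQ : (volume : Measure Plane).restrict Q = volume.restrict Q' := by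
    refine Measure.restrict_congr_set ?_
    have h1 : (Set.univ.pi fun _ : Fin 2 => Set.Ioc (-Real.pi) Real.pi) =ᵐ[volume]
        (Set.Icc (fun _ : Fin 2 => -Real.pi) (fun _ => Real.pi)) :=
      Measure.univ_pi_Ioc_ae_eq_Icc
    have h2 := e.quasiMeasurePreserving.preimage_ae_eq h1
    refine Filter.EventuallyEq.trans ?_ (h2.symm.trans ?_)
    · refine Filter.EventuallyEq.of_eq ?_
      refine Set.ext fun τ => ?_
      show (∀ i, -Real.pi ≤ τ i ∧ τ i ≤ Real.pi) ↔ (∀ i, -Real.pi ≤ τ i) ∧ ∀ i, τ i ≤ Real.pi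
      exact forall_and
    · refine Filter.EventuallyEq.of_eq ?_
      refine Set.ext fun τ => ?_
      simp only [Set.mem_preimage, Set.mem_univ_pi]
      rfl
  refine ⟨continuous_proj.measurable, ?_⟩
  ext s hs
  rw [Measure.map_apply continuous_proj.measurable hs, hQQ, Measure.smul_apply,
    Measure.restrict_apply (continuous_proj.measurable hs)]
  have hm : Measurable fun x : Fin 2 → ℝ => (fun i => (x i : UnitAddCircle) : T2) :=
    measurable_pi_lambda _ fun i => AddCircle.measurable_mk'.comp (measurable_pi_apply i)
  -- The unit cell is based at -1/2, so that division by 2π carries `Q'` onto it.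
  have h1 : volume s = volume
      ({x : Fin 2 → ℝ | ∀ i, x i ∈ Set.Ioc (-1 / 2 : ℝ) (-1 / 2 + 1)} ∩
        (fun x : Fin 2 → ℝ => (fun i => (x i : UnitAddCircle) : T2)) ⁻¹' s) := by
    have := lintegral_preimage (s.indicator 1) (fun _ : Fin 2 => (-1 / 2 : ℝ))
    rw [lintegral_indicator_one hs] at this
    rw [this, show (fun x : Fin 2 → ℝ => s.indicator (1 : T2 → ENNReal) (fun i => (x i : UnitAddCircle))) =
      ((fun x : Fin 2 → ℝ => (fun i => (x i : UnitAddCircle) : T2)) ⁻¹' s).indicator 1 from rfl,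
      lintegral_indicator_one (hm hs), Measure.restrict_apply (hm hs), Set.inter_comm]
  have h2 : proj ⁻¹' s ∩ Q' = (WithLp.ofLp : Plane → Fin 2 → ℝ) ⁻¹' ((fun x => (2 * Real.pi)⁻¹ • x) ⁻¹'
      ({x : Fin 2 → ℝ | ∀ i, x i ∈ Set.Ioc (-1 / 2 : ℝ) (-1 / 2 + 1)} ∩
        (fun x : Fin 2 → ℝ => (fun i => (x i : UnitAddCircle) : T2)) ⁻¹' s)) := by
    ext τ
    have h3 : ∀ t : ℝ, t ∈ Set.Ioc (-Real.pi) Real.pi ↔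
        (2 * Real.pi)⁻¹ * t ∈ Set.Ioc (-1 / 2 : ℝ) (-1 / 2 + 1) := by
      intro t
      rw [Set.mem_Ioc, Set.mem_Ioc, inv_mul_eq_div, lt_div_iff₀ hpi, div_le_iff₀ hpi]
      constructor <;> rintro ⟨h, h'⟩ <;> constructor <;> linarith
    have h4 : proj τ = fun i => (((2 * Real.pi)⁻¹ * τ i : ℝ) : UnitAddCircle) := by
      ext i; simp only [proj]; rw [div_eq_inv_mul]
    simp only [Q', Set.mem_inter_iff, Set.mem_preimage, Set.mem_ofPred_eq, h3, h4, Pi.smul_apply,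
      smul_eq_mul]
    exact and_comm
  have h5 := e.measure_preimage_equiv ((fun x : Fin 2 → ℝ => (2 * Real.pi)⁻¹ • x) ⁻¹'
      ({x : Fin 2 → ℝ | ∀ i, x i ∈ Set.Ioc (-1 / 2 : ℝ) (-1 / 2 + 1)} ∩
        (fun x : Fin 2 → ℝ => (fun i => (x i : UnitAddCircle) : T2)) ⁻¹' s))
  rw [h2]
  refine (congrArg _ h5).trans ?_
  rw [Measure.addHaar_preimage_smul _ (by positivity), ← h1, smul_eq_mul, ← mul_assoc,
    ← ENNReal.ofReal_mul (by positivity)]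
  have : ((2 * Real.pi) ^ 2)⁻¹ * |(((2 * Real.pi)⁻¹) ^ Module.finrank ℝ (Fin 2 → ℝ))⁻¹| = 1 := by
    rw [abs_of_nonneg (by positivity)]
    simp only [Module.finrank_fin_fun]
    field_simp
  rw [this, ENNReal.ofReal_one, one_mul]

lemma isFourierSum_comp_proj {f : T2 → ℂ} {k : (Fin 2 → ℤ) → ℂ} (hf : MemLp f 2)
    (hc : ContinuousOn f {0}ᶜ) (hk : ∀ m, mFourierCoeff f m = k m) (hk0 : k 0 = 0) :
    IsFourierSum k (fun τ => f (proj τ)) where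
  periodic m τ := by rw [proj_add_period]
  continuousOn := hc.comp continuous_proj.continuousOn fun τ hτ h => hτ (proj_eq_zero_iff.mp h)
  tendsto := by
    have h1 := hasSum_mFourier_series_L2 (hf.toLp f)
    have hk' : ∀ m, mFourierCoeff (hf.toLp f) m = k m := fun m => by
      rw [← hk]
      exact integral_congr_ae (by filter_upwards [hf.coeFn_toLp] with x hx; rw [hx])
    simp only [hk'] at h1
    have h2 := tendsto_iff_norm_sub_tendsto_zero.mp h1
    have h3 : ∀ s : Finset (Fin 2 → ℤ), eLpNorm (fun τ : Plane => (∑ m ∈ s.erase 0,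
        k m * Complex.exp (Complex.I * ∑ i, (m i : ℂ) * (τ i : ℂ))) - f (proj τ)) 2
        (volume.restrict Q) = ENNReal.ofReal (2 * Real.pi) *
        ENNReal.ofReal ‖∑ m ∈ s, k m • mFourierLp 2 m - hf.toLp f‖ := by
      intro s
      set g : T2 → ℂ := fun x => ∑ m ∈ s, k m * mFourier m x - f x with hg
      have hgm : MemLp g 2 := by
        refine MemLp.sub ?_ hf
        refine memLp_finsetSum _ fun m _ => MemLp.const_mul ?_ _
        exact MemLp.of_bound (mFourier m).continuous.aestronglyMeasurable 1
          (Eventually.of_forall fun x => (norm_mFourier_apply m x).le)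
      have e1 : (fun τ : Plane => (∑ m ∈ s.erase 0,
          k m * Complex.exp (Complex.I * ∑ i, (m i : ℂ) * (τ i : ℂ))) - f (proj τ)) = g ∘ proj := by
        ext τ
        simp only [hg, Function.comp_apply, mFourier_proj]
        congr 1
        -- The sums in the plane omit the index 0 and those on the torus do not; they agree because
        -- `k 0 = 0`.
        by_cases h0 : (0 : Fin 2 → ℤ) ∈ s
        · rw [← Finset.add_sum_erase _ _ h0, hk0, zero_mul, zero_add]
        · rw [Finset.erase_eq_of_notMem h0]
      have e2 : ENNReal.ofReal ‖∑ m ∈ s, k m • mFourierLp 2 m - hf.toLp f‖ = eLpNorm g 2 := by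
        rw [ofReal_norm, Lp.enorm_def]
        refine eLpNorm_congr_ae ?_
        have hsum : ∀ s : Finset (Fin 2 → ℤ),
            ((∑ m ∈ s, k m • mFourierLp 2 m : Lp ℂ 2 (volume : Measure T2)) : T2 → ℂ) =ᵐ[volume]
            fun x => ∑ m ∈ s, k m * mFourier m x := by
          intro s
          have h4 := Lp.coeFn_finsetSum s (fun m => k m • mFourierLp (d := Fin 2) 2 m)
          refine h4.trans ?_
          have h5 : ∀ᵐ x : T2, ∀ m : Fin 2 → ℤ,
              (k m • mFourierLp 2 m : Lp ℂ 2 (volume : Measure T2)) x = k m * mFourier m x := by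
            rw [ae_all_iff]
            intro m
            filter_upwards [Lp.coeFn_smul (k m) (mFourierLp (d := Fin 2) 2 m),
              coeFn_mFourierLp 2 m] with x hx hx'
            rw [hx, Pi.smul_apply, hx', smul_eq_mul]
          filter_upwards [h5] with x hx
          rw [Finset.sum_apply]
          exact Finset.sum_congr rfl fun m _ => hx m
        filter_upwards [Lp.coeFn_sub (∑ m ∈ s, k m • mFourierLp 2 m) (hf.toLp f), hsum s,
          hf.coeFn_toLp] with x hx hx1 hx2
        rw [hx, Pi.sub_apply, hx1, hx2]
      rw [e1, e2, ← eLpNorm_comp_measurePreserving hgm.1 measurePreserving_proj,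
        eLpNorm_smul_measure_of_ne_top (by norm_num), smul_eq_mul, ← mul_assoc]
      have : ENNReal.ofReal (2 * Real.pi) *
          ENNReal.ofReal ((2 * Real.pi) ^ 2)⁻¹ ^ ((1 / 2 : ENNReal).toReal) = 1 := by
        rw [ENNReal.ofReal_rpow_of_pos (by positivity), ← ENNReal.ofReal_mul (by positivity)]
        have : (((2 * Real.pi) ^ 2)⁻¹ : ℝ) ^ ((1 / 2 : ENNReal).toReal) = (2 * Real.pi)⁻¹ := by
          rw [ENNReal.toReal_div, ENNReal.toReal_one, ENNReal.toReal_ofNat, ← Real.sqrt_eq_rpow, Real.sqrt_inv, Real.sqrt_sq (by positivity)]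
        rw [this, mul_inv_cancel₀ (by positivity), ENNReal.ofReal_one]
      rw [this, one_mul]
    simp only [h3]
    have h6 := (ENNReal.tendsto_ofReal h2)
    rw [ENNReal.ofReal_zero] at h6
    have h7 := ENNReal.Tendsto.const_mul (a := ENNReal.ofReal (2 * Real.pi)) h6
      (Or.inr ENNReal.ofReal_ne_top)
    rwa [mul_zero] at h7

lemma countable_periodLattice : periodLattice.Countable := Set.countable_range _

lemma Q_inter_periodLattice {τ : Plane} (hτ : τ ∈ Q) (h0 : τ ≠ 0) : τ ∉ periodLattice := by
  rintro ⟨m, rfl⟩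
  apply h0
  have hm : ∀ i, m i = 0 := by
    intro i
    have := hτ i
    simp only [latticePoint, PiLp.smul_apply, smul_eq_mul, Set.mem_Icc] at this
    have hpi := Real.pi_pos
    have h1 : (m i : ℝ) < 1 := by nlinarith
    have h2 : (-1 : ℝ) < m i := by nlinarith
    have h1' : m i < 1 := by exact_mod_cast h1
    have h2' : -1 < m i := by exact_mod_cast h2
    omega
  ext i
  simp [latticePoint, hm]

lemma isClosed_Q : IsClosed Q := by
  have : Q = ⋂ i : Fin 2, {τ : Plane | τ i ∈ Set.Icc (-Real.pi) Real.pi} := by ext; simp [Q]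
  rw [this]
  exact isClosed_iInter fun i => isClosed_Icc.preimage (by fun_prop)

lemma convex_Q : Convex ℝ Q := by
  intro x hx y hy a b ha hb hab i
  exact convex_Icc _ _ (hx i) (hy i) ha hb hab

lemma interior_Q : interior Q = {τ : Plane | ∀ i, τ i ∈ Set.Ioo (-Real.pi) Real.pi} := by
  have h : Q = (EuclideanSpace.equiv (Fin 2) ℝ).toHomeomorph ⁻¹'
      (Set.univ.pi fun _ => Set.Icc (-Real.pi) Real.pi) := by
    refine Set.ext fun τ => ?_
    simp only [Set.mem_preimage, Set.mem_univ_pi]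
    rfl
  rw [h, ← Homeomorph.preimage_interior, interior_pi_set Set.finite_univ]
  ext; simp

lemma IsFourierSum.aestronglyMeasurable {k : (Fin 2 → ℤ) → ℂ} {f : Plane → ℂ}
    (hf : IsFourierSum k f) : AEStronglyMeasurable f (volume.restrict Q) := by
  have := hf.continuousOn.aestronglyMeasurable (μ := volume)
    isOpen_compl_periodLattice.measurableSet
  rw [Measure.restrict_eq_self_of_ae_mem] at this
  · exact this.restrict
  · exact compl_mem_ae_iff.mpr (countable_periodLattice.measure_zero _)

/-- The sum of a Fourier series is determined by its coefficients. -/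
lemma IsFourierSum.eqOn {k : (Fin 2 → ℤ) → ℂ} {f g : Plane → ℂ} (hf : IsFourierSum k f)
    (hg : IsFourierSum k g) : Set.EqOn f g (Q ∩ periodLatticeᶜ) := by
  have hae : f =ᵐ[volume.restrict Q] g := by
    have hz : eLpNorm (fun τ => f τ - g τ) 2 (volume.restrict Q) = 0 := by
      have hlim := hf.tendsto.add hg.tendsto
      rw [add_zero] at hlim
      refine le_antisymm (ge_of_tendsto' hlim fun s => ?_) zero_le
      have hcont : Continuous fun τ : Plane => ∑ m ∈ s.erase 0,
          k m * Complex.exp (Complex.I * ∑ i, (m i : ℂ) * (τ i : ℂ)) := by fun_prop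
      have h1 := (hcont.aestronglyMeasurable (μ := volume.restrict Q)).sub hf.aestronglyMeasurable
      have h2 := (hcont.aestronglyMeasurable (μ := volume.restrict Q)).sub hg.aestronglyMeasurable
      have := eLpNorm_sub_le h2 h1 (p := 2) (by norm_num)
      rw [add_comm]
      refine le_trans (le_of_eq ?_) this
      congr 1; ext τ; simp
    have hz' := (eLpNorm_eq_zero_iff (hf.aestronglyMeasurable.sub hg.aestronglyMeasurable)
      (by norm_num)).mp hz
    filter_upwards [hz'] with τ hτ
    exact sub_eq_zero.mp hτ
  refine Measure.eqOn_of_ae_eq (μ := volume)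
    (ae_restrict_of_ae_restrict_of_subset Set.inter_subset_left hae)
    (hf.continuousOn.mono Set.inter_subset_right) (hg.continuousOn.mono Set.inter_subset_right) ?_
  -- Almost everywhere equality extends by continuity, since the set lies in the closure of its
  -- interior: `Q` is convex with interior points, and the complement of the lattice is open and
  -- dense.
  rw [interior_inter, isOpen_compl_periodLattice.interior_eq]
  have h0 : (interior Q).Nonempty := ⟨0, by rw [interior_Q]; intro i; simp [Real.pi_pos]⟩
  have hd : Dense periodLatticeᶜ := countable_periodLattice.dense_compl ℝ
  intro τ hτ
  have h1 : τ ∈ closure (interior Q) := by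
    rw [convex_Q.closure_interior_eq_closure_of_nonempty_interior h0]
    exact subset_closure hτ.1
  exact closure_minimal (hd.open_subset_closure_inter isOpen_interior) isClosed_closure h1
end DDA

end

/-! ### The value at (1/2, 0) through Eisenstein series and ℘. -/

noncomputable section
namespace DDA
open EisensteinSeries

lemma hasSum_int_even_odd {f : ℤ → ℂ} {a b : ℂ} (he : HasSum (fun k => f (2 * k)) a)
    (ho : HasSum (fun k => f (2 * k - 1)) b) : HasSum f (a + b) := by
  have i1 : Function.Injective fun k : ℤ => 2 * k := fun a b h => by simpa using h
  have i2 : Function.Injective fun k : ℤ => 2 * k - 1 := fun a b h => by simpa using h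
  have h1 := i1.hasSum_range_iff.mpr he
  have h2 := i2.hasSum_range_iff.mpr ho
  refine h1.add_isCompl ?_ h2
  have e1 : Set.range (fun k : ℤ => 2 * k) = {n | Even n} := by
    ext n; simp [even_iff_exists_two_mul]
  have e2 : Set.range (fun k : ℤ => 2 * k - 1) = {n | Odd n} := by
    ext n
    constructor
    · rintro ⟨k, rfl⟩; exact ⟨k - 1, by ring⟩
    · rintro ⟨k, rfl⟩; exact ⟨k + 1, by ring⟩
  rw [e1, e2]
  exact Int.isCompl_even_odd

/-- The point `i t` of the upper half-plane. -/
def imagPoint (t : ℝ) (ht : 0 < t) : UpperHalfPlane := ⟨t * Complex.I, by simpa using ht⟩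

lemma coe_imagPoint (t : ℝ) (ht : 0 < t) : (imagPoint t ht : ℂ) = t * Complex.I := rfl

lemma hasSum_e2Summand (n : ℤ) (t : ℝ) (ht : 0 < t) :
    HasSum (fun m : ℤ => (((m : ℂ) + n * (t * Complex.I)) ^ 2)⁻¹) (e2Summand n (imagPoint t ht)) := by
  refine (e2Summand_summable n (imagPoint t ht)).hasSum.congr_fun fun m => ?_
  simp [eisSummand, coe_imagPoint, add_comm]

lemma hasSum_symmetricIcc {f : ℤ → ℂ} {a : ℂ} (h : HasSum f a) :
    HasSum f a (SummationFilter.symmetricIcc ℤ) :=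
  Tendsto.mono_left h SummationFilter.LeAtTop.le_atTop

lemma hasSum_e2Summand_G2 (z : UpperHalfPlane) :
    HasSum (fun n => e2Summand n z) (G2 z) (SummationFilter.symmetricIcc ℤ) :=
  (summable_e2Summand_symmetricIcc z).hasSum

lemma G2_imagPoint_inv (t : ℝ) (ht : 0 < t) :
    G2 (imagPoint t⁻¹ (inv_pos.mpr ht)) = 2 * Real.pi * t - t ^ 2 * G2 (imagPoint t ht) := by
  have h := G2_S_transform (imagPoint t ht)
  have ht' : (t : ℂ) ≠ 0 := by exact_mod_cast ht.ne'
  have hS : ModularGroup.S • imagPoint t ht = imagPoint t⁻¹ (inv_pos.mpr ht) := by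
    rw [UpperHalfPlane.modular_S_smul]
    ext
    show (-((t : ℂ) * Complex.I))⁻¹ = ((t⁻¹ : ℝ) : ℂ) * Complex.I
    push_cast
    rw [inv_neg, mul_inv, Complex.inv_I]; ring
  rw [hS, coe_imagPoint, mul_pow, Complex.I_sq] at h
  rw [h]
  field_simp
  ring

/-- At the fixed point `i` of inversion the quasi-modular relation becomes a linear equation for the
value. -/
lemma G2_I : G2 (imagPoint 1 one_pos) = Real.pi := by
  have := G2_imagPoint_inv 1 one_pos
  simp only [inv_one, Complex.ofReal_one, mul_one, one_pow, one_mul] at this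
  linear_combination this / 2

/-- The character at 1/2 is (-1)^m = (1 + (-1)^m) - 1: twice the sum over even `m`, a rescaled row
at i/2, minus the full row at `i`. -/
lemma rowSum_half (n : ℤ) : rowSum n ((1 / 2 : ℝ) : UnitAddCircle) =
    2⁻¹ * e2Summand n (imagPoint 2⁻¹ (by norm_num)) - e2Summand n (imagPoint 1 one_pos) := by
  have hf : ∀ m : ℤ, (fourier m ((1 / 2 : ℝ) : UnitAddCircle) : ℂ) = (-1) ^ m := by
    intro m
    rw [fourier_coe_apply, ← Complex.exp_pi_mul_I, ← Complex.exp_int_mul]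
    congr 1; push_cast; ring
  have h1 : HasSum (fun m : ℤ => invSq m n) (e2Summand n (imagPoint 1 one_pos)) := by
    refine (hasSum_e2Summand n 1 one_pos).congr_fun fun m => ?_
    simp [invSq]
  have h2 : HasSum (fun k : ℤ => invSq (2 * k) n)
      (4⁻¹ * e2Summand n (imagPoint 2⁻¹ (by norm_num))) := by
    refine ((hasSum_e2Summand n 2⁻¹ (by norm_num)).mul_left 4⁻¹).congr_fun fun m => ?_
    rw [invSq, ← mul_inv]
    congr 1; push_cast; ring
  have h3 : HasSum (fun m : ℤ => (1 + (-1 : ℂ) ^ m) * invSq m n)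
      (2⁻¹ * e2Summand n (imagPoint 2⁻¹ (by norm_num)) + 0) := by
    refine hasSum_int_even_odd ?_ ?_
    · have e : 2⁻¹ * e2Summand n (imagPoint 2⁻¹ (by norm_num)) =
          2 * (4⁻¹ * e2Summand n (imagPoint 2⁻¹ (by norm_num))) := by ring
      rw [e]
      refine (h2.mul_left 2).congr_fun fun k => ?_
      rw [(even_two_mul k).neg_one_zpow]; norm_num
    · refine hasSum_zero.congr_fun fun k => ?_
      have : Odd (2 * k - 1) := ⟨k - 1, by ring⟩
      rw [this.neg_one_zpow]; simp
  have h4 := h3.sub h1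
  rw [add_zero] at h4
  rw [rowSum, ← h4.tsum_eq]
  refine tsum_congr fun m => ?_
  rw [hf]; ring

/-- `G2` is summed over symmetric intervals of rows, so the absolutely summable rows on the left are
compared with it along that filter. -/
lemma torusSeries_half_zero : torusSeries ![((1 / 2 : ℝ) : UnitAddCircle), 0] =
    2⁻¹ * G2 (imagPoint 2⁻¹ (by norm_num)) - Real.pi := by
  have h0 : (![((1 / 2 : ℝ) : UnitAddCircle), 0] : T2) 0 ≠ 0 := half_ne_zero
  rw [torusSeries_of_zero h0, rowSeries]
  have h1 : HasSum (fun n => rowSum n ((1 / 2 : ℝ) : UnitAddCircle))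
      (∑' n, rowSum n ((1 / 2 : ℝ) : UnitAddCircle)) :=
    (Summable.of_norm (summable_norm_rowSum half_ne_zero)).hasSum
  have h2 := ((hasSum_e2Summand_G2 (imagPoint 2⁻¹ (by norm_num))).mul_left 2⁻¹).sub
    (hasSum_e2Summand_G2 (imagPoint 1 one_pos))
  rw [G2_I] at h2
  rw [(h2.congr_fun fun n => rowSum_half n).unique (hasSum_symmetricIcc h1)]
  refine tsum_congr fun n => ?_
  simp

/-- The pair of periods `1, i`. -/
def gaussPeriods : PeriodPair where
  ω₁ := 1
  ω₂ := Complex.I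
  indep := by simpa using Complex.basisOneI.linearIndependent

/-- The ℘ series converges absolutely and may be summed by rows. Since (2m - 1) + 2ni = -2(1/2 - (m
+ ni)), the shifted terms form the odd part of a row at 2i, which is the full row minus its even
part, and the even part is a quarter of the row at `i`. -/
lemma weierstrassP_half : gaussPeriods.weierstrassP (1 / 2) =
    4 * G2 (imagPoint 2 two_pos) - 2 * Real.pi := by
  have h1 := gaussPeriods.hasSum_weierstrassP (1 / 2)
  rw [← gaussPeriods.latticeEquivProd.symm.toEquiv.hasSum_iff] at h1
  rw [← (Equiv.prodComm ℤ ℤ).hasSum_iff] at h1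
  have h2 : ∀ n : ℤ, HasSum (fun m : ℤ => 1 / ((1 / 2 : ℂ) - (m + n * Complex.I)) ^ 2 -
      1 / ((m : ℂ) + n * Complex.I) ^ 2)
      (4 * e2Summand n (imagPoint 2 two_pos) - 2 * e2Summand n (imagPoint 1 one_pos)) := by
    intro n
    have h3 : HasSum (fun m : ℤ => 1 / ((m : ℂ) + n * Complex.I) ^ 2) (e2Summand n (imagPoint 1 one_pos)) := by
      refine (hasSum_e2Summand n 1 one_pos).congr_fun fun m => ?_
      simp
    obtain ⟨F, hF⟩ : ∃ F : ℤ → ℂ, ∀ m, F m = (((m : ℂ) + n * (2 * Complex.I)) ^ 2)⁻¹ :=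
      ⟨_, fun _ => rfl⟩
    have h4 : HasSum F (e2Summand n (imagPoint 2 two_pos)) := by
      refine (hasSum_e2Summand n 2 two_pos).congr_fun fun m => ?_
      rw [hF]; simp
    have h5 : HasSum (fun m => F (2 * m)) (4⁻¹ * e2Summand n (imagPoint 1 one_pos)) := by
      refine (h3.mul_left 4⁻¹).congr_fun fun m => ?_
      rw [hF, one_div, ← mul_inv]; congr 1; push_cast; ring
    have h6 : Summable fun m => F (2 * m - 1) :=
      h4.summable.comp_injective fun a b h => by simpa using h
    have h7 := (hasSum_int_even_odd h5 h6.hasSum).unique h4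
    have h8 := (h6.hasSum.mul_left 4).sub h3
    have h9 : 4 * (∑' m, F (2 * m - 1)) -
        e2Summand n (imagPoint 1 one_pos) =
        4 * e2Summand n (imagPoint 2 two_pos) - 2 * e2Summand n (imagPoint 1 one_pos) := by
      linear_combination 4 * h7
    rw [h9] at h8
    refine h8.congr_fun fun m => ?_
    have : (((2 * m - 1 : ℤ) : ℂ) + n * (2 * Complex.I)) = -2 * (1 / 2 - (m + n * Complex.I)) := by
      push_cast; ring
    rw [hF, this, mul_pow, mul_inv, one_div, one_div]
    ring
  have h3 := HasSum.prod_fiberwise h1 (g := fun n =>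
    4 * e2Summand n (imagPoint 2 two_pos) - 2 * e2Summand n (imagPoint 1 one_pos)) fun n => by
      refine (h2 n).congr_fun fun m => ?_
      have e : ((gaussPeriods.latticeEquivProd.symm.toEquiv (m, n)).1 : ℂ) = m * 1 + n * Complex.I :=
        gaussPeriods.latticeEquiv_symm_apply (m, n)
      simp only [Function.comp_apply, Equiv.prodComm_apply, Prod.swap]
      rw [e, mul_one]
  have h4 := ((hasSum_e2Summand_G2 (imagPoint 2 two_pos)).mul_left 4).sub
    ((hasSum_e2Summand_G2 (imagPoint 1 one_pos)).mul_left 2)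
  rw [G2_I] at h4
  exact (hasSum_symmetricIcc h3).unique h4

/-- Inversion relates i/2 to 2i, and makes both sides affine functions of `G2` at 2i. -/
lemma torusSeries_eq_weierstrassP : torusSeries ![((1 / 2 : ℝ) : UnitAddCircle), 0] =
    -2⁻¹ * gaussPeriods.weierstrassP (1 / 2) := by
  have := G2_imagPoint_inv 2 two_pos
  push_cast at this
  rw [torusSeries_half_zero, weierstrassP_half, this]
  ring
end DDA

end

/-! ### The lemniscatic value of ℘ and the number `Lambda0`. -/

noncomputable section
namespace DDA
open EisensteinSeries

local notation "℘₀" => PeriodPair.weierstrassP gaussPeriods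
local notation "℘₀'" => PeriodPair.derivWeierstrassP gaussPeriods

-- At 2i the q-expansion of `G2` has q = e^{-4π} < 3.8·10⁻⁶, so π²/3 is almost the whole value; σ₁(k
-- + 1) ≤ (k + 1)² ≤ 4^k bounds the correction by a geometric series.
open scoped ArithmeticFunction.sigma in
lemma exists_weierstrassP_half_eq : ∃ e : ℝ, ℘₀ (1 / 2) = e ∧
    0.5471 * (4 * Real.pi) < e ∧ e < 0.5472 * (4 * Real.pi) := by
  set q : ℝ := Real.exp (-(4 * Real.pi)) with hq
  have hq0 : 0 < q := Real.exp_pos _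
  have hpi := Real.pi_gt_d6
  have hpi' := Real.pi_lt_d6
  have hq1 : q < 3.8e-6 := by
    have h1 : Real.exp (-(4 * Real.pi)) ≤ Real.exp (-12.5) := Real.exp_le_exp.mpr (by linarith)
    -- Squaring turns the half-integral exponent -25/2 into an integer power of `e`.
    have h2 : Real.exp (-12.5) ^ 2 = (Real.exp 1 ^ 25)⁻¹ := by
      rw [← Real.exp_nat_mul, ← Real.exp_nat_mul, ← Real.exp_neg]; norm_num
    have h3 : (2.7182818283 : ℝ) ^ 25 < Real.exp 1 ^ 25 := by
      gcongr; exact Real.exp_one_gt_d9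
    have h4 : (Real.exp 1 ^ 25)⁻¹ < (3.8e-6) ^ 2 := by
      refine lt_of_le_of_lt (inv_anti₀ (by norm_num) h3.le) ?_
      norm_num
    have h5 : Real.exp (-12.5) < 3.8e-6 := by
      refine lt_of_pow_lt_pow_left₀ 2 (by norm_num) ?_
      rw [h2]; exact h4
    linarith
  set S : ℝ := ∑' n : ℕ+, (σ 1 n : ℝ) * q ^ (n : ℕ) with hS
  have hle : ∀ n : ℕ+, (σ 1 n : ℝ) * q ^ (n : ℕ) ≤ q * (4 * q) ^ ((n : ℕ) - 1) := by
    intro n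
    obtain ⟨k, hk⟩ : ∃ k, (n : ℕ) = k + 1 := ⟨n - 1, by have := n.pos; omega⟩
    rw [hk, Nat.add_sub_cancel]
    have h1 : (σ 1 (k + 1) : ℝ) ≤ ((k + 1 : ℕ) : ℝ) ^ 2 := by
      exact_mod_cast ArithmeticFunction.sigma_le_pow_succ 1 (k + 1)
    have h2 : ((k + 1 : ℕ) : ℝ) ^ 2 ≤ 4 ^ k := by
      have : ((k + 1 : ℕ) : ℝ) ≤ 2 ^ k := by exact_mod_cast Nat.lt_two_pow_self
      calc ((k + 1 : ℕ) : ℝ) ^ 2 ≤ (2 ^ k) ^ 2 := by gcongr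
        _ = 4 ^ k := by rw [← pow_mul, mul_comm, pow_mul]; norm_num
    calc (σ 1 (k + 1) : ℝ) * q ^ (k + 1) ≤ 4 ^ k * q ^ (k + 1) := by
          gcongr; exact h1.trans h2
      _ = q * (4 * q) ^ k := by rw [mul_pow, pow_succ]; ring
  have hnn : ∀ n : ℕ+, 0 ≤ (σ 1 n : ℝ) * q ^ (n : ℕ) := fun n => by positivity
  have hgeo : HasSum (fun n : ℕ+ => q * (4 * q) ^ ((n : ℕ) - 1)) (q * (1 - 4 * q)⁻¹) := by
    refine HasSum.mul_left q ?_
    have := hasSum_geometric_of_lt_one (r := 4 * q) (by positivity) (by linarith)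
    rw [← Equiv.pnatEquivNat.hasSum_iff] at this
    refine this.congr_fun fun n => ?_
    simp [Equiv.pnatEquivNat, PNat.natPred]
  have hS0 : 0 ≤ S := tsum_nonneg hnn
  have hS1 : S ≤ q * (1 - 4 * q)⁻¹ := by
    rw [← hgeo.tsum_eq]
    exact (hgeo.summable.of_nonneg_of_le hnn hle).tsum_le_tsum hle hgeo.summable
  have hS2 : S ≤ 3.81e-6 := by
    refine hS1.trans ?_
    rw [← div_eq_mul_inv, div_le_iff₀ (by linarith)]
    linarith
  have hG : G2 (imagPoint 2 two_pos) = ((Real.pi ^ 2 / 3 - 8 * Real.pi ^ 2 * S : ℝ) : ℂ) := by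
    rw [G2_eq_tsum_cexp, riemannZeta_two]
    have : Complex.exp (2 * Real.pi * Complex.I * (imagPoint 2 two_pos : ℂ)) = (q : ℂ) := by
      rw [coe_imagPoint, hq]; push_cast; congr 1
      linear_combination (4 * Real.pi : ℂ) * Complex.I_sq
    rw [this, hS]
    push_cast
    ring
  refine ⟨4 * (Real.pi ^ 2 / 3 - 8 * Real.pi ^ 2 * S) - 2 * Real.pi, ?_, ?_, ?_⟩
  · rw [weierstrassP_half, hG]; push_cast; ring
  · have h1 : Real.pi * S ≤ 3.141593 * 3.81e-6 := by
      have := hS0; gcongr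
    nlinarith
  · have : 0 ≤ Real.pi ^ 2 * S := by positivity
    nlinarith

lemma gauss_hasSum_int {f : ℂ → ℂ} {a : ℂ} (h : HasSum (fun l : gaussPeriods.lattice => f l) a) :
    HasSum (fun p : ℤ × ℤ => f (p.1 + p.2 * Complex.I)) a := by
  rw [← gaussPeriods.latticeEquivProd.symm.toEquiv.hasSum_iff] at h
  refine h.congr_fun fun p => ?_
  have e : ((gaussPeriods.latticeEquivProd.symm.toEquiv p).1 : ℂ) = p.1 * 1 + p.2 * Complex.I :=
    gaussPeriods.latticeEquiv_symm_apply p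
  simp only [Function.comp_apply]
  rw [e, mul_one]

lemma weierstrassP_conj (z : ℂ) : ℘₀ ((starRingEnd ℂ) z) = (starRingEnd ℂ) (℘₀ z) := by
  have h1 := gauss_hasSum_int (f := fun l => 1 / (z - l) ^ 2 - 1 / l ^ 2)
    (gaussPeriods.hasSum_weierstrassP z)
  have h2 := gauss_hasSum_int (f := fun l => 1 / ((starRingEnd ℂ) z - l) ^ 2 - 1 / l ^ 2)
    (gaussPeriods.hasSum_weierstrassP ((starRingEnd ℂ) z))
  have h3 := h1.map (starRingEnd ℂ) Complex.continuous_conj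
  rw [← ((Equiv.refl ℤ).prodCongr (Equiv.neg ℤ)).hasSum_iff] at h3
  refine h2.unique (h3.congr_fun fun p => ?_)
  simp

lemma weierstrassP_ofReal (x : ℝ) : ℘₀ x = ((℘₀ x).re : ℂ) := by
  have := weierstrassP_conj x
  rw [Complex.conj_ofReal] at this
  exact (Complex.conj_eq_iff_re.mp this.symm).symm

/-- The lattice is stable under multiplication by `i` and i⁶ = -1, so the sum of l⁻⁶ is its own
negative. -/
lemma gauss_g₃ : gaussPeriods.g₃ = 0 := by
  have h0 : Summable fun l : gaussPeriods.lattice => ((l : ℂ) ^ 6)⁻¹ := by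
    have := (gaussPeriods.hasSum_sumInvPow 0 (r := 6) (by norm_num)).summable
    simpa using this
  have h1 := gauss_hasSum_int (f := fun l => (l ^ 6)⁻¹) h0.hasSum
  have h2 := h1
  let σ : ℤ × ℤ ≃ ℤ × ℤ :=
    { toFun := fun p => (-p.2, p.1), invFun := fun p => (p.2, -p.1)
      left_inv := fun p => by simp, right_inv := fun p => by simp }
  rw [← σ.hasSum_iff] at h2
  have h3 := h2.unique (h1.neg.congr_fun fun p => by
    have : (((-p.2 : ℤ) : ℂ) + p.1 * Complex.I) = Complex.I * (p.1 + p.2 * Complex.I) := by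
      push_cast; linear_combination (-(p.2 : ℂ)) * Complex.I_sq
    simp only [σ, Function.comp_apply, Equiv.coe_fn_mk]
    rw [this, mul_pow, mul_inv, show Complex.I ^ 6 = -1 by
      rw [show 6 = 2 * 3 by rfl, pow_mul, Complex.I_sq]; norm_num]
    ring)
  rw [PeriodPair.g₃, PeriodPair.G, CharZero.eq_neg_self_iff.mp h3, mul_zero]

lemma gauss_mem_lattice_int (n : ℤ) : (n : ℂ) ∈ gaussPeriods.lattice := by
  have h : (1 : ℂ) ∈ gaussPeriods.lattice := gaussPeriods.ω₁_mem_lattice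
  simpa using gaussPeriods.lattice.smul_mem n h

lemma ofReal_notMem_gauss_lattice {x : ℝ} (hx : x ∈ Set.Ioo (0 : ℝ) 1) :
    (x : ℂ) ∉ gaussPeriods.lattice := by
  intro h
  obtain ⟨m, n, hmn⟩ := PeriodPair.mem_lattice.mp h
  have := congrArg Complex.re hmn
  simp [gaussPeriods] at this
  have h1 : (0 : ℝ) < m := by rw [this]; exact hx.1
  have h2 : (m : ℝ) < 1 := by rw [this]; exact hx.2
  have h1' : 0 < m := by exact_mod_cast h1
  have h2' : m < 1 := by exact_mod_cast h2
  omega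

/-- ℘' is odd with period 1, so its value at 1/2 is its own negative. -/
lemma derivWeierstrassP_half : ℘₀' (1 / 2) = 0 := by
  have h1 := gaussPeriods.derivWeierstrassP_sub_coe (1 / 2)
    ⟨1, by simpa using gauss_mem_lattice_int 1⟩
  have h2 : (1 / 2 : ℂ) - 1 = -(1 / 2) := by norm_num
  rw [h2, gaussPeriods.derivWeierstrassP_neg] at h1
  exact CharZero.eq_neg_self_iff.mp h1.symm

/-- The restriction of the Weierstrass function of `ℤ[i]` to the real axis. -/
def realP (x : ℝ) : ℝ := (℘₀ x).re

/-- The derivative of `realP`. -/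
def realP' (x : ℝ) : ℝ := (℘₀' x).re

lemma hasDerivAt_weierstrassP {x : ℝ} (hx : x ∈ Set.Ioo (0 : ℝ) 1) :
    HasDerivAt ℘₀ (℘₀' x) (x : ℂ) := by
  have h := (gaussPeriods.differentiableOn_weierstrassP.differentiableAt
    (gaussPeriods.isClosed_lattice.isOpen_compl.mem_nhds (ofReal_notMem_gauss_lattice hx))).hasDerivAt
  rwa [PeriodPair.deriv_weierstrassP] at h

lemma hasDerivAt_realP {x : ℝ} (hx : x ∈ Set.Ioo (0 : ℝ) 1) : HasDerivAt realP (realP' x) x :=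
  (hasDerivAt_weierstrassP hx).real_of_complex

lemma derivWeierstrassP_ofReal {x : ℝ} (hx : x ∈ Set.Ioo (0 : ℝ) 1) : ℘₀' x = (realP' x : ℂ) := by
  have h1 := (hasDerivAt_weierstrassP hx).comp_ofReal
  have h2 := (hasDerivAt_realP hx).ofReal_comp
  exact h1.unique (h2.congr_of_eventuallyEq (Eventually.of_forall weierstrassP_ofReal))

/-- At the critical point 1/2 the differential equation reads 0 = 4e³ - g₂e. -/
lemma gauss_g₂ {e : ℝ} (he : ℘₀ (1 / 2) = e) (he0 : 0 < e) : gaussPeriods.g₂ = 4 * e ^ 2 := by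
  have h := gaussPeriods.derivWeierstrassP_sq (1 / 2) (by
    have := ofReal_notMem_gauss_lattice (x := 1 / 2) ⟨by norm_num, by norm_num⟩
    simpa using this)
  rw [gauss_g₃, derivWeierstrassP_half, he] at h
  have he' : (e : ℂ) ≠ 0 := by exact_mod_cast he0.ne'
  have : (e : ℂ) * (gaussPeriods.g₂ - 4 * e ^ 2) = 0 := by linear_combination h
  exact sub_eq_zero.mp ((mul_eq_zero.mp this).resolve_left he')

lemma realP'_sq {e : ℝ} (he : ℘₀ (1 / 2) = e) (he0 : 0 < e) {x : ℝ} (hx : x ∈ Set.Ioo (0 : ℝ) 1) :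
    realP' x ^ 2 = 4 * realP x * (realP x ^ 2 - e ^ 2) := by
  have h := gaussPeriods.derivWeierstrassP_sq x (ofReal_notMem_gauss_lattice hx)
  rw [gauss_g₃, gauss_g₂ he he0, derivWeierstrassP_ofReal hx, weierstrassP_ofReal] at h
  have h' : realP' x ^ 2 = 4 * realP x ^ 3 - 4 * e ^ 2 * realP x - 0 := by exact_mod_cast h
  rw [h']; ring

lemma realP_half {e : ℝ} (he : ℘₀ (1 / 2) = e) : realP (1 / 2) = e := by
  rw [realP]; push_cast; rw [he, Complex.ofReal_re]

lemma continuousOn_realP : ContinuousOn realP (Set.Ioo 0 1) := fun _ hx =>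
  (hasDerivAt_realP hx).continuousAt.continuousWithinAt

/-- Where 0 < ℘ < e, the right side of `realP'_sq` is negative. A value below `e` would, by
connectedness of the interval, force a value in [e/2, e); the cut-off e/2 keeps ℘ positive there. -/
lemma le_realP {e : ℝ} (he : ℘₀ (1 / 2) = e) (he0 : 0 < e) {x : ℝ} (hx : x ∈ Set.Ioo (0 : ℝ) 1) :
    e ≤ realP x := by
  by_contra! hlt
  have hhalf : (1 / 2 : ℝ) ∈ Set.Ioo (0 : ℝ) 1 := by norm_num
  have hc : IsPreconnected (realP '' Set.Ioo 0 1) := isPreconnected_Ioo.image _ continuousOn_realP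
  have hord := hc.ordConnected
  have hmem : max (realP x) (e / 2) ∈ realP '' Set.Ioo 0 1 := by
    refine hord.out ⟨x, hx, rfl⟩ ⟨1 / 2, hhalf, rfl⟩ ⟨le_max_left _ _, ?_⟩
    rw [realP_half he]
    exact max_le hlt.le (by linarith)
  obtain ⟨y, hy, hyx⟩ := hmem
  have h1 := realP'_sq he he0 hy
  have h2 : e / 2 ≤ realP y := by rw [hyx]; exact le_max_right _ _
  have h3 : realP y < e := by rw [hyx]; exact max_lt hlt (by linarith)
  have h4 : 4 * realP y * (realP y ^ 2 - e ^ 2) < 0 :=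
    mul_neg_of_pos_of_neg (by linarith) (by nlinarith)
  nlinarith [sq_nonneg (realP' y)]

lemma tendsto_realP_zero : Tendsto realP (𝓝[>] 0) atTop := by
  have h0 : ∀ x : ℝ, realP x = (gaussPeriods.weierstrassPExcept 0 x).re + (x ^ 2)⁻¹ := by
    intro x
    have h := gaussPeriods.weierstrassPExcept_def 0 x
    simp only [ZeroMemClass.coe_zero] at h
    have : (1 / ((x : ℂ) - 0) ^ 2) = (((x ^ 2)⁻¹ : ℝ) : ℂ) := by push_cast; simp
    rw [this] at h
    rw [realP, h, Complex.add_re, Complex.sub_re, Complex.ofReal_re]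
    simp
  have h1 : ContinuousAt (fun x : ℝ => (gaussPeriods.weierstrassPExcept 0 x).re) 0 := by
    have h := (gaussPeriods.analyticAt_weierstrassPExcept 0).continuousAt
    have h' : ContinuousAt (gaussPeriods.weierstrassPExcept 0) ((0 : ℝ) : ℂ) := by simpa using h
    exact Complex.continuous_re.continuousAt.comp
      (h'.comp Complex.continuous_ofReal.continuousAt)
  have h2 : Tendsto (fun x : ℝ => (x ^ 2)⁻¹) (𝓝[>] 0) atTop := by
    refine Tendsto.inv_tendsto_nhdsGT_zero (tendsto_nhdsWithin_iff.mpr ⟨?_, ?_⟩)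
    · have : Tendsto (fun x : ℝ => x ^ 2) (𝓝 0) (𝓝 (0 ^ 2)) := (continuous_pow 2).tendsto 0
      rw [zero_pow two_ne_zero] at this
      exact this.mono_left nhdsWithin_le_nhds
    · filter_upwards [self_mem_nhdsWithin] with x hx
      exact pow_pos (Set.mem_Ioi.mp hx) 2
  rw [funext h0]
  exact (h1.tendsto.mono_left nhdsWithin_le_nhds).add_atTop h2

lemma analyticOnNhd_realP : AnalyticOnNhd ℝ realP (Set.Ioo 0 1) := by
  intro x hx
  have h := (gaussPeriods.analyticOnNhd_weierstrassP x (ofReal_notMem_gauss_lattice hx)).restrictScalars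
    (𝕜 := ℝ)
  have h1 : AnalyticAt ℝ (fun y : ℝ => ℘₀ y) x :=
    AnalyticAt.comp (g := ℘₀) (f := fun y : ℝ => (y : ℂ)) h (Complex.ofRealCLM.analyticAt x)
  exact AnalyticAt.comp (g := Complex.re) (Complex.reCLM.analyticAt _) h1

/-- At a critical point in (0, 1) ℘ takes its minimal value `e`. A critical point x < 1/2 would make
the maximum over [x, 1/2] equal to `e` too, so ℘ would be constant there, and by analyticity on (0,
1), against its pole at 0. -/
lemma realP'_ne_zero {e : ℝ} (he : ℘₀ (1 / 2) = e) (he0 : 0 < e) {x : ℝ}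
    (hx : x ∈ Set.Ioo (0 : ℝ) (1 / 2)) : realP' x ≠ 0 := by
  intro h0
  have hsub : ∀ y ∈ Set.Icc x (1 / 2), y ∈ Set.Ioo (0 : ℝ) 1 := fun y hy =>
    ⟨hx.1.trans_le hy.1, by linarith [hy.2]⟩
  have hcrit : ∀ y ∈ Set.Ioo (0 : ℝ) 1, realP' y = 0 → realP y = e := by
    intro y hy h
    have h1 := realP'_sq he he0 hy
    have h2 := le_realP he he0 hy
    rw [h, zero_pow two_ne_zero] at h1
    have h3 : realP y ^ 2 - e ^ 2 = 0 :=
      (mul_eq_zero.mp h1.symm).resolve_left (by linarith)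
    nlinarith
  have hxe := hcrit x (hsub x ⟨le_rfl, hx.2.le⟩) h0
  obtain ⟨y, hy, hmax⟩ := isCompact_Icc.exists_isMaxOn ⟨x, Set.left_mem_Icc.mpr hx.2.le⟩
    (continuousOn_realP.mono hsub)
  have hye : realP y = e := by
    by_cases hy' : y ∈ Set.Ioo x (1 / 2)
    · refine hcrit y (hsub y hy) ?_
      exact (hmax.isLocalMax (Icc_mem_nhds hy'.1 hy'.2)).hasDerivAt_eq_zero
        (hasDerivAt_realP (hsub y hy))
    · rcases hy.1.eq_or_lt with h | h
      · rw [← h, hxe]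
      · have : y = 1 / 2 := le_antisymm hy.2 (not_lt.mp fun h' => hy' ⟨h, h'⟩)
        rw [this, realP_half he]
  have hconst : ∀ z ∈ Set.Icc x (1 / 2), realP z = e := fun z hz =>
    le_antisymm (hye ▸ hmax hz) (le_realP he he0 (hsub z hz))
  obtain ⟨z, hz1, hz2⟩ := exists_between hx.2
  have hev : realP =ᶠ[𝓝 z] fun _ => e := by
    filter_upwards [Icc_mem_nhds hz1 hz2] with w hw using hconst w hw
  have hall := analyticOnNhd_realP.eqOn_of_preconnected_of_eventuallyEq
    (fun _ _ => analyticAt_const) isPreconnected_Ioo (hsub z ⟨hz1.le, hz2.le⟩) hev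
  have h1 := tendsto_realP_zero.eventually_gt_atTop e
  have h2 : ∀ᶠ w in 𝓝[>] (0 : ℝ), w ∈ Set.Ioo (0 : ℝ) 1 := Ioo_mem_nhdsGT one_pos
  obtain ⟨w, hw1, hw2⟩ := (h1.and h2).exists
  exact hw1.ne' (hall hw2)

lemma lt_realP {e : ℝ} (he : ℘₀ (1 / 2) = e) (he0 : 0 < e) {x : ℝ}
    (hx : x ∈ Set.Ioo (0 : ℝ) (1 / 2)) : e < realP x := by
  have hx' : x ∈ Set.Ioo (0 : ℝ) 1 := ⟨hx.1, by linarith [hx.2]⟩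
  refine lt_of_le_of_ne (le_realP he he0 hx') fun h => realP'_ne_zero he he0 hx ?_
  have := realP'_sq he he0 hx'
  rw [← h, sub_self, mul_zero] at this
  exact pow_eq_zero_iff two_ne_zero |>.mp this

lemma injOn_realP {e : ℝ} (he : ℘₀ (1 / 2) = e) (he0 : 0 < e) :
    Set.InjOn realP (Set.Ioo 0 (1 / 2)) := by
  have key : ∀ x ∈ Set.Ioo (0 : ℝ) (1 / 2), ∀ y ∈ Set.Ioo (0 : ℝ) (1 / 2), x < y →
      realP x ≠ realP y := by
    intro x hx y hy hxy h
    obtain ⟨c, hc, hc0⟩ := exists_hasDerivAt_eq_zero (f := realP) (f' := realP') hxy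
      (continuousOn_realP.mono fun z hz => ⟨hx.1.trans_le hz.1, by linarith [hz.2, hy.2]⟩) h
      fun z hz => hasDerivAt_realP ⟨hx.1.trans hz.1, by linarith [hz.2, hy.2]⟩
    exact realP'_ne_zero he he0 ⟨hx.1.trans hc.1, hc.2.trans hy.2⟩ hc0
  intro x hx y hy h
  rcases lt_trichotomy x y with h' | h' | h'
  · exact absurd h (key x hx y hy h')
  · exact h'
  · exact absurd h.symm (key y hy x hx h')

/-- The substitution t = (e/℘(x))² maps (0, 1/2) bijectively onto (0, 1), and the differential
equation turns the integrand into the constant 4√e, on an interval of length 1/2. -/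
lemma beta_quarter_half {e : ℝ} (he : ℘₀ (1 / 2) = e) (he0 : 0 < e) :
    ∫ t in Set.Ioo (0 : ℝ) 1, t ^ (-3 / 4 : ℝ) * (1 - t) ^ (-1 / 2 : ℝ) = 2 * Real.sqrt e := by
  set T : ℝ → ℝ := fun x => (e / realP x) ^ 2 with hT
  have hpos : ∀ x ∈ Set.Ioo (0 : ℝ) 1, 0 < realP x := fun x hx => he0.trans_le (le_realP he he0 hx)
  have hsub : Set.Ioo (0 : ℝ) (1 / 2) ⊆ Set.Ioo 0 1 := Set.Ioo_subset_Ioo le_rfl (by norm_num)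
  have hder : ∀ x ∈ Set.Ioo (0 : ℝ) 1,
      HasDerivAt T (2 * (e / realP x) * (-(e * realP' x) / realP x ^ 2)) x := by
    intro x hx
    have h1 := ((hasDerivAt_const x e).div (hasDerivAt_realP hx) (hpos x hx).ne').pow 2
    refine h1.congr_deriv ?_
    simp
  have himg : T '' Set.Ioo 0 (1 / 2) = Set.Ioo 0 1 := by
    ext t
    constructor
    · rintro ⟨x, hx, rfl⟩
      have h1 := lt_realP he he0 hx
      have h2 := hpos x (hsub hx)
      refine ⟨by positivity, ?_⟩
      simp only [hT]
      rw [sq_lt_one_iff₀ (by positivity), div_lt_one h2]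
      exact h1
    · rintro ⟨ht0, ht1⟩
      have h1 : Tendsto T (𝓝[>] 0) (𝓝 0) := by
        have := (tendsto_realP_zero.const_div_atTop e).pow 2
        simpa using this
      have h2 : ∀ᶠ w in 𝓝[>] (0 : ℝ), w ∈ Set.Ioo (0 : ℝ) (1 / 2) := Ioo_mem_nhdsGT (by norm_num)
      obtain ⟨x, hx1, hx2⟩ := ((h1.eventually_lt_const ht0).and h2).exists
      have hThalf : T (1 / 2) = 1 := by
        simp only [hT]; rw [realP_half he, div_self he0.ne', one_pow]
      have hc : ContinuousOn T (Set.Icc x (1 / 2)) := fun z hz =>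
        (hder z ⟨hx2.1.trans_le hz.1, by linarith [hz.2]⟩).continuousAt.continuousWithinAt
      obtain ⟨z, hz, hzt⟩ := intermediate_value_Ioo hx2.2.le hc ⟨hx1, by rw [hThalf]; exact ht1⟩
      exact ⟨z, ⟨hx2.1.trans hz.1, hz.2⟩, hzt⟩
  have hinj : Set.InjOn T (Set.Ioo 0 (1 / 2)) := by
    intro x hx y hy h
    have h1 := hpos x (hsub hx)
    have h2 := hpos y (hsub hy)
    refine injOn_realP he he0 hx hy ?_
    have h3 : e / realP x = e / realP y := (pow_left_inj₀ (by positivity) (by positivity) two_ne_zero).mp h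
    rw [div_eq_div_iff h1.ne' h2.ne'] at h3
    exact (mul_left_cancel₀ he0.ne' h3).symm
  have hcv := integral_image_eq_integral_abs_deriv_smul (s := Set.Ioo (0 : ℝ) (1 / 2)) measurableSet_Ioo
    (fun x hx => (hder x (hsub hx)).hasDerivWithinAt) hinj
    (fun t => t ^ (-3 / 4 : ℝ) * (1 - t) ^ (-1 / 2 : ℝ))
  rw [himg] at hcv
  rw [hcv]
  have hval : ∀ x ∈ Set.Ioo (0 : ℝ) (1 / 2),
      |2 * (e / realP x) * (-(e * realP' x) / realP x ^ 2)| •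
        (T x ^ (-3 / 4 : ℝ) * (1 - T x) ^ (-1 / 2 : ℝ)) = 4 * Real.sqrt e := by
    intro x hx
    have hlt := lt_realP he he0 hx
    have h2 := hpos x (hsub hx)
    -- In terms of ε = √e and s = √(℘/e) the fractional powers disappear: ℘ = ε²s², |℘'| = 2ε³s√(s⁴
    -- - 1) and t = s⁻⁴.
    set ε := Real.sqrt e with hε
    have hε0 : 0 < ε := Real.sqrt_pos.mpr he0
    have hεe : e = ε ^ 2 := (Real.sq_sqrt he0.le).symm
    set s := Real.sqrt (realP x / e) with hs
    have hs0 : 0 < s := Real.sqrt_pos.mpr (by positivity)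
    have hsP : realP x = ε ^ 2 * s ^ 2 := by
      rw [← hεe, hs, Real.sq_sqrt (by positivity)]; field_simp
    have hs1 : 1 < s ^ 4 := by
      have : 1 < s ^ 2 := by rw [hs, Real.sq_sqrt (by positivity), one_lt_div he0]; exact hlt
      nlinarith
    set r := Real.sqrt (s ^ 4 - 1) with hr
    have hr0 : 0 < r := Real.sqrt_pos.mpr (by linarith)
    have hr2 : r ^ 2 = s ^ 4 - 1 := Real.sq_sqrt (by linarith)
    have hP' : |realP' x| = 2 * ε ^ 3 * s * r := by
      rw [← Real.sqrt_sq_eq_abs, realP'_sq he he0 (hsub hx), hsP, hεe]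
      rw [show 4 * (ε ^ 2 * s ^ 2) * ((ε ^ 2 * s ^ 2) ^ 2 - (ε ^ 2) ^ 2) = (2 * ε ^ 3 * s * r) ^ 2 by
        rw [mul_pow _ r, hr2]; ring]
      exact Real.sqrt_sq (by positivity)
    have hTx : T x = (s ^ 4)⁻¹ := by
      simp only [hT]; rw [hsP, hεe]; field_simp
    have hT1 : 1 - T x = (r / s ^ 2) ^ 2 := by
      rw [hTx, div_pow, hr2]; field_simp
    have e1 : T x ^ (-3 / 4 : ℝ) = s ^ 3 := by
      rw [hTx, Real.inv_rpow (by positivity), ← Real.rpow_natCast s 4, ← Real.rpow_mul hs0.le,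
        ← Real.rpow_neg hs0.le, ← Real.rpow_natCast s 3]
      norm_num
    have e2 : (1 - T x) ^ (-1 / 2 : ℝ) = s ^ 2 / r := by
      rw [hT1, ← Real.rpow_natCast _ 2, ← Real.rpow_mul (by positivity)]
      norm_num
      rw [Real.rpow_neg_one, inv_div]
    have e3 : |2 * (e / realP x) * (-(e * realP' x) / realP x ^ 2)| =
        2 * (e / realP x) * (e * |realP' x| / realP x ^ 2) := by
      rw [abs_mul, abs_of_pos (show 0 < 2 * (e / realP x) by positivity), abs_div, abs_neg,
        abs_mul e, abs_of_pos he0, abs_of_pos (show 0 < realP x ^ 2 by positivity)]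
    rw [e1, e2, e3, smul_eq_mul, hP', hsP, hεe]
    field_simp
    ring
  rw [setIntegral_congr_fun measurableSet_Ioo hval, setIntegral_const]
  simp
  ring

/-- The integral is B(1/4, 1/2) = Γ(1/4)√π/Γ(3/4); the reflection formula eliminates Γ(3/4), and
squaring isolates `e`. -/
lemma eq_Gamma_pow_four {e : ℝ} (he : ℘₀ (1 / 2) = e) (he0 : 0 < e) :
    e = Real.Gamma (1 / 4) ^ 4 / (8 * Real.pi) := by
  have h1 := beta_quarter_half he he0
  have h2 : ∫ t in Set.Ioo (0 : ℝ) 1, t ^ (-3 / 4 : ℝ) * (1 - t) ^ (-1 / 2 : ℝ) =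
      ProbabilityTheory.beta (1 / 4) (1 / 2) := by
    rw [ProbabilityTheory.beta_eq_betaIntegralReal _ _ (by norm_num) (by norm_num),
      Complex.betaIntegral, intervalIntegral.integral_of_le zero_le_one,
      ← integral_Ioc_eq_integral_Ioo]
    have : ∫ t in Set.Ioc (0 : ℝ) 1, (t : ℂ) ^ (((1 / 4 : ℝ) : ℂ) - 1) * (1 - (t : ℂ)) ^ (((1 / 2 : ℝ) : ℂ) - 1) =
        ∫ t in Set.Ioc (0 : ℝ) 1, ((t ^ (-3 / 4 : ℝ) * (1 - t) ^ (-1 / 2 : ℝ) : ℝ) : ℂ) := by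
      refine setIntegral_congr_fun measurableSet_Ioc fun t ht => ?_
      rw [Complex.ofReal_mul, Complex.ofReal_cpow ht.1.le, Complex.ofReal_cpow (by linarith [ht.2])]
      push_cast
      norm_num
    rw [this, integral_complex_ofReal, Complex.ofReal_re]
  rw [h2, ProbabilityTheory.beta, Real.Gamma_one_half_eq] at h1
  have h3 := Real.Gamma_mul_Gamma_one_sub (1 / 4)
  have h4 : Real.sin (Real.pi * (1 / 4)) = Real.sqrt 2 / 2 := by
    rw [← Real.sin_pi_div_four]; congr 1; ring
  have hpi := Real.pi_pos
  have hg : 0 < Real.Gamma (1 / 4) := Real.Gamma_pos_of_pos (by norm_num)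
  have hg' : 0 < Real.Gamma (3 / 4) := Real.Gamma_pos_of_pos (by norm_num)
  rw [h4, show (1 - 1 / 4 : ℝ) = 3 / 4 by norm_num] at h3
  rw [show (1 / 4 + 1 / 2 : ℝ) = 3 / 4 by norm_num] at h1
  have h5 : Real.Gamma (3 / 4) = Real.pi / (Real.sqrt 2 / 2) / Real.Gamma (1 / 4) := by
    rw [eq_div_iff hg.ne', mul_comm]; exact h3
  have h6 := congrArg (fun z => z ^ 2) h1
  simp only [mul_pow, div_pow, Real.sq_sqrt he0.le, Real.sq_sqrt hpi.le, h5,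
    Real.sq_sqrt (zero_le_two : (0:ℝ) ≤ 2)] at h6
  field_simp at h6 ⊢
  linarith

lemma exists_weierstrassP_half_eq_Lambda0 : ℘₀ (1 / 2) = ((4 * Real.pi * Lambda0 : ℝ) : ℂ) ∧
    (0.5471 : ℝ) < Lambda0 ∧ Lambda0 < 0.5472 := by
  obtain ⟨e, he, h1, h2⟩ := exists_weierstrassP_half_eq
  have hpi := Real.pi_pos
  have he0 : 0 < e := lt_trans (by positivity) h1
  have h3 := eq_Gamma_pow_four he he0
  have h4 : e = 4 * Real.pi * Lambda0 := by
    rw [h3, Lambda0]; field_simp; norm_num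
  refine ⟨by rw [he, h4], ?_, ?_⟩ <;> nlinarith
end DDA

end

/-! ### The numerical symbol: entries, eigenvalues and extreme values. -/

noncomputable section
namespace DDA
attribute [local instance] instMeasureSpaceUnitAddCircle
  instIsAddHaarMeasureUnitAddCircleVolume instIsProbabilityMeasureUnitAddCircleVolume

open UnitAddTorus

/-- The diagonal entry of the numerical symbol, as a function on the torus. -/
def symbA (x : T2) : ℝ := -(1 / (2 * Real.pi)) * (torusSeries x).re

/-- The off-diagonal entry of the numerical symbol, as a function on the torus. -/
def symbB (x : T2) : ℝ := 1 / (2 * Real.pi) * (torusSeries x).im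

lemma invSq_re_im (m n : ℤ) : invSq m n =
    ((((m : ℝ) ^ 2 - n ^ 2) / (m ^ 2 + n ^ 2) ^ 2 : ℝ) : ℂ) +
      ((-(2 * m * n) / (m ^ 2 + n ^ 2) ^ 2 : ℝ) : ℂ) * Complex.I := by
  by_cases h : m = 0 ∧ n = 0
  · obtain ⟨rfl, rfl⟩ := h; simp [invSq]
  have hr : (m : ℝ) ^ 2 + n ^ 2 ≠ 0 := by
    intro h0
    have h1 : (m : ℝ) = 0 := by nlinarith [sq_nonneg (m : ℝ), sq_nonneg (n : ℝ)]
    have h2 : (n : ℝ) = 0 := by nlinarith [sq_nonneg (m : ℝ), sq_nonneg (n : ℝ)]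
    exact h ⟨by exact_mod_cast h1, by exact_mod_cast h2⟩
  have hc : (m : ℂ) ^ 2 + n ^ 2 ≠ 0 := by exact_mod_cast hr
  have e : (((m : ℝ) ^ 2 - n ^ 2) / (m ^ 2 + n ^ 2) ^ 2 : ℝ) +
      ((-(2 * m * n) / (m ^ 2 + n ^ 2) ^ 2 : ℝ) : ℂ) * Complex.I =
      ((m - n * Complex.I) / (m ^ 2 + n ^ 2)) ^ 2 := by
    push_cast
    field_simp
    linear_combination (-(n : ℂ) ^ 2) * Complex.I_sq
  rw [e, invSq]
  refine inv_eq_of_mul_eq_one_right ?_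
  rw [← mul_pow]
  have : ((m : ℂ) + n * Complex.I) * ((m - n * Complex.I) / (m ^ 2 + n ^ 2)) = 1 := by
    rw [mul_div_assoc', div_eq_one_iff_eq hc]
    linear_combination (-(n : ℂ) ^ 2) * Complex.I_sq
  rw [this, one_pow]

lemma invSq_re (m n : ℤ) : (invSq m n).re = ((m : ℝ) ^ 2 - n ^ 2) / (m ^ 2 + n ^ 2) ^ 2 := by
  rw [invSq_re_im, Complex.add_re, Complex.ofReal_re, Complex.re_ofReal_mul, Complex.I_re]; simp

lemma invSq_im (m n : ℤ) : (invSq m n).im = -(2 * m * n) / (m ^ 2 + n ^ 2) ^ 2 := by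
  rw [invSq_re_im, Complex.add_im, Complex.ofReal_im, Complex.im_ofReal_mul, Complex.I_im]; simp

lemma coeffA_eq (m : Fin 2 → ℤ) :
    coeffA m = ((-(1 / (2 * Real.pi)) * (invSq (m 0) (m 1)).re : ℝ) : ℂ) := by
  rw [invSq_re, coeffA]; push_cast
  rw [show ((m 1 : ℂ) ^ 2 - (m 0 : ℂ) ^ 2) = -((m 0 : ℂ) ^ 2 - (m 1 : ℂ) ^ 2) by ring,
    ← div_div, neg_div, neg_div, neg_mul, one_div_mul_eq_div, div_right_comm]

lemma coeffB_eq (m : Fin 2 → ℤ) :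
    coeffB m = ((1 / (2 * Real.pi) * (invSq (m 0) (m 1)).im : ℝ) : ℂ) := by
  rw [invSq_im, coeffB]; push_cast
  have hpi : (Real.pi : ℂ) ≠ 0 := by exact_mod_cast Real.pi_ne_zero
  rw [← div_div, div_mul_div_comm, ← div_div]
  congr 1
  field_simp

lemma norm_sq_latticePoint (m : Fin 2 → ℤ) : ‖latticePoint m‖ ^ 2 = (m 0 : ℝ) ^ 2 + (m 1 : ℝ) ^ 2 := by
  rw [EuclideanSpace.norm_sq_eq, Fin.sum_univ_two]; simp [latticePoint]

lemma kernel_latticePoint (m : Fin 2 → ℤ) :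
    kernel (latticePoint m) = !![coeffA m, coeffB m; coeffB m, -coeffA m] := by
  have h4 : ‖latticePoint m‖ ^ 4 = ((m 0 : ℝ) ^ 2 + (m 1 : ℝ) ^ 2) ^ 2 := by
    rw [← norm_sq_latticePoint, ← pow_mul]
  have hpi : (Real.pi : ℂ) ≠ 0 := by exact_mod_cast Real.pi_ne_zero
  have hl : ∀ i, latticePoint m i = m i := fun _ => rfl
  ext i j
  simp only [kernel, Matrix.of_apply, h4, norm_sq_latticePoint, hl, coeffA, coeffB]
  generalize hD : ((m 0 : ℝ) ^ 2 + (m 1 : ℝ) ^ 2) ^ 2 = D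
  have hD' : ((m 0 : ℂ) ^ 2 + (m 1 : ℂ) ^ 2) ^ 2 = D := by rw [← hD]; push_cast; rfl
  rw [hD', ← div_div, ← div_div]
  fin_cases i <;> fin_cases j <;> simp <;> ring

lemma mFourierCoeff_re (m : Fin 2 → ℤ) :
    mFourierCoeff (fun x => ((torusSeries x).re : ℂ)) m = ((invSq (m 0) (m 1)).re : ℂ) := by
  have hi : ∀ f : T2 → ℂ, MemLp f 2 → Integrable fun x => mFourier (-m) x • f x := fun f hf => by
    refine (hf.integrable (by norm_num)).bdd_mul (c := 1) ?_ ?_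
    · exact (mFourier (-m)).continuous.aestronglyMeasurable
    · exact Eventually.of_forall fun x => (norm_mFourier_apply _ x).le
  have h1 := mFourierCoeff_torusSeries m
  have h2 := mFourierCoeff_conj torusSeries m
  rw [mFourierCoeff_torusSeries, Pi.neg_apply, Pi.neg_apply, invSq_neg_neg] at h2
  rw [mFourierCoeff] at h1 h2 ⊢
  have hc : MemLp (fun x => (starRingEnd ℂ) (torusSeries x)) 2 := memLp_torusSeries.star
  rw [Complex.re_eq_add_conj, ← h2, ← h1,
    ← integral_add (hi _ memLp_torusSeries) (hi _ hc), ← integral_div]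
  congr 1; ext x
  rw [Complex.re_eq_add_conj, smul_eq_mul, smul_eq_mul, smul_eq_mul]; ring

lemma mFourierCoeff_const_mul (c : ℂ) (f : T2 → ℂ) (m : Fin 2 → ℤ) :
    mFourierCoeff (fun x => c * f x) m = c * mFourierCoeff f m := by
  rw [mFourierCoeff, mFourierCoeff, ← integral_const_mul]
  congr 1; ext x; simp only [smul_eq_mul]; ring

lemma mFourierCoeff_im (m : Fin 2 → ℤ) :
    mFourierCoeff (fun x => ((torusSeries x).im : ℂ)) m = ((invSq (m 0) (m 1)).im : ℂ) := by
  have hi : ∀ f : T2 → ℂ, MemLp f 2 → Integrable fun x => mFourier (-m) x • f x := fun f hf => by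
    refine (hf.integrable (by norm_num)).bdd_mul (c := 1) ?_ ?_
    · exact (mFourier (-m)).continuous.aestronglyMeasurable
    · exact Eventually.of_forall fun x => (norm_mFourier_apply _ x).le
  have h1 := mFourierCoeff_torusSeries m
  have h2 := mFourierCoeff_conj torusSeries m
  rw [mFourierCoeff_torusSeries, Pi.neg_apply, Pi.neg_apply, invSq_neg_neg] at h2
  rw [mFourierCoeff] at h1 h2 ⊢
  have hc : MemLp (fun x => (starRingEnd ℂ) (torusSeries x)) 2 := memLp_torusSeries.star
  rw [Complex.im_eq_sub_conj, ← h2, ← h1,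
    ← integral_sub (hi _ memLp_torusSeries) (hi _ hc), ← integral_div]
  congr 1; ext x
  rw [Complex.im_eq_sub_conj, smul_eq_mul, smul_eq_mul, smul_eq_mul]; ring

lemma mFourierCoeff_symbA (m : Fin 2 → ℤ) :
    mFourierCoeff (fun x => (symbA x : ℂ)) m = coeffA m := by
  rw [coeffA_eq]; simp only [symbA]; push_cast
  rw [mFourierCoeff_const_mul, mFourierCoeff_re]

lemma mFourierCoeff_symbB (m : Fin 2 → ℤ) :
    mFourierCoeff (fun x => (symbB x : ℂ)) m = coeffB m := by
  rw [coeffB_eq]; simp only [symbB]; push_cast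
  rw [mFourierCoeff_const_mul, mFourierCoeff_im]

lemma memLp_symbA : MemLp (fun x => (symbA x : ℂ)) 2 (volume : Measure T2) :=
  (memLp_torusSeries.re.const_mul _).ofReal

lemma memLp_symbB : MemLp (fun x => (symbB x : ℂ)) 2 (volume : Measure T2) :=
  (memLp_torusSeries.im.const_mul _).ofReal

lemma continuousOn_symbA : ContinuousOn symbA {0}ᶜ :=
  continuousOn_const.mul (Complex.continuous_re.comp_continuousOn continuousOn_torusSeries)

lemma continuousOn_symbB : ContinuousOn symbB {0}ᶜ :=
  continuousOn_const.mul (Complex.continuous_im.comp_continuousOn continuousOn_torusSeries)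

lemma isFourierSum_symbA : IsFourierSum coeffA (fun τ => (symbA (proj τ) : ℂ)) :=
  isFourierSum_comp_proj (f := fun x => (symbA x : ℂ)) memLp_symbA
    (Complex.continuous_ofReal.comp_continuousOn continuousOn_symbA) mFourierCoeff_symbA
    (by simp [coeffA])

lemma isFourierSum_symbB : IsFourierSum coeffB (fun τ => (symbB (proj τ) : ℂ)) :=
  isFourierSum_comp_proj (f := fun x => (symbB x : ℂ)) memLp_symbB
    (Complex.continuous_ofReal.comp_continuousOn continuousOn_symbB) mFourierCoeff_symbB
    (by simp [coeffB])

lemma IsFourierSum.neg {k : (Fin 2 → ℤ) → ℂ} {f : Plane → ℂ} (hf : IsFourierSum k f) :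
    IsFourierSum (fun m => -k m) (fun τ => -f τ) where
  periodic m τ := by rw [hf.periodic]
  continuousOn := hf.continuousOn.neg
  tendsto := by
    refine hf.tendsto.congr fun s => ?_
    rw [← eLpNorm_neg]
    congr 1; ext τ
    simp [Finset.sum_neg_distrib]
    ring

/-- The numerical symbol. -/
def symbolMatrix (τ : Plane) : Matrix (Fin 2) (Fin 2) ℂ :=
  !![(symbA (proj τ) : ℂ), (symbB (proj τ) : ℂ); (symbB (proj τ) : ℂ), -(symbA (proj τ) : ℂ)]

lemma isNumericalSymbol_symbolMatrix : IsNumericalSymbol symbolMatrix := by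
  intro i j
  simp only [kernel_latticePoint]
  fin_cases i <;> fin_cases j
  · exact isFourierSum_symbA
  · exact isFourierSum_symbB
  · exact isFourierSum_symbB
  · exact isFourierSum_symbA.neg

lemma IsNumericalSymbol.eq_symbolMatrix {F : Plane → Matrix (Fin 2) (Fin 2) ℂ}
    (hF : IsNumericalSymbol F) {τ : Plane} (hτ : τ ∈ Q) (h0 : τ ≠ 0) : F τ = symbolMatrix τ := by
  ext i j
  exact (hF i j).eqOn (isNumericalSymbol_symbolMatrix i j) ⟨hτ, Q_inter_periodLattice hτ h0⟩

lemma hasEigenvalue_symm_trace_zero (a b : ℝ) (μ : ℂ) :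
    Module.End.HasEigenvalue (Matrix.toLin' !![(a : ℂ), (b : ℂ); (b : ℂ), -(a : ℂ)]) μ ↔
      μ = (Real.sqrt (a ^ 2 + b ^ 2) : ℝ) ∨ μ = -(Real.sqrt (a ^ 2 + b ^ 2) : ℝ) := by
  have hs : ((Real.sqrt (a ^ 2 + b ^ 2) : ℝ) : ℂ) ^ 2 = (a : ℂ) ^ 2 + (b : ℂ) ^ 2 := by
    rw [← Complex.ofReal_pow, Real.sq_sqrt (by positivity)]; push_cast; rfl
  rw [Module.End.hasEigenvalue_iff_isRoot_charpoly, Matrix.charpoly_toLin', Matrix.charpoly_fin_two,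
    Polynomial.IsRoot.def]
  simp only [Polynomial.eval_add, Polynomial.eval_sub, Polynomial.eval_pow, Polynomial.eval_X,
    Polynomial.eval_mul, Polynomial.eval_C, Matrix.trace_fin_two_of, Matrix.det_fin_two_of]
  rw [← sq_eq_sq_iff_eq_or_eq_neg, hs]
  constructor <;> intro h <;> linear_combination h

lemma symbA_pi_zero : symbA (proj !₂[Real.pi, 0]) = Lambda0 := by
  have hp : proj !₂[Real.pi, 0] = ![((1 / 2 : ℝ) : UnitAddCircle), 0] := by
    have := Real.pi_ne_zero
    ext i
    fin_cases i
    · simp only [proj]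
      congr 1
      simp; field_simp
    · simp [proj]
  rw [hp, symbA, torusSeries_eq_weierstrassP, exists_weierstrassP_half_eq_Lambda0.1,
    show (-2⁻¹ : ℂ) * ((4 * Real.pi * Lambda0 : ℝ) : ℂ) = ((-2⁻¹ * (4 * Real.pi * Lambda0) : ℝ) : ℂ) by
      push_cast; ring, Complex.ofReal_re]
  have := Real.pi_ne_zero
  field_simp
  ring

lemma symbB_eq_zero {τ : Plane} (hτ : τ ∈ Q) {i : Fin 2} (hi : τ i = Real.pi ∨ τ i = -Real.pi) :
    symbB (proj τ) = 0 := by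
  have hpi := Real.pi_ne_zero
  have h0 : τ ≠ 0 := by
    rintro rfl
    rcases hi with h | h <;> simp at h <;> exact hpi (by linarith)
  have hp : proj τ ≠ 0 := fun h => Q_inter_periodLattice hτ h0 (proj_eq_zero_iff.mp h)
  have hneg : -(proj τ) i = proj τ i := by
    have e : proj τ i = ((1 / 2 : ℝ) : UnitAddCircle) := by
      rcases hi with h | h
      · simp only [proj]; rw [h]; congr 1; field_simp
      · rw [← neg_half, ← AddCircle.coe_neg]; simp only [proj]; rw [h]; congr 1; field_simp
    rw [e, neg_half]
  rw [symbB, torusSeries_im_eq_zero hp hneg, mul_zero]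

lemma symbB_frontier {τ : Plane} (hτ : τ ∈ frontier Q) : symbB (proj τ) = 0 := by
  have hQ : τ ∈ Q := isClosed_Q.frontier_subset hτ
  have hn : τ ∉ interior Q := hτ.2
  rw [interior_Q] at hn
  have : ∃ i, τ i ∉ Set.Ioo (-Real.pi) Real.pi := by
    by_contra! h; exact hn h
  obtain ⟨i, hi⟩ := this
  refine symbB_eq_zero hQ (i := i) ?_
  have h := hQ i
  by_contra! hne
  exact hi ⟨lt_of_le_of_ne h.1 hne.2.symm, lt_of_le_of_ne h.2 hne.1⟩

/-- The spectral radius of the numerical symbol. -/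
def symbolRadius (τ : Plane) : ℝ := Real.sqrt (symbA (proj τ) ^ 2 + symbB (proj τ) ^ 2)

/-- The radius is the modulus of `torusSeries` divided by 2π. -/
lemma exists_symbolRadius_le : ∃ C, ∀ τ ∈ Q, τ ≠ 0 → symbolRadius τ ≤ C := by
  obtain ⟨C, hC⟩ := exists_norm_torusSeries_le
  refine ⟨1 / (2 * Real.pi) * C, fun τ hτ h0 => ?_⟩
  have h1 := hC (proj τ) fun h => Q_inter_periodLattice hτ h0 (proj_eq_zero_iff.mp h)
  have h2 : symbolRadius τ = 1 / (2 * Real.pi) * ‖torusSeries (proj τ)‖ := by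
    have hpi := Real.pi_pos
    rw [symbolRadius, symbA, symbB, ← Real.sqrt_sq (show 0 ≤ 1 / (2 * Real.pi) * ‖torusSeries (proj τ)‖ by positivity),
      mul_pow _ ‖_‖, Complex.sq_norm, Complex.normSq_apply]
    congr 1; ring
  rw [h2]
  have hpi := Real.pi_pos
  gcongr

lemma realEigenvalues_symbolMatrix (τ : Plane) :
    realEigenvalues (symbolMatrix τ) = {symbolRadius τ, -symbolRadius τ} := by
  ext x
  have h := hasEigenvalue_symm_trace_zero (symbA (proj τ)) (symbB (proj τ)) x
  refine h.trans ?_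
  simp only [Set.mem_insert_iff, Set.mem_singleton_iff, symbolRadius]
  norm_cast

lemma isGreatest_realEigenvalues (τ : Plane) (x : ℝ) :
    IsGreatest (realEigenvalues (symbolMatrix τ)) x ↔ x = symbolRadius τ := by
  have h0 : 0 ≤ symbolRadius τ := Real.sqrt_nonneg _
  have h : IsGreatest (realEigenvalues (symbolMatrix τ)) (symbolRadius τ) := by
    rw [realEigenvalues_symbolMatrix]
    refine ⟨by simp, ?_⟩
    rintro y (rfl | rfl)
    · exact le_rfl
    · linarith
  exact ⟨fun hx => hx.unique h, fun hx => hx ▸ h⟩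

lemma isLeast_realEigenvalues (τ : Plane) (x : ℝ) :
    IsLeast (realEigenvalues (symbolMatrix τ)) x ↔ x = -symbolRadius τ := by
  have h0 : 0 ≤ symbolRadius τ := Real.sqrt_nonneg _
  have h : IsLeast (realEigenvalues (symbolMatrix τ)) (-symbolRadius τ) := by
    rw [realEigenvalues_symbolMatrix]
    refine ⟨by simp, ?_⟩
    rintro y (rfl | rfl)
    · linarith
    · exact le_rfl
  exact ⟨fun hx => hx.unique h, fun hx => hx ▸ h⟩

lemma pi_zero_mem_Q : (!₂[Real.pi, 0] : Plane) ∈ Q := by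
  have := Real.pi_pos
  intro i; fin_cases i
  · exact ⟨by simp; linarith, by simp⟩
  · exact ⟨by simp; linarith, by simp; linarith⟩

lemma pi_zero_ne_zero : (!₂[Real.pi, 0] : Plane) ≠ 0 := by
  intro h
  have := congrFun (congrArg WithLp.ofLp h) 0
  simp at this

lemma Lambda0_pos : 0 < Lambda0 := by
  have := exists_weierstrassP_half_eq_Lambda0.2.1; linarith

lemma symbB_pi_zero : symbB (proj !₂[Real.pi, 0]) = 0 :=
  symbB_eq_zero pi_zero_mem_Q (i := 0) (Or.inl (by simp))

lemma symbolRadius_pi_zero : symbolRadius !₂[Real.pi, 0] = Lambda0 := by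
  rw [symbolRadius, symbA_pi_zero, symbB_pi_zero]
  rw [zero_pow two_ne_zero, add_zero, Real.sqrt_sq Lambda0_pos.le]

/-- Each spectrum is symmetric about 0, so the least eigenvalues are the negatives of the greatest
ones; the point (π, 0) contributes `Lambda0` to the supremum. -/
lemma exists_lambda {F : Plane → Matrix (Fin 2) (Fin 2) ℂ} (hF : IsNumericalSymbol F) :
    ∃ Lm Lp : ℝ, IsLambdaMinus F Lm ∧ IsLambdaPlus F Lp ∧ Lambda0 ≤ Lp ∧ Lm = -Lp := by
  obtain ⟨C, hC⟩ := exists_symbolRadius_le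
  set S : Set ℝ := {x | ∃ τ ∈ Q, τ ≠ 0 ∧ x = symbolRadius τ} with hS
  have e1 : {x | ∃ τ ∈ Q, τ ≠ 0 ∧ IsGreatest (realEigenvalues (F τ)) x} = S := by
    ext x
    refine exists_congr fun τ => and_congr_right fun hτ => and_congr_right fun h0 => ?_
    rw [hF.eq_symbolMatrix hτ h0, isGreatest_realEigenvalues]
  have e2 : {x | ∃ τ ∈ Q, τ ≠ 0 ∧ IsLeast (realEigenvalues (F τ)) x} = -S := by
    ext x
    rw [Set.mem_neg]
    refine exists_congr fun τ => and_congr_right fun hτ => and_congr_right fun h0 => ?_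
    rw [hF.eq_symbolMatrix hτ h0, isLeast_realEigenvalues, neg_eq_iff_eq_neg]
  have hmem : Lambda0 ∈ S := ⟨_, pi_zero_mem_Q, pi_zero_ne_zero, symbolRadius_pi_zero.symm⟩
  have hlub : IsLUB S (sSup S) := isLUB_csSup ⟨_, hmem⟩
    ⟨C, by rintro x ⟨τ, hτ, h0, rfl⟩; exact hC τ hτ h0⟩
  refine ⟨-sSup S, sSup S, ?_, ?_, hlub.1 hmem, rfl⟩
  · rw [IsLambdaMinus, e2]; exact hlub.neg
  · rw [IsLambdaPlus, e1]; exact hlub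
end DDA

end

/-! ### Approximate eigenvectors of the infinite Toeplitz matrix. -/

noncomputable section
namespace DDA
attribute [local instance] instMeasureSpaceUnitAddCircle
  instIsAddHaarMeasureUnitAddCircleVolume instIsProbabilityMeasureUnitAddCircleVolume

open UnitAddTorus

/-- On the edge τ = (π, t) the off-diagonal entry vanishes and the diagonal one passes continuously
from `Lambda0` at t = 0 to 0 at t = π. -/
lemma exists_symbA_eq {l : ℝ} (h0 : 0 ≤ l) (h1 : l ≤ Lambda0) :
    ∃ x : T2, x ≠ 0 ∧ symbA x = l ∧ symbB x = 0 := by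
  have hpi := Real.pi_pos
  let γ : ℝ → Plane := fun t => !₂[Real.pi, t]
  have hγ : Continuous γ := by
    refine (PiLp.continuous_toLp 2 _).comp (continuous_pi fun i => ?_)
    fin_cases i
    · exact continuous_const
    · exact continuous_id
  have hQ : ∀ t ∈ Set.Icc 0 Real.pi, γ t ∈ Q := by
    intro t ht i
    fin_cases i
    · exact ⟨by simp [γ]; linarith, by simp [γ]⟩
    · exact ⟨by simpa [γ] using by linarith [ht.1], by simpa [γ] using ht.2⟩
  have hne : ∀ t, γ t ≠ 0 := by
    intro t h
    have := congrFun (congrArg WithLp.ofLp h) 0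
    simp [γ] at this
  have hp : ∀ t ∈ Set.Icc 0 Real.pi, proj (γ t) ≠ 0 := fun t ht h =>
    Q_inter_periodLattice (hQ t ht) (hne t) (proj_eq_zero_iff.mp h)
  have hc : ContinuousOn (fun t => symbA (proj (γ t))) (Set.Icc 0 Real.pi) :=
    continuousOn_symbA.comp (continuous_proj.comp hγ).continuousOn hp
  have hpp : symbA (proj (γ Real.pi)) = 0 := by
    have : proj (γ Real.pi) = ![((1 / 2 : ℝ) : UnitAddCircle), ((1 / 2 : ℝ) : UnitAddCircle)] := by
      have := Real.pi_ne_zero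
      ext i
      fin_cases i
      · simp only [proj]
        congr 1
        simp [γ]; field_simp
      · simp only [proj]
        congr 1
        simp [γ]; field_simp
    rw [this, symbA, torusSeries_half_half]; simp
  have := intermediate_value_Icc' hpi.le hc
  rw [hpp, show symbA (proj (γ 0)) = Lambda0 from symbA_pi_zero] at this
  obtain ⟨t, ht, hl⟩ := this ⟨h0, h1⟩
  exact ⟨proj (γ t), hp t ht, hl, symbB_eq_zero (hQ t ht) (i := 0) (Or.inl (by simp [γ]))⟩

/-- The trigonometric polynomial with coefficients `p`. -/
def trigPoly (p : (Fin 2 → ℤ) →₀ ℂ) : C(T2, ℂ) := p.sum fun n c => c • mFourier n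

lemma trigPoly_apply (p : (Fin 2 → ℤ) →₀ ℂ) (x : T2) :
    trigPoly p x = ∑ n ∈ p.support, p n * mFourier n x := by
  simp [trigPoly, Finsupp.sum, ContinuousMap.sum_apply]

lemma exists_trigPoly_near (φ : C(T2, ℂ)) {δ : ℝ} (hδ : 0 < δ) :
    ∃ p, ∀ x, ‖trigPoly p x - φ x‖ < δ := by
  have h : φ ∈ (Submodule.span ℂ (Set.range (mFourier (d := Fin 2)))).topologicalClosure := by
    rw [span_mFourier_closure_eq_top]; trivial
  rw [← SetLike.mem_coe, Submodule.topologicalClosure_coe, Metric.mem_closure_iff] at h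
  obtain ⟨P, hP, hd⟩ := h δ hδ
  obtain ⟨p, rfl⟩ := Finsupp.mem_span_range_iff_exists_finsupp.mp hP
  refine ⟨p, fun x => ?_⟩
  rw [dist_comm] at hd
  rw [← dist_eq_norm]
  exact (ContinuousMap.dist_apply_le_dist x).trans_lt hd

/-- Multiplication by a symbol acts on coefficients as its Toeplitz matrix. -/
lemma mFourierCoeff_mul_trigPoly {h : T2 → ℂ} (hh : MemLp h 2) (p : (Fin 2 → ℤ) →₀ ℂ)
    (m : Fin 2 → ℤ) : mFourierCoeff (fun x => h x * trigPoly p x) m =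
      ∑ n ∈ p.support, p n * mFourierCoeff h (m - n) := by
  have hi : ∀ k, Integrable fun x => mFourier k x • h x := fun k => by
    refine (hh.integrable (by norm_num)).bdd_mul (c := 1) ?_ ?_
    · exact (mFourier k).continuous.aestronglyMeasurable
    · exact Eventually.of_forall fun x => (norm_mFourier_apply _ x).le
  simp only [mFourierCoeff, ← integral_const_mul]
  rw [← integral_finsetSum _ fun n _ => (hi _).const_mul _]
  congr 1; ext x
  rw [trigPoly_apply, Finset.mul_sum, smul_eq_mul, Finset.mul_sum]
  refine Finset.sum_congr rfl fun n _ => ?_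
  rw [show -(m - n) = -m + n by abel, mFourier_add, smul_eq_mul]
  ring

lemma hasSum_sq_mFourierCoeff_of_memLp {f : T2 → ℂ} (hf : MemLp f 2) :
    HasSum (fun m => ‖mFourierCoeff f m‖ ^ 2) (∫ x, ‖f x‖ ^ 2) := by
  have h := hasSum_sq_mFourierCoeff hf.toLp
  have e : ∀ m, mFourierCoeff (hf.toLp f) m = mFourierCoeff f m := fun m =>
    integral_congr_ae (by filter_upwards [hf.coeFn_toLp] with x hx; rw [hx])
  simp only [e] at h
  rwa [integral_congr_ae (show (fun x => ‖hf.toLp f x‖ ^ 2) =ᵐ[volume] fun x => ‖f x‖ ^ 2 by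
    filter_upwards [hf.coeFn_toLp] with x hx; rw [hx])] at h

lemma memLp_trigPoly (p : (Fin 2 → ℤ) →₀ ℂ) : MemLp (trigPoly p) 2 volume :=
  (trigPoly p).continuous.memLp_of_hasCompactSupport (HasCompactSupport.of_compactSpace _)

lemma memLp_mul_trigPoly {h : T2 → ℂ} (hh : MemLp h 2) (p : (Fin 2 → ℤ) →₀ ℂ) :
    MemLp (fun x => h x * trigPoly p x) 2 volume := by
  obtain ⟨B, hB⟩ := isCompact_univ.exists_bound_of_continuousOn (trigPoly p).continuous.continuousOn
  exact hh.of_le_mul (c := B) (hh.1.mul (trigPoly p).continuous.aestronglyMeasurable)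
    (Eventually.of_forall fun x => by rw [norm_mul, mul_comm]; gcongr; exact hB x trivial)

lemma mFourierCoeff_sub {f g : T2 → ℂ} (hf : MemLp f 2) (hg : MemLp g 2) (m : Fin 2 → ℤ) :
    mFourierCoeff (fun x => f x - g x) m = mFourierCoeff f m - mFourierCoeff g m := by
  have hi : ∀ f : T2 → ℂ, MemLp f 2 → Integrable fun x => mFourier (-m) x • f x := fun f hf => by
    refine (hf.integrable (by norm_num)).bdd_mul (c := 1) ?_ ?_
    · exact (mFourier (-m)).continuous.aestronglyMeasurable
    · exact Eventually.of_forall fun x => (norm_mFourier_apply _ x).le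
  simp only [mFourierCoeff]
  rw [← integral_sub (hi f hf) (hi g hg)]
  simp only [smul_sub]

lemma mFourierCoeff_trigPoly (p : (Fin 2 → ℤ) →₀ ℂ) (m : Fin 2 → ℤ) :
    mFourierCoeff (trigPoly p) m = p m := by
  have h := mFourierCoeff_mul_trigPoly (h := fun _ => 1) (memLp_const 1) p m
  simp only [one_mul] at h
  have e : ∀ k : Fin 2 → ℤ, mFourierCoeff (fun _ : T2 => (1 : ℂ)) k = if k = 0 then 1 else 0 := by
    intro k
    have h1 := orthonormal_iff_ite.mp (mFourierBasis (d := Fin 2)).orthonormal k 0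
    have h2 := mFourierBasis_repr (mFourierBasis (d := Fin 2) 0) k
    rw [HilbertBasis.repr_apply_apply, h1, coe_mFourierBasis] at h2
    rw [h2]
    refine integral_congr_ae ?_
    filter_upwards [coeFn_mFourierLp 2 (0 : Fin 2 → ℤ)] with x hx
    rw [hx, mFourier_zero]; rfl
  rw [h]
  simp only [e, sub_eq_zero, mul_ite, mul_one, mul_zero, Finset.sum_ite_eq, Finsupp.mem_support_iff]
  by_cases hm : p m = 0 <;> simp [hm]

lemma integral_norm_sq_trigPoly (p : (Fin 2 → ℤ) →₀ ℂ) :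
    ∫ x, ‖trigPoly p x‖ ^ 2 = ∑ n ∈ p.support, ‖p n‖ ^ 2 := by
  have h := hasSum_sq_mFourierCoeff_of_memLp (memLp_trigPoly p)
  simp only [mFourierCoeff_trigPoly] at h
  refine h.unique (hasSum_sum_of_ne_finset_zero fun n hn => ?_)
  rw [Finsupp.notMem_support_iff.mp hn]; simp

/-- Trigonometric polynomials can be concentrated where a function is small. -/
lemma exists_trigPoly_concentrated {g : T2 → ℝ} (hgm : AEStronglyMeasurable g) {G : ℝ}
    (hg0 : ∀ x, 0 ≤ g x) (hgG : ∀ x, g x ≤ G) {x₀ : T2} (hc : ContinuousAt g x₀) (hx₀ : g x₀ = 0)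
    {η : ℝ} (hη : 0 < η) : ∃ p, 0 < ∫ x, ‖trigPoly p x‖ ^ 2 ∧
      ∫ x, g x * ‖trigPoly p x‖ ^ 2 ≤ 4 * η * ∫ x, ‖trigPoly p x‖ ^ 2 := by
  have hG : 0 ≤ G := (hg0 0).trans (hgG 0)
  obtain ⟨r, hr, hball⟩ := Metric.continuousAt_iff.mp hc (η / 2) (by positivity)
  -- A tent supported in the ball on which `g` stays below η/2.
  let φ : C(T2, ℝ) := ⟨fun x => max 0 (r - dist x x₀), by fun_prop⟩
  have hφ : ∀ x, g x * φ x ^ 2 ≤ η / 2 * φ x ^ 2 := by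
    intro x
    by_cases hx : dist x x₀ < r
    · have h := hball hx
      rw [hx₀, Real.dist_eq, sub_zero, abs_of_nonneg (hg0 x)] at h
      gcongr
    · have : φ x = 0 := max_eq_left (by linarith)
      simp [this]
  have hI : 0 < ∫ x, φ x ^ 2 := by
    refine Continuous.integral_pos_of_hasCompactSupport_nonneg_nonzero (x := x₀) (by fun_prop)
      (HasCompactSupport.of_compactSpace _) (fun x => sq_nonneg _) ?_
    have : φ x₀ = r := by simp [φ, hr.le]
    rw [this]; positivity
  set I := ∫ x, φ x ^ 2
  -- `D` is the allowed square of the uniform error. The first bound keeps the mass of the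
  -- polynomial at least I/4; the second keeps the error terms, in total at most 4(η + 2G)D, no
  -- larger than ηI.
  set D := min (I / 4) (η * I / (4 * (η + 2 * G)))
  have hD : 0 < D := by positivity
  have hD1 : D ≤ I / 4 := min_le_left _ _
  have hD2 : (η + 2 * G) * D ≤ η * (I / 4) := by
    have : D ≤ η * I / (4 * (η + 2 * G)) := min_le_right _ _
    rw [le_div_iff₀ (by positivity)] at this
    linarith
  obtain ⟨p, hp⟩ := exists_trigPoly_near ⟨fun x => (φ x : ℂ), by fun_prop⟩ (Real.sqrt_pos.mpr hD)
  have hp' : ∀ x, ‖trigPoly p x - φ x‖ ^ 2 ≤ D := fun x => by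
    rw [← Real.sq_sqrt hD.le]; exact pow_le_pow_left₀ (norm_nonneg _) (hp x).le 2
  have ineq : ∀ z w : ℂ, ‖z + w‖ ^ 2 ≤ 2 * ‖z‖ ^ 2 + 2 * ‖w‖ ^ 2 := fun z w => by
    nlinarith [norm_add_le z w, norm_nonneg (z + w), sq_nonneg (‖z‖ - ‖w‖)]
  have hφn : ∀ x, ‖(φ x : ℂ)‖ ^ 2 = φ x ^ 2 := fun x => by simp
  have b1 : ∀ x, φ x ^ 2 ≤ 2 * ‖trigPoly p x‖ ^ 2 + 2 * D := fun x => by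
    have h := ineq (trigPoly p x) (φ x - trigPoly p x)
    rw [add_sub_cancel, hφn, norm_sub_rev] at h
    linarith [hp' x]
  have b2 : ∀ x, g x * ‖trigPoly p x‖ ^ 2 ≤ η * φ x ^ 2 + 2 * G * D := fun x => by
    have h := ineq (φ x) (trigPoly p x - φ x)
    rw [add_sub_cancel, hφn] at h
    have h2 : g x * ‖trigPoly p x - φ x‖ ^ 2 ≤ G * D :=
      mul_le_mul (hgG x) (hp' x) (by positivity) hG
    nlinarith [mul_le_mul_of_nonneg_left h (hg0 x), hφ x]
  have i1 : Integrable fun x => ‖trigPoly p x‖ ^ 2 :=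
    Continuous.integrable_of_hasCompactSupport (by fun_prop) (HasCompactSupport.of_compactSpace _)
  have i2 : Integrable fun x => φ x ^ 2 :=
    Continuous.integrable_of_hasCompactSupport (by fun_prop) (HasCompactSupport.of_compactSpace _)
  have i3 : Integrable fun x => g x * ‖trigPoly p x‖ ^ 2 :=
    i1.bdd_mul (c := G) hgm (Eventually.of_forall fun x => by
      rw [Real.norm_of_nonneg (hg0 x)]; exact hgG x)
  have c1 : I ≤ 2 * (∫ x, ‖trigPoly p x‖ ^ 2) + 2 * D := by
    have := integral_mono i2 ((i1.const_mul 2).add (integrable_const (2 * D))) b1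
    simpa [integral_add (i1.const_mul 2) (integrable_const (2 * D)), integral_const_mul] using this
  have c2 : ∫ x, g x * ‖trigPoly p x‖ ^ 2 ≤ η * I + 2 * G * D := by
    have := integral_mono i3 ((i2.const_mul η).add (integrable_const (2 * G * D))) b2
    simpa [integral_add (i2.const_mul η) (integrable_const (2 * G * D)), integral_const_mul]
      using this
  refine ⟨p, by linarith, c2.trans ?_⟩
  nlinarith [mul_le_mul_of_nonneg_left c1 hη.le]

/-- The entries of the numerical symbol, as functions on the torus. -/
def symbEntry (i j : Fin 2) (x : T2) : ℝ := !![symbA x, symbB x; symbB x, -symbA x] i j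

lemma symbEntry_cases (P : (T2 → ℝ) → Prop) (hA : P symbA) (hB : P symbB)
    (hN : P fun x => -symbA x) (i j : Fin 2) : P (symbEntry i j) := by
  fin_cases i <;> fin_cases j
  exacts [hA, hB, hB, hN]

lemma memLp_symbEntry (i j : Fin 2) : MemLp (fun x => (symbEntry i j x : ℂ)) 2 volume :=
  symbEntry_cases (fun f => MemLp (fun x => (f x : ℂ)) 2 volume) memLp_symbA memLp_symbB
    (by simpa using! memLp_symbA.neg) i j

lemma continuousOn_symbEntry (i j : Fin 2) : ContinuousOn (symbEntry i j) {0}ᶜ :=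
  symbEntry_cases (ContinuousOn · {0}ᶜ) continuousOn_symbA continuousOn_symbB
    continuousOn_symbA.neg i j

lemma exists_abs_symbEntry_le (i j : Fin 2) : ∃ C, ∀ x, |symbEntry i j x| ≤ C := by
  obtain ⟨C, hC⟩ := exists_norm_torusSeries_le
  have hpi := Real.pi_pos
  have h1 : ∀ x, ‖torusSeries x‖ ≤ max C ‖torusSeries 0‖ := fun x => by
    by_cases hx : x = 0
    · rw [hx]; exact le_max_right _ _
    · exact (hC x hx).trans (le_max_left _ _)
  have hA : ∀ x, |symbA x| ≤ 1 / (2 * Real.pi) * max C ‖torusSeries 0‖ := fun x => by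
    rw [symbA, abs_mul, abs_neg, abs_of_pos (show 0 < 1 / (2 * Real.pi) by positivity)]
    gcongr; exact (Complex.abs_re_le_norm _).trans (h1 x)
  have hB : ∀ x, |symbB x| ≤ 1 / (2 * Real.pi) * max C ‖torusSeries 0‖ := fun x => by
    rw [symbB, abs_mul, abs_of_pos (show 0 < 1 / (2 * Real.pi) by positivity)]
    gcongr; exact (Complex.abs_im_le_norm _).trans (h1 x)
  exact ⟨_, symbEntry_cases (fun f => ∀ x, |f x| ≤ _) hA hB (by simpa using hA) i j⟩

lemma mFourierCoeff_symbEntry (i j : Fin 2) (m : Fin 2 → ℤ) :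
    mFourierCoeff (fun x => (symbEntry i j x : ℂ)) m = kernel (latticePoint m) i j := by
  rw [kernel_latticePoint]
  fin_cases i <;> fin_cases j
  · exact mFourierCoeff_symbA m
  · exact mFourierCoeff_symbB m
  · exact mFourierCoeff_symbB m
  · simp only [symbEntry]
    simp [mFourierCoeff_neg_fun, mFourierCoeff_symbA]

/-- Approximate eigenvectors of the infinite block Toeplitz matrix, as trigonometric polynomials. -/
lemma exists_approx_eigenvector {lam : ℝ} (hlam : |lam| ≤ Lambda0) {η : ℝ} (hη : 0 < η) :
    ∃ (e : Fin 2) (p : (Fin 2 → ℤ) →₀ ℂ), 0 < ∑ n ∈ p.support, ‖p n‖ ^ 2 ∧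
      ∀ s : Finset (Fin 2 → ℤ), ∑ m ∈ s, ∑ i, ‖(if i = e then lam * p m else 0) -
        ∑ n ∈ p.support, kernel (latticePoint (m - n)) i e * p n‖ ^ 2 ≤
        η * ∑ n ∈ p.support, ‖p n‖ ^ 2 := by
  obtain ⟨x₀, hx₀, hA, hB⟩ := exists_symbA_eq (abs_nonneg lam) hlam
  -- At `x₀` the symbol is diag(|lam|, -|lam|), so a unit vector is an eigenvector for `lam`, the
  -- first or the second according to its sign.
  obtain ⟨e, he⟩ : ∃ e : Fin 2, ∀ i, symbEntry i e x₀ = if i = e then lam else 0 := by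
    rcases abs_choice lam with h | h
    · refine ⟨0, fun i => ?_⟩
      fin_cases i
      · simp [symbEntry, hA, h]
      · simp [symbEntry, hB]
    · refine ⟨1, fun i => ?_⟩
      fin_cases i
      · simp [symbEntry, hB]
      · simp [symbEntry, hA, h]
  -- The column `e` of lam - F. It vanishes at `x₀`, so its product with a polynomial concentrated
  -- near `x₀` is small in L².
  let q : Fin 2 → T2 → ℝ := fun i x => (if i = e then lam else 0) - symbEntry i e x
  have hq : ∀ i, MemLp (fun x => (q i x : ℂ)) 2 volume := fun i => by
    simpa [q] using! (memLp_const (((if i = e then lam else 0 : ℝ)) : ℂ)).sub (memLp_symbEntry i e)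
  have hqc : ∀ i, ContinuousAt (q i) x₀ := fun i => continuousAt_const.sub
    ((continuousOn_symbEntry i e).continuousAt (isOpen_compl_singleton.mem_nhds hx₀))
  choose C hC using fun i => exists_abs_symbEntry_le i e
  have hqb : ∀ i x, |q i x| ≤ |lam| + C i := fun i x => by
    refine (abs_sub _ _).trans (add_le_add ?_ (hC i x))
    split_ifs <;> simp
  have hgm : AEStronglyMeasurable (fun x => ∑ i, q i x ^ 2) (volume : Measure T2) := by
    refine Finset.aestronglyMeasurable_fun_sum _ fun i _ => ?_
    have := (Complex.continuous_re.comp_aestronglyMeasurable (hq i).1)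
    simp only [Complex.ofReal_re] at this
    exact this.pow 2
  obtain ⟨p, hp0, hp⟩ := exists_trigPoly_concentrated (x₀ := x₀) (η := η / 4)
    (G := ∑ i, (|lam| + C i) ^ 2) hgm
    (fun x => Finset.sum_nonneg fun i _ => sq_nonneg _)
    (fun x => Finset.sum_le_sum fun i _ => by
      rw [← sq_abs]; exact pow_le_pow_left₀ (abs_nonneg _) (hqb i x) 2)
    (tendsto_finsetSum _ fun i _ => (hqc i).pow 2)
    (Finset.sum_eq_zero fun i _ => by simp [q, he]) (by positivity)
  rw [integral_norm_sq_trigPoly] at hp0 hp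
  refine ⟨e, p, hp0, fun s => ?_⟩
  have hm : ∀ i, MemLp (fun x => (q i x : ℂ) * trigPoly p x) 2 volume := fun i =>
    memLp_mul_trigPoly (hq i) p
  have key : ∀ i m, mFourierCoeff (fun x => (q i x : ℂ) * trigPoly p x) m =
      (if i = e then lam * p m else 0) -
        ∑ n ∈ p.support, kernel (latticePoint (m - n)) i e * p n := by
    intro i m
    have e1 : (fun x => (q i x : ℂ) * trigPoly p x) =
        fun x => ((if i = e then lam else 0 : ℝ) : ℂ) * trigPoly p x -
          symbEntry i e x * trigPoly p x := by
      ext x; simp only [q]; push_cast; ring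
    rw [e1, mFourierCoeff_sub (((memLp_trigPoly p).const_mul _)) (memLp_mul_trigPoly
      (memLp_symbEntry i e) p), mFourierCoeff_const_mul, mFourierCoeff_trigPoly,
      mFourierCoeff_mul_trigPoly (memLp_symbEntry i e)]
    simp only [mFourierCoeff_symbEntry]
    congr 1
    · split_ifs <;> simp
    · exact Finset.sum_congr rfl fun n _ => mul_comm _ _
  simp only [← key]
  rw [Finset.sum_comm]
  -- Bessel's inequality over the index set `s`; the resulting bound does not depend on `s`.
  calc ∑ i, ∑ m ∈ s, ‖mFourierCoeff (fun x => (q i x : ℂ) * trigPoly p x) m‖ ^ 2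
      ≤ ∑ i, ∫ x, ‖(q i x : ℂ) * trigPoly p x‖ ^ 2 := Finset.sum_le_sum fun i _ =>
        sum_le_hasSum _ (fun _ _ => sq_nonneg _) (hasSum_sq_mFourierCoeff_of_memLp (hm i))
    _ = ∫ x, (∑ i, q i x ^ 2) * ‖trigPoly p x‖ ^ 2 := by
        rw [← integral_finsetSum _ fun i _ => (hm i).integrable_norm_pow (by norm_num)]
        congr 1; ext x
        rw [Finset.sum_mul]
        refine Finset.sum_congr rfl fun i _ => ?_
        rw [norm_mul, mul_pow, Complex.norm_real, Real.norm_eq_abs, sq_abs]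
    _ ≤ _ := by linarith
end DDA

end

/-! ### Finite sections on the grids: instability of the scheme. -/

noncomputable section
namespace DDA

lemma kernel_smul (c : ℝ) (x : Plane) : kernel (c • x) = (c : ℂ)⁻¹ ^ 2 • kernel x := by
  ext i j
  by_cases hc : c = 0
  · subst hc; simp [kernel]
  have h4 : |c| ^ 4 = c ^ 4 := by rw [show 4 = 2 * 2 from rfl, pow_mul, sq_abs, ← pow_mul]
  simp only [kernel, Matrix.smul_apply, Matrix.of_apply, smul_eq_mul, norm_smul, Real.norm_eq_abs,
    mul_pow, sq_abs, h4, PiLp.smul_apply]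
  rw [← Complex.ofReal_inv, ← Complex.ofReal_pow, ← Complex.ofReal_mul]
  congr 1
  by_cases hx : ‖x‖ = 0
  · simp [hx]
  · split_ifs <;> field_simp; ring

lemma kernel_zero : kernel 0 = 0 := by
  ext i j; simp [kernel]

/-- Homogeneity of degree -2 cancels the factor N⁻²: all system matrices are sections of one
Toeplitz matrix, and the mesh and the origin enter only through the index set. The zero diagonal
agrees with the default value of `kernel` at 0. -/
lemma systemMatrix_apply (Ω : Set Plane) (o : Plane) (N : ℕ+) (k l : gridIndex Ω o N) (i j : Fin 2) :
    systemMatrix Ω o N (k, i) (l, j) = kernel (latticePoint (k - l)) i j := by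
  have hN : ((N : ℕ) : ℂ) ≠ 0 := by exact_mod_cast N.ne_zero
  have e : latticePoint (k - l) = latticePoint k - latticePoint l := by
    ext i; simp [latticePoint]
  simp only [systemMatrix, Matrix.of_apply]
  split_ifs with h
  · rw [h, sub_self, show latticePoint 0 = 0 by ext; simp [latticePoint], kernel_zero]; rfl
  · rw [gridPoint, gridPoint, add_sub_add_left_eq_sub, ← smul_sub, ← e, kernel_smul]
    simp only [Matrix.smul_apply, smul_eq_mul]
    push_cast
    rw [inv_inv, ← mul_assoc, inv_mul_cancel₀ (pow_ne_zero 2 hN), one_mul]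

/-- A fixed disc in `Ω` contains arbitrarily large blocks of a fine grid wherever its origin lies.
The threshold for `N` comes before the quantifier over `o`, which covers every choice of origins. -/
lemma eventually_translate_subset_gridIndex {Ω : Set Plane} (hΩ : IsOpen Ω) (hne : Ω.Nonempty)
    (S : Finset (Fin 2 → ℤ)) :
    ∀ᶠ N : ℕ+ in atTop, ∀ o, ∃ s, ∀ n ∈ S, s + n ∈ gridIndex Ω o N := by
  obtain ⟨c, hc⟩ := hne
  obtain ⟨r, hr, hball⟩ := Metric.isOpen_iff.mp hΩ c hc
  obtain ⟨B, hB⟩ : ∃ B : ℝ, ∀ n ∈ S, ∀ i, |(n i : ℝ)| ≤ B := by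
    refine ⟨∑ n ∈ S, ∑ i, |(n i : ℝ)|, fun n hn i => ?_⟩
    refine (Finset.single_le_sum (f := fun i => |(n i : ℝ)|) (fun _ _ => abs_nonneg _)
      (Finset.mem_univ i)).trans ?_
    exact Finset.single_le_sum (f := fun n : Fin 2 → ℤ => ∑ i, |(n i : ℝ)|)
      (fun _ _ => Finset.sum_nonneg fun _ _ => abs_nonneg _) hn
  obtain ⟨N₁, hN₁⟩ := exists_nat_gt (2 * (1 + B) / r)
  filter_upwards [eventually_ge_atTop N₁.succPNat] with N hN o
  have hN0 : (0 : ℝ) < ((N : ℕ) : ℝ) := by exact_mod_cast N.pos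
  have hN2 : 2 * (1 + B) / r < ((N : ℕ) : ℝ) := by
    refine hN₁.trans_le ?_
    have : N₁ + 1 ≤ (N : ℕ) := hN
    exact_mod_cast (Nat.le_succ _).trans this
  rw [div_lt_iff₀ hr, mul_comm (((N : ℕ) : ℝ))] at hN2
  -- This translation takes the index 0 to a grid point within 1/N of `c` in each coordinate; adding
  -- `n` costs at most B/N more.
  refine ⟨fun i => ⌊((N : ℕ) : ℝ) * (c i - o i)⌋, fun n hn => hball ?_⟩
  rw [Metric.mem_ball, dist_eq_norm]
  have hi : ∀ i, |(gridPoint o N ((fun i => ⌊((N : ℕ) : ℝ) * (c i - o i)⌋) + n) - c) i| ≤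
      (1 + B) / ((N : ℕ) : ℝ) := fun i => by
    rw [le_div_iff₀ hN0, ← abs_of_pos hN0, ← abs_mul, abs_of_pos hN0]
    have e : (gridPoint o N ((fun i => ⌊((N : ℕ) : ℝ) * (c i - o i)⌋) + n) - c) i * ((N : ℕ) : ℝ) =
        n i - Int.fract (((N : ℕ) : ℝ) * (c i - o i)) := by
      simp only [gridPoint, latticePoint, PiLp.sub_apply, PiLp.add_apply, PiLp.smul_apply,
        smul_eq_mul, Pi.add_apply, Int.cast_add, Int.fract]
      field_simp
      ring
    rw [e]
    refine (abs_sub _ _).trans ?_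
    rw [abs_of_nonneg (Int.fract_nonneg (((N : ℕ) : ℝ) * (c i - o i)))]
    linarith [hB n hn i, (Int.fract_lt_one (((N : ℕ) : ℝ) * (c i - o i))).le]
  have hB0 : 0 ≤ (1 + B) / ((N : ℕ) : ℝ) := (abs_nonneg _).trans (hi 0)
  have hr2 : 2 * ((1 + B) / ((N : ℕ) : ℝ)) < r := by
    rwa [mul_div_assoc', div_lt_iff₀ hN0]
  refine lt_of_pow_lt_pow_left₀ 2 hr.le ?_
  rw [EuclideanSpace.norm_sq_eq, Fin.sum_univ_two]
  have h0 := pow_le_pow_left₀ (abs_nonneg _) (hi 0) 2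
  have h1 := pow_le_pow_left₀ (abs_nonneg _) (hi 1) 2
  simp only [Real.norm_eq_abs]
  nlinarith

-- Translate `p` by `s` into the grid, in the component `e`. The residual of this vector consists of
-- some rows of the residual on the whole lattice, so it obeys the same bound, and a resolvent bound
-- `C` would give ‖p‖² ≤ C²η‖p‖² < ‖p‖².
open Classical in
lemma not_resolventBound {Ω : Set Plane} (hΩb : Bornology.IsBounded Ω) {o : Plane} {lam : ℝ}
    {N : ℕ+} {C η : ℝ} (hC : C ^ 2 * η < 1) {e : Fin 2} {p : (Fin 2 → ℤ) →₀ ℂ}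
    (hp0 : 0 < ∑ n ∈ p.support, ‖p n‖ ^ 2)
    (hp : ∀ s : Finset (Fin 2 → ℤ), ∑ m ∈ s, ∑ i, ‖(if i = e then lam * p m else 0) -
        ∑ n ∈ p.support, kernel (latticePoint (m - n)) i e * p n‖ ^ 2 ≤
        η * ∑ n ∈ p.support, ‖p n‖ ^ 2) {s : Fin 2 → ℤ}
    (hs : ∀ n ∈ p.support, s + n ∈ gridIndex Ω o N) : ¬ ResolventBound hΩb o (lam : ℂ) N C := by
  rintro ⟨hu, hn⟩
  let _ : Fintype (gridIndex Ω o N) := (finite_gridIndex hΩb o N).fintype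
  set M : Matrix (gridIndex Ω o N × Fin 2) (gridIndex Ω o N × Fin 2) ℂ :=
    (lam : ℂ) • 1 - systemMatrix Ω o N with hM
  let U : gridIndex Ω o N × Fin 2 → ℂ := fun q => if q.2 = e then p (q.1 - s) else 0
  have hsum : ∀ {E : Type} [AddCommMonoid E] (f : (Fin 2 → ℤ) → E), (∀ n ∉ p.support, f n = 0) →
      ∑ l : gridIndex Ω o N, f (l - s) = ∑ n ∈ p.support, f n := by
    intro E _ f hf
    rw [Finset.sum_set_coe (s := gridIndex Ω o N) (f := fun l => f (l - s))]
    symm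
    refine Finset.sum_of_injOn (fun n => s + n) (fun a _ b _ h => add_left_cancel h)
      (fun n hn => by simpa using hs n hn) (fun l _ hl => hf _ fun h => hl ⟨l - s, h, by simp⟩)
      (fun n _ => by simp)
  have hMU : ∀ k i, (M.mulVec U) (k, i) = (if i = e then lam * p (k - s) else 0) -
      ∑ n ∈ p.support, kernel (latticePoint (k - s - n)) i e * p n := by
    intro k i
    rw [hM, Matrix.sub_mulVec, Matrix.smul_mulVec, Matrix.one_mulVec, Pi.sub_apply, Pi.smul_apply]
    congr 1
    · simp [U]
    · rw [Matrix.mulVec, dotProduct, Fintype.sum_prod_type,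
        ← hsum (fun n => kernel (latticePoint (k - s - n)) i e * p n) fun n hn => by
          rw [Finsupp.notMem_support_iff.mp hn, mul_zero]]
      refine Finset.sum_congr rfl fun l _ => ?_
      simp only [systemMatrix_apply, U, mul_ite, mul_zero, Finset.sum_ite_eq', Finset.mem_univ,
        if_true, sub_sub_sub_cancel_right]
  have h1 : ‖WithLp.toLp 2 U‖ ^ 2 = ∑ n ∈ p.support, ‖p n‖ ^ 2 := by
    rw [EuclideanSpace.norm_sq_eq, Fintype.sum_prod_type, ← hsum (fun n => ‖p n‖ ^ 2) fun n hn => by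
          rw [Finsupp.notMem_support_iff.mp hn]; simp]
    refine Finset.sum_congr rfl fun l _ => ?_
    simp [U, apply_ite norm, ite_pow]
  have h2 : ‖WithLp.toLp 2 (M.mulVec U)‖ ^ 2 ≤ η * ∑ n ∈ p.support, ‖p n‖ ^ 2 := by
    refine le_trans (le_of_eq ?_) (hp ((gridIndex Ω o N).toFinset.image (· - s)))
    rw [EuclideanSpace.norm_sq_eq, Fintype.sum_prod_type,
      Finset.sum_image fun a _ b _ h => sub_left_injective h, ← Finset.sum_set_coe]
    simp only [hMU]
  have h3 : ‖WithLp.toLp 2 U‖ ≤ C * ‖WithLp.toLp 2 (M.mulVec U)‖ := by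
    have e : WithLp.toLp 2 U = Matrix.toEuclideanCLM (n := gridIndex Ω o N × Fin 2) (𝕜 := ℂ) M⁻¹
        (WithLp.toLp 2 (M.mulVec U)) := by
      rw [Matrix.toEuclideanCLM_toLp, Matrix.mulVec_mulVec,
        Matrix.nonsing_inv_mul _ ((Matrix.isUnit_iff_isUnit_det _).mp hu), Matrix.one_mulVec]
    rw [e]
    refine (ContinuousLinearMap.le_opNorm _ _).trans ?_
    exact mul_le_mul_of_nonneg_right hn (norm_nonneg _)
  have h4 : ‖WithLp.toLp 2 U‖ ^ 2 ≤ C ^ 2 * ‖WithLp.toLp 2 (M.mulVec U)‖ ^ 2 := by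
    rw [← mul_pow]; exact pow_le_pow_left₀ (norm_nonneg _) h3 2
  nlinarith [mul_le_mul_of_nonneg_left h2 (sq_nonneg C)]

lemma not_schemeStable {Ω : Set Plane} (hΩb : Bornology.IsBounded Ω) (hΩ : IsOpen Ω)
    (hne : Ω.Nonempty) {lam : ℝ} (hlam : |lam| ≤ Lambda0) (o : ℕ+ → Plane) :
    ¬ SchemeStable hΩb o (lam : ℂ) := by
  rintro ⟨C, hC⟩
  obtain ⟨e, p, hp0, hp⟩ := exists_approx_eigenvector hlam (η := 1 / (C ^ 2 + 1)) (by positivity)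
  obtain ⟨N, hN, hs⟩ := (hC.and (eventually_translate_subset_gridIndex hΩ hne p.support)).exists
  obtain ⟨s, hs⟩ := hs (o N)
  refine not_resolventBound hΩb ?_ hp0 hp hs hN
  rw [mul_one_div, div_lt_one (by positivity)]; linarith
end DDA

end

/-! ### Complex coordinates and Lipschitz functions related to the Cauchy kernel. -/

noncomputable section
namespace DDA
open scoped ComplexConjugate NNReal

/-- The identification of the plane with `ℂ`. -/
def toC : Plane ≃ₗᵢ[ℝ] ℂ := Complex.orthonormalBasisOneI.repr.symm

lemma toC_apply (x : Plane) : toC x = x 0 + x 1 * Complex.I :=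
  Complex.orthonormalBasisOneI_repr_symm_apply x

/-- The first unit vector. -/
def e₁ : Plane := EuclideanSpace.single 0 1

/-- The second unit vector. -/
def e₂ : Plane := EuclideanSpace.single 1 1

lemma toC_e₁ : toC e₁ = 1 := by simp [toC_apply, e₁]

lemma toC_e₂ : toC e₂ = Complex.I := by simp [toC_apply, e₂]

lemma toC_eq_zero {x : Plane} : toC x = 0 ↔ x = 0 := by
  rw [← norm_eq_zero, toC.norm_map, norm_eq_zero]

/-! ### A regularized Cauchy kernel -/

/-- The Cauchy kernel `1 / z`, replaced by `conj z / ε²` in the disc of radius `ε`. -/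
def cauchyReg (ε : ℝ) (x : Plane) : ℂ := conj (toC ((max ‖x‖ ε ^ 2)⁻¹ • x))

lemma cauchyReg_of_le {ε : ℝ} {x : Plane} (h : ‖x‖ ≤ ε) :
    cauchyReg ε x = ((ε ^ 2)⁻¹ : ℝ) * conj (toC x) := by
  rw [cauchyReg, max_eq_right h, map_smul, Complex.real_smul, map_mul, Complex.conj_ofReal]

lemma cauchyReg_of_ge {ε : ℝ} {x : Plane} (h : ε ≤ ‖x‖) :
    cauchyReg ε x = (toC x)⁻¹ := by
  rw [cauchyReg, max_eq_left h, map_smul, Complex.real_smul, map_mul, Complex.conj_ofReal,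
    Complex.inv_def, Complex.normSq_eq_norm_sq, toC.norm_map, mul_comm]

/-- The radial profile p/max(p, ε)² rises with slope ε⁻² up to `ε` and then falls like 1/p, with
smaller slope. -/
lemma abs_div_max_sq_sub_le {ε p q : ℝ} (hε : 0 < ε) (hp : 0 ≤ p) (hpq : p ≤ q) :
    |(max p ε ^ 2)⁻¹ * p - (max q ε ^ 2)⁻¹ * q| ≤ (ε ^ 2)⁻¹ * (q - p) := by
  rcases le_total q ε with hq | hq
  · rw [max_eq_right hq, max_eq_right (hpq.trans hq), ← mul_sub, abs_mul,
      abs_of_pos (by positivity), abs_sub_comm, abs_of_nonneg (sub_nonneg.mpr hpq)]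
  have hq0 : 0 < q := hε.trans_le hq
  have eq : (max q ε ^ 2)⁻¹ * q = 1 / q := by rw [max_eq_left hq]; field_simp
  rw [eq]
  rcases le_total p ε with hp' | hp'
  · rw [max_eq_right hp', abs_le]
    constructor
    · have : 1 / q ≤ (ε ^ 2)⁻¹ * q := by
        rw [div_le_iff₀ hq0, mul_assoc, ← div_eq_inv_mul, one_le_div (by positivity)]
        nlinarith
      linarith
    -- For p ≤ ε ≤ q the upper estimate is the inequality of arithmetic and geometric means for `q`
    -- and ε²/q.
    · have : 2 * p ≤ q + ε ^ 2 / q := by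
        have : q + ε ^ 2 / q - 2 * ε = (q - ε) ^ 2 / q := by field_simp; ring
        have h2 : 0 ≤ (q - ε) ^ 2 / q := by positivity
        linarith
      have h3 := mul_le_mul_of_nonneg_left this (show 0 ≤ (ε ^ 2)⁻¹ by positivity)
      have h4 : (ε ^ 2)⁻¹ * (q + ε ^ 2 / q) = (ε ^ 2)⁻¹ * q + 1 / q := by field_simp
      linarith
  · have hp0 : 0 < p := hε.trans_le hp'
    have ep : (max p ε ^ 2)⁻¹ * p = 1 / p := by rw [max_eq_left hp']; field_simp
    rw [ep, abs_of_nonneg (sub_nonneg.mpr (one_div_le_one_div_of_le hp0 hpq)),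
      show 1 / p - 1 / q = (p * q)⁻¹ * (q - p) by field_simp]
    gcongr
    nlinarith

/-- After squaring, the two sides exceed their radial parts by 2ab and 2c² times ‖x‖‖y‖ - ⟨x, y⟩ ≥
0, and ab ≤ c². So the radial estimate suffices. -/
lemma norm_smul_sub_smul_le {c a b : ℝ} (hc : 0 ≤ c) (ha : 0 ≤ a) (hb : 0 ≤ b) (hac : a ≤ c)
    (hbc : b ≤ c) {x y : Plane} (h : |a * ‖x‖ - b * ‖y‖| ≤ c * |‖x‖ - ‖y‖|) :
    ‖a • x - b • y‖ ≤ c * ‖x - y‖ := by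
  refine le_of_sq_le_sq ?_ (by positivity)
  have h1 := real_inner_le_norm x y
  have h2 : (a * ‖x‖ - b * ‖y‖) ^ 2 ≤ c ^ 2 * (‖x‖ - ‖y‖) ^ 2 := by
    rw [← sq_abs, ← sq_abs (‖x‖ - ‖y‖), ← mul_pow]
    exact pow_le_pow_left₀ (abs_nonneg _) h 2
  have h3 : 0 ≤ c ^ 2 - a * b := by nlinarith
  rw [mul_pow, norm_sub_sq_real, norm_sub_sq_real, norm_smul, norm_smul, inner_smul_left,
    inner_smul_right, Real.norm_of_nonneg ha, Real.norm_of_nonneg hb]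
  simp only [conj_trivial]
  nlinarith [mul_le_mul_of_nonneg_left h1 h3]

lemma lipschitzWith_cauchyReg {ε : ℝ} (hε : 0 < ε) :
    LipschitzWith (Real.toNNReal (ε ^ 2)⁻¹) (cauchyReg ε) := by
  refine LipschitzWith.of_dist_le_mul fun x y => ?_
  rw [Real.coe_toNNReal _ (by positivity), dist_eq_norm, dist_eq_norm, cauchyReg, cauchyReg,
    ← map_sub, ← map_sub, RCLike.norm_conj, toC.norm_map]
  have hm : ∀ p, (max p ε ^ 2)⁻¹ ≤ (ε ^ 2)⁻¹ := fun p => by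
    have := le_max_right p ε
    gcongr
  refine norm_smul_sub_smul_le (by positivity) (by positivity) (by positivity) (hm _) (hm _) ?_
  rcases le_total ‖x‖ ‖y‖ with h | h
  · rw [abs_sub_comm ‖x‖, abs_of_nonneg (sub_nonneg.mpr h)]
    exact abs_div_max_sq_sub_le hε (norm_nonneg _) h
  · rw [abs_sub_comm, abs_of_nonneg (sub_nonneg.mpr h)]
    exact abs_div_max_sq_sub_le hε (norm_nonneg _) h

/-- The derivative of `cauchyReg ε`, off the circle of radius `ε`. -/
def cauchyRegDeriv (ε : ℝ) (e x : Plane) : ℂ :=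
  if ‖x‖ ≤ ε then ((ε ^ 2)⁻¹ : ℝ) * conj (toC e) else -(toC e) / toC x ^ 2

lemma hasLineDerivAt_cauchyReg {ε : ℝ} (hε : 0 < ε) (e : Plane) {x : Plane} (hx : ‖x‖ ≠ ε) :
    HasLineDerivAt ℝ (cauchyReg ε) (cauchyRegDeriv ε e x) x e := by
  have hT : HasFDerivAt toC (toC : Plane →L[ℝ] ℂ) x := (toC : Plane →L[ℝ] ℂ).hasFDerivAt
  rcases lt_or_gt_of_ne hx with h | h
  · rw [cauchyRegDeriv, if_pos h.le]
    let L : Plane →L[ℝ] ℂ := (((ε ^ 2)⁻¹ : ℝ) : ℂ) •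
      ((Complex.conjCLE : ℂ →L[ℝ] ℂ).comp (toC : Plane →L[ℝ] ℂ))
    have hL : HasFDerivAt L L x := L.hasFDerivAt
    have : HasFDerivAt (cauchyReg ε) L x := hL.congr_of_eventuallyEq <| by
      filter_upwards [(isOpen_lt continuous_norm continuous_const).mem_nhds h] with y hy
      exact cauchyReg_of_le (le_of_lt hy)
    exact this.hasLineDerivAt e
  · rw [cauchyRegDeriv, if_neg h.not_ge]
    have hx0 : toC x ≠ 0 := by
      rw [Ne, toC_eq_zero, ← norm_eq_zero]; exact (hε.trans h).ne'
    have h1 := (hasDerivAt_inv hx0).hasFDerivAt.restrictScalars ℝ |>.comp x hT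
    have h2 := (h1.congr_of_eventuallyEq (f₁ := cauchyReg ε) <| by
      filter_upwards [(isOpen_lt continuous_const continuous_norm).mem_nhds h] with y hy
      exact cauchyReg_of_ge (le_of_lt hy)).hasLineDerivAt e
    rw [show -(toC e) / toC x ^ 2 = (((ContinuousLinearMap.toSpanSingleton ℂ
      (-(toC x ^ 2)⁻¹)).restrictScalars ℝ).comp (toC : Plane →L[ℝ] ℂ)) e by simp [div_eq_mul_inv]]
    exact h2

lemma ae_norm_ne (r : ℝ) (hr : r ≠ 0) : ∀ᵐ x : Plane, ‖x‖ ≠ r := by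
  have := Measure.addHaar_sphere_of_ne_zero (volume : Measure Plane) 0 hr
  rw [← compl_mem_ae_iff] at this
  filter_upwards [this] with x hx h
  exact hx (by simpa using h)

/-- The integral of the derivative of a compactly supported Lipschitz function vanishes. -/
lemma integral_lineDeriv_eq_zero {h h' : Plane → ℂ} {C : ℝ≥0} (hL : LipschitzWith C h)
    (hs : HasCompactSupport h) {e : Plane} (hd : ∀ᵐ x, HasLineDerivAt ℝ h (h' x) x e)
    (hi : Integrable h') : ∫ x, h' x = 0 := by
  have key : ∀ {g : Plane → ℝ} {D : ℝ≥0}, LipschitzWith D g → HasCompactSupport g →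
      ∫ x, lineDeriv ℝ g x e = 0 := by
    intro g D hg hgs
    -- Integration by parts against the constant 1; the direction is `-e` because the formula
    -- reverses it.
    have := (LipschitzWith.const (1 : ℝ)).integral_lineDeriv_mul_eq (μ := volume) hg hgs (-e)
    simpa [lineDeriv] using this.symm
  have hre := key (Complex.reCLM.lipschitz.comp hL) (hs.comp_left (g := Complex.reCLM) (map_zero _))
  have him := key (Complex.imCLM.lipschitz.comp hL) (hs.comp_left (g := Complex.imCLM) (map_zero _))
  apply Complex.ext
  · rw [Complex.zero_re, ← hre, ← RCLike.re_eq_complex_re, ← integral_re hi]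
    refine integral_congr_ae ?_
    filter_upwards [hd] with x hx
    have hx' : HasDerivAt (fun t : ℝ => h (x + t • e)) (h' x) 0 := hx
    have h2 : HasLineDerivAt ℝ (Complex.reCLM ∘ h) (Complex.reCLM (h' x)) x e :=
      Complex.reCLM.hasFDerivAt.comp_hasDerivAt (0 : ℝ) hx'
    exact h2.lineDeriv.symm
  · rw [Complex.zero_im, ← him, ← RCLike.im_eq_complex_im, ← integral_im hi]
    refine integral_congr_ae ?_
    filter_upwards [hd] with x hx
    have hx' : HasDerivAt (fun t : ℝ => h (x + t • e)) (h' x) 0 := hx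
    have h2 : HasLineDerivAt ℝ (Complex.imCLM ∘ h) (Complex.imCLM (h' x)) x e :=
      Complex.imCLM.hasFDerivAt.comp_hasDerivAt (0 : ℝ) hx'
    exact h2.lineDeriv.symm
end DDA

end

/-! ### The L² identity between annulus and disc kernels. -/

noncomputable section
namespace DDA
open scoped ComplexConjugate NNReal Convolution ContDiff

/-- The kernel `z⁻²`, truncated to an annulus. -/
def annulusKer (ε R : ℝ) (x : Plane) : ℂ := if ε < ‖x‖ ∧ ‖x‖ ≤ R then (toC x ^ 2)⁻¹ else 0

/-- The indicator function of the disc of radius `r`, divided by `r²`. -/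
def discKer (r : ℝ) (x : Plane) : ℂ := if ‖x‖ ≤ r then (((r ^ 2)⁻¹ : ℝ) : ℂ) else 0

lemma integrable_of_bounded_of_support {k : Plane → ℂ} (hm : Measurable k) {C R : ℝ}
    (hb : ∀ x, ‖k x‖ ≤ C) (hs : ∀ x, R < ‖x‖ → k x = 0) : Integrable k := by
  rw [← integrableOn_iff_integrable_of_support_subset (s := Metric.closedBall 0 R)]
  · exact Measure.integrableOn_of_bounded (M := C) measure_closedBall_lt_top.ne
      hm.aestronglyMeasurable (Eventually.of_forall hb)
  · intro x hx
    by_contra h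
    exact hx (hs x (by simpa using h))

lemma measurable_toC : Measurable toC := toC.continuous.measurable

lemma integrable_annulusKer {ε : ℝ} (hε : 0 < ε) (R : ℝ) : Integrable (annulusKer ε R) := by
  refine integrable_of_bounded_of_support (C := (ε ^ 2)⁻¹) (R := R) ?_ (fun x => ?_) fun x hx => ?_
  · exact Measurable.ite ((measurableSet_lt measurable_const measurable_norm).inter
      (measurableSet_le measurable_norm measurable_const)) (measurable_toC.pow_const 2).inv
      measurable_const
  · rw [annulusKer]
    split_ifs with h
    · rw [norm_inv, norm_pow, toC.norm_map]
      have := h.1.le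
      gcongr
    · simpa using sq_nonneg ε
  · rw [annulusKer, if_neg fun h => not_lt.mpr h.2 hx]

lemma integrable_discKer (r : ℝ) : Integrable (discKer r) := by
  refine integrable_of_bounded_of_support (C := (r ^ 2)⁻¹) (R := r) ?_ (fun x => ?_) fun x hx => ?_
  · exact Measurable.ite (measurableSet_le measurable_norm measurable_const) measurable_const
      measurable_const
  · rw [discKer]
    split_ifs with h
    · rw [Complex.norm_real, Real.norm_of_nonneg (by positivity)]
    · simpa using sq_nonneg r
  · rw [discKer, if_neg (not_le.mpr hx)]

/-- The operator ∂₁ - i∂₂ = 2∂ kills the conjugate of z and sends 1/z to -2z⁻²; beyond radius `R`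
the two kernels coincide. -/
lemma cauchyRegDeriv_sub_wirtinger {ε R : ℝ} (h : ε < R) (x : Plane) :
    (cauchyRegDeriv ε e₁ x - cauchyRegDeriv R e₁ x) -
      Complex.I * (cauchyRegDeriv ε e₂ x - cauchyRegDeriv R e₂ x) = -2 * annulusKer ε R x := by
  simp only [cauchyRegDeriv, annulusKer, toC_e₁, toC_e₂, map_one, Complex.conj_I]
  rcases le_or_gt ‖x‖ ε with h1 | h1
  · simp only [h1, h1.trans h.le, not_lt.mpr h1, false_and, if_true, if_false]
    linear_combination ((((ε ^ 2)⁻¹ : ℝ) : ℂ) - (((R ^ 2)⁻¹ : ℝ) : ℂ)) * Complex.I_sq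
  rcases le_or_gt ‖x‖ R with h2 | h2
  · simp only [h1, h1.not_ge, h2, and_self, if_true, if_false]
    rw [div_eq_mul_inv, div_eq_mul_inv]
    linear_combination ((toC x ^ 2)⁻¹ - (((R ^ 2)⁻¹ : ℝ) : ℂ)) * Complex.I_sq
  · simp only [h1.not_ge, h2.not_ge, and_false, if_false]
    ring

/-- The operator ∂₁ + i∂₂ = 2∂̄ kills 1/z and sends the conjugate of z to 2. -/
lemma cauchyRegDeriv_add_wirtinger (r : ℝ) (x : Plane) :
    cauchyRegDeriv r e₁ x + Complex.I * cauchyRegDeriv r e₂ x = 2 * discKer r x := by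
  simp only [cauchyRegDeriv, discKer, toC_e₁, toC_e₂, map_one, Complex.conj_I]
  split_ifs
  · linear_combination -(((r ^ 2)⁻¹ : ℝ) : ℂ) * Complex.I_sq
  · rw [div_eq_mul_inv, div_eq_mul_inv]
    linear_combination -(toC x ^ 2)⁻¹ * Complex.I_sq

/-- A compactly supported Lipschitz kernel whose Wirtinger derivatives are `annulusKer` and
`discKer`. -/
def cauchyDiff (ε R : ℝ) (x : Plane) : ℂ := cauchyReg ε x - cauchyReg R x

lemma cauchyDiff_eq_zero {ε R : ℝ} (h : ε < R) {x : Plane} (hx : R ≤ ‖x‖) :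
    cauchyDiff ε R x = 0 := by
  rw [cauchyDiff, cauchyReg_of_ge hx, cauchyReg_of_ge (h.le.trans hx), sub_self]

lemma hasCompactSupport_of_norm {E : Type*} [Zero E] {k : Plane → E} {R : ℝ}
    (h : ∀ x, R < ‖x‖ → k x = 0) : HasCompactSupport k :=
  HasCompactSupport.intro (isCompact_closedBall 0 R) fun x hx => h x (by simpa using hx)

lemma hasCompactSupport_cauchyDiff {ε R : ℝ} (h : ε < R) : HasCompactSupport (cauchyDiff ε R) :=
  hasCompactSupport_of_norm fun _ hx => cauchyDiff_eq_zero h hx.le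

lemma lipschitzWith_cauchyDiff {ε R : ℝ} (hε : 0 < ε) (h : ε < R) :
    LipschitzWith (Real.toNNReal (ε ^ 2)⁻¹ + Real.toNNReal (R ^ 2)⁻¹) (cauchyDiff ε R) :=
  (lipschitzWith_cauchyReg hε).sub (lipschitzWith_cauchyReg (hε.trans h))

lemma measurable_cauchyRegDeriv (r : ℝ) (e : Plane) : Measurable (cauchyRegDeriv r e) :=
  Measurable.ite (measurableSet_le measurable_norm measurable_const) measurable_const
    (measurable_const.div (measurable_toC.pow_const 2))

lemma norm_cauchyRegDeriv_le {r : ℝ} (hr : 0 < r) (e x : Plane) :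
    ‖cauchyRegDeriv r e x‖ ≤ (r ^ 2)⁻¹ * ‖e‖ := by
  rw [cauchyRegDeriv]
  split_ifs with h
  · rw [norm_mul, RCLike.norm_conj, toC.norm_map, Complex.norm_real,
      Real.norm_of_nonneg (by positivity)]
  · rw [norm_div, norm_neg, norm_pow, toC.norm_map, toC.norm_map, div_eq_inv_mul]
    have := (not_le.mp h).le
    gcongr

lemma integrable_cauchyRegDeriv_sub {ε R : ℝ} (hε : 0 < ε) (h : ε < R) (e : Plane) :
    Integrable fun x => cauchyRegDeriv ε e x - cauchyRegDeriv R e x := by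
  refine integrable_of_bounded_of_support (R := R)
    ((measurable_cauchyRegDeriv ε e).sub (measurable_cauchyRegDeriv R e))
    (fun x => (norm_sub_le _ _).trans (add_le_add (norm_cauchyRegDeriv_le hε e x)
      (norm_cauchyRegDeriv_le (hε.trans h) e x))) fun x hx => ?_
  rw [cauchyRegDeriv, cauchyRegDeriv, if_neg hx.not_ge, if_neg (h.trans hx).not_ge, sub_self]

/-- Convolution of complex functions on the plane. -/
def conv (k f : Plane → ℂ) : Plane → ℂ := k ⋆[ContinuousLinearMap.mul ℝ ℂ, volume] f

lemma conv_apply (k f : Plane → ℂ) (x : Plane) : conv k f x = ∫ t, k t * f (x - t) := rfl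

lemma exists_lipschitz_mul {k g : Plane → ℂ} {C D : ℝ≥0} (hk : LipschitzWith C k)
    (hks : HasCompactSupport k) (hg : LipschitzWith D g) (hgs : HasCompactSupport g) :
    ∃ L : ℝ≥0, LipschitzWith L fun x => k x * g x := by
  obtain ⟨A, hA⟩ := hk.continuous.bounded_above_of_compact_support hks
  obtain ⟨B, hB⟩ := hg.continuous.bounded_above_of_compact_support hgs
  refine ⟨Real.toNNReal (A * D + B * C), LipschitzWith.of_dist_le_mul fun x y => ?_⟩
  have hA0 : 0 ≤ A := (norm_nonneg _).trans (hA 0)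
  have hB0 : 0 ≤ B := (norm_nonneg _).trans (hB 0)
  rw [Real.coe_toNNReal _ (by positivity), dist_eq_norm,
    show k x * g x - k y * g y = k x * (g x - g y) + g y * (k x - k y) by ring]
  refine (norm_add_le _ _).trans ?_
  rw [norm_mul, norm_mul, ← dist_eq_norm, ← dist_eq_norm, add_mul, mul_assoc, mul_assoc]
  have h1 := hg.dist_le_mul x y
  have h2 := hk.dist_le_mul x y
  gcongr
  exacts [hA x, hB y]

/-- The derivative first falls on the smooth factor `f`; integration by parts moves it to the
kernel, which is Lipschitz with compact support and differentiable off two circles. -/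
lemma fderiv_conv_cauchyDiff {ε R : ℝ} (hε : 0 < ε) (h : ε < R) {f : Plane → ℂ}
    (hf : ContDiff ℝ ∞ f) (hfs : HasCompactSupport f) (e x : Plane) :
    fderiv ℝ (conv (cauchyDiff ε R) f) x e =
      conv (fun t => cauchyRegDeriv ε e t - cauchyRegDeriv R e t) f x := by
  have hc := (lipschitzWith_cauchyDiff hε h).continuous
  have h1 := (hfs.hasFDerivAt_convolution_right (ContinuousLinearMap.mul ℝ ℂ)
    (hc.locallyIntegrable (μ := volume)) (hf.of_le (by simp)) x).fderiv
  have hf's := hfs.fderiv (𝕜 := ℝ)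
  have hf'c : Continuous (fderiv ℝ f) := hf.continuous_fderiv (by simp)
  have hgc : ∀ x, HasCompactSupport fun t => f (x - t) := fun x =>
    hfs.comp_homeomorph (Homeomorph.subLeft x)
  have hg'c : HasCompactSupport fun t => fderiv ℝ f (x - t) :=
    hf's.comp_homeomorph (Homeomorph.subLeft x)
  obtain ⟨D, hD⟩ := hf.lipschitzWith_of_hasCompactSupport hfs (by simp)
  have hfl : LipschitzWith D fun t => f (x - t) := by
    refine LipschitzWith.of_dist_le_mul fun a b => ?_
    rw [← dist_sub_left x a b]
    exact hD.dist_le_mul _ _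
  have i2 : Integrable fun t => cauchyDiff ε R t * fderiv ℝ f (x - t) e := by
    refine Continuous.integrable_of_hasCompactSupport ?_
      ((hasCompactSupport_cauchyDiff h).mul_right)
    fun_prop
  have i1 : Integrable fun t => (cauchyRegDeriv ε e t - cauchyRegDeriv R e t) * f (x - t) := by
    obtain ⟨B, hB⟩ := hf.continuous.bounded_above_of_compact_support hfs
    refine (integrable_cauchyRegDeriv_sub hε h e).mul_bdd (c := B) ?_ ?_
    · exact (hf.continuous.comp (continuous_sub_left x)).aestronglyMeasurable
    · exact Eventually.of_forall fun t => hB _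
  have e1 : fderiv ℝ (conv (cauchyDiff ε R) f) x e =
      ∫ t, cauchyDiff ε R t * fderiv ℝ f (x - t) e := by
    rw [conv, h1, convolution, ContinuousLinearMap.integral_apply]
    · rfl
    · exact (hf's.convolutionExists_right _ (hc.locallyIntegrable (μ := volume)) hf'c x).integrable
  obtain ⟨L, hL⟩ := exists_lipschitz_mul (lipschitzWith_cauchyDiff hε h)
    (hasCompactSupport_cauchyDiff h) hfl (hgc x)
  have h0 := integral_lineDeriv_eq_zero (e := e) (h' := fun t =>
    (cauchyRegDeriv ε e t - cauchyRegDeriv R e t) * f (x - t) -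
      cauchyDiff ε R t * fderiv ℝ f (x - t) e) hL ((hasCompactSupport_cauchyDiff h).mul_right) ?_
    (i1.sub i2)
  · rw [integral_sub i1 i2, sub_eq_zero] at h0
    rw [e1, ← h0, conv_apply]
  · filter_upwards [ae_norm_ne ε hε.ne', ae_norm_ne R (hε.trans h).ne'] with t ht1 ht2
    have d1 := (hasLineDerivAt_cauchyReg hε e ht1)
    have d2 := (hasLineDerivAt_cauchyReg (hε.trans h) e ht2)
    have d3 : HasLineDerivAt ℝ (fun t => f (x - t)) (-(fderiv ℝ f (x - t) e)) t e := by
      have := ((hf.differentiable (by simp) (x - t)).hasFDerivAt.comp t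
        ((hasFDerivAt_id t).const_sub x)).hasLineDerivAt e
      simpa only [ContinuousLinearMap.comp_apply, neg_apply, map_neg] using! this
    have d4 := HasDerivAt.mul (HasDerivAt.sub d1 d2) d3
    rw [HasLineDerivAt]
    refine d4.congr_deriv ?_
    simp [cauchyDiff]
    ring

/-- Integrated by parts, both sides are minus the integral of `q` times a mixed second derivative of
`p`, and such derivatives commute. -/
lemma integral_jacobian {p q : Plane → ℝ} (hp : ContDiff ℝ 2 p) (hps : HasCompactSupport p)
    (hq : ContDiff ℝ 2 q) (a b : Plane) :
    ∫ x, fderiv ℝ p x a * fderiv ℝ q x b = ∫ x, fderiv ℝ p x b * fderiv ℝ q x a := by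
  have hd : ∀ e, ContDiff ℝ 1 fun x => fderiv ℝ p x e := fun e =>
    (hp.fderiv_right (m := 1) (by norm_num)).clm_apply contDiff_const
  have hs : ∀ e, HasCompactSupport fun x => fderiv ℝ p x e := fun e => hps.fderiv_apply ℝ e
  have hs2 : ∀ e e', HasCompactSupport fun x => fderiv ℝ (fun x => fderiv ℝ p x e) x e' :=
    fun e e' => (hs e).fderiv_apply ℝ e'
  have hc2 : ∀ e, Continuous (fderiv ℝ fun x => fderiv ℝ p x e) := fun e =>
    (hd e).continuous_fderiv (by simp)
  have hqc : Continuous (fderiv ℝ q) := hq.continuous_fderiv (by simp)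
  have hqc0 := hq.continuous
  have key : ∀ e e', ∫ x, fderiv ℝ p x e * fderiv ℝ q x e' =
      -∫ x, fderiv ℝ (fun x => fderiv ℝ p x e) x e' * q x := by
    intro e e'
    have hc1 := (hd e).continuous
    have hc2e := hc2 e
    refine integral_mul_fderiv_eq_neg_fderiv_mul_of_integrable ?_ ?_ ?_ ?_ ?_
    · exact Continuous.integrable_of_hasCompactSupport (by fun_prop) (hs2 e e').mul_right
    · exact Continuous.integrable_of_hasCompactSupport (by fun_prop) (hs e).mul_right
    · exact Continuous.integrable_of_hasCompactSupport (by fun_prop) (hs e).mul_right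
    · exact fun x _ => (hd e).differentiable (by simp) x
    · exact fun x _ => hq.differentiable (by simp) x
  rw [key, key]
  congr 2; ext x
  have h1 : DifferentiableAt ℝ (fderiv ℝ p) x :=
    (hp.fderiv_right (m := 1) (by norm_num)).differentiable (by simp) x
  have h2 : IsSymmSndFDerivAt ℝ p x := hp.contDiffAt.isSymmSndFDerivAt (by simp)
  have h3 : ∀ e e', fderiv ℝ (fun x => fderiv ℝ p x e) x e' = fderiv ℝ (fderiv ℝ p) x e' e :=
    fun e e' => by
      rw [fderiv_clm_apply h1 (differentiableAt_const e)]; simp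
  rw [h3, h3, h2.eq]

/-- The integrands differ by four times the Jacobian determinant of `v`, whose integral vanishes by
`integral_jacobian`. -/
lemma integral_wirtinger {v : Plane → ℂ} (hv : ContDiff ℝ 2 v) (hs : HasCompactSupport v) :
    ∫ x, ‖fderiv ℝ v x e₁ - Complex.I * fderiv ℝ v x e₂‖ ^ 2 =
      ∫ x, ‖fderiv ℝ v x e₁ + Complex.I * fderiv ℝ v x e₂‖ ^ 2 := by
  have hre : ∀ x e, fderiv ℝ (fun x => (v x).re) x e = (fderiv ℝ v x e).re := fun x e => by
    have h : HasFDerivAt (fun x => (v x).re) (Complex.reCLM.comp (fderiv ℝ v x)) x :=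
      Complex.reCLM.hasFDerivAt.comp x (hv.differentiable (by simp) x).hasFDerivAt
    rw [h.fderiv]
    rfl
  have him : ∀ x e, fderiv ℝ (fun x => (v x).im) x e = (fderiv ℝ v x e).im := fun x e => by
    have h : HasFDerivAt (fun x => (v x).im) (Complex.imCLM.comp (fderiv ℝ v x)) x :=
      Complex.imCLM.hasFDerivAt.comp x (hv.differentiable (by simp) x).hasFDerivAt
    rw [h.fderiv]
    rfl
  have hj := integral_jacobian (p := fun x => (v x).re) (q := fun x => (v x).im)
    (Complex.reCLM.contDiff.comp hv) (hs.comp_left Complex.zero_re)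
    (Complex.imCLM.contDiff.comp hv) e₁ e₂
  simp only [hre, him] at hj
  have hc : Continuous (fderiv ℝ v) := hv.continuous_fderiv (by simp)
  have hd : ∀ e, HasCompactSupport fun x => fderiv ℝ v x e := fun e => hs.fderiv_apply ℝ e
  have hr : ∀ e, Continuous fun x => (fderiv ℝ v x e).re := fun e =>
    Complex.continuous_re.comp (by fun_prop)
  have hi : ∀ e, Continuous fun x => (fderiv ℝ v x e).im := fun e =>
    Complex.continuous_im.comp (by fun_prop)
  have i1 : ∀ a b, Integrable fun x => (fderiv ℝ v x a).re * (fderiv ℝ v x b).im := fun a b =>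
    ((hr a).mul (hi b)).integrable_of_hasCompactSupport
      (((hd a).comp_left (g := Complex.re) Complex.zero_re).mul_right)
  have i2 : Integrable fun x => ‖fderiv ℝ v x e₁ + Complex.I * fderiv ℝ v x e₂‖ ^ 2 := by
    refine Continuous.integrable_of_hasCompactSupport (by fun_prop) ?_
    exact ((hd e₁).add ((hd e₂).mul_left (f := fun _ => Complex.I))).comp_left
      (g := fun z : ℂ => ‖z‖ ^ 2) (by simp)
  have e : ∀ x, ‖fderiv ℝ v x e₁ - Complex.I * fderiv ℝ v x e₂‖ ^ 2 =
      ‖fderiv ℝ v x e₁ + Complex.I * fderiv ℝ v x e₂‖ ^ 2 +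
        4 * ((fderiv ℝ v x e₁).re * (fderiv ℝ v x e₂).im -
          (fderiv ℝ v x e₂).re * (fderiv ℝ v x e₁).im) := fun x => by
    rw [Complex.sq_norm, Complex.sq_norm, Complex.normSq_apply, Complex.normSq_apply]
    simp
    ring
  have i3 : Integrable fun x => 4 * ((fderiv ℝ v x e₁).re * (fderiv ℝ v x e₂).im -
      (fderiv ℝ v x e₂).re * (fderiv ℝ v x e₁).im) := ((i1 _ _).sub (i1 _ _)).const_mul 4
  simp only [e]
  rw [integral_add i2 i3, integral_const_mul, integral_sub (i1 _ _) (i1 _ _), hj, sub_self, mul_zero, add_zero]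

lemma conv_const_mul (c : ℂ) (k f : Plane → ℂ) (x : Plane) :
    conv (fun t => c * k t) f x = c * conv k f x := by
  simp only [conv_apply, mul_assoc, integral_const_mul]

lemma integrable_mul_translate {k f : Plane → ℂ} (hk : Integrable k) (hf : Continuous f)
    (hfs : HasCompactSupport f) (x : Plane) : Integrable fun t => k t * f (x - t) := by
  obtain ⟨B, hB⟩ := hf.bounded_above_of_compact_support hfs
  refine hk.mul_bdd (c := B) ?_ ?_
  · exact (hf.comp (continuous_sub_left x)).aestronglyMeasurable
  · exact Eventually.of_forall fun t => hB _

lemma conv_sub {k l f : Plane → ℂ} (hk : Integrable k) (hl : Integrable l) (hf : Continuous f)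
    (hfs : HasCompactSupport f) (x : Plane) :
    conv (fun t => k t - l t) f x = conv k f x - conv l f x := by
  simp only [conv_apply, sub_mul]
  exact integral_sub (integrable_mul_translate hk hf hfs x) (integrable_mul_translate hl hf hfs x)

lemma conv_add {k l f : Plane → ℂ} (hk : Integrable k) (hl : Integrable l) (hf : Continuous f)
    (hfs : HasCompactSupport f) (x : Plane) :
    conv (fun t => k t + l t) f x = conv k f x + conv l f x := by
  simp only [conv_apply, add_mul]
  exact integral_add (integrable_mul_translate hk hf hfs x) (integrable_mul_translate hl hf hfs x)

/-- Convolution with `annulusKer` is as large as convolution with the difference of two disc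
averages. -/
lemma integral_norm_sq_conv_annulusKer {ε R : ℝ} (hε : 0 < ε) (h : ε < R) {f : Plane → ℂ}
    (hf : ContDiff ℝ ∞ f) (hfs : HasCompactSupport f) :
    ∫ x, ‖conv (annulusKer ε R) f x‖ ^ 2 =
      ∫ x, ‖conv (discKer ε) f x - conv (discKer R) f x‖ ^ 2 := by
  have hc := (lipschitzWith_cauchyDiff hε h).continuous
  have hv : ContDiff ℝ 2 (conv (cauchyDiff ε R) f) :=
    (hfs.contDiff_convolution_right _ (hc.locallyIntegrable (μ := volume)) hf).of_le
      (WithTop.coe_le_coe.mpr (le_top (a := (2 : ℕ∞))))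
  have hvs : HasCompactSupport (conv (cauchyDiff ε R) f) :=
    (hasCompactSupport_cauchyDiff h).convolution _ hfs
  -- Up to the factors -2 and 2, both convolutions are Wirtinger derivatives of the same function
  -- `conv (cauchyDiff ε R) f`.
  have hw := integral_wirtinger hv hvs
  have hi := integrable_cauchyRegDeriv_sub hε h
  have e1 : ∀ x, fderiv ℝ (conv (cauchyDiff ε R) f) x e₁ -
      Complex.I * fderiv ℝ (conv (cauchyDiff ε R) f) x e₂ = -2 * conv (annulusKer ε R) f x := by
    intro x
    rw [fderiv_conv_cauchyDiff hε h hf hfs, fderiv_conv_cauchyDiff hε h hf hfs, ← conv_const_mul,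
      ← conv_const_mul, ← conv_sub (hi _) ((hi _).const_mul _) hf.continuous hfs]
    simp only [cauchyRegDeriv_sub_wirtinger h]
  have e2 : ∀ x, fderiv ℝ (conv (cauchyDiff ε R) f) x e₁ +
      Complex.I * fderiv ℝ (conv (cauchyDiff ε R) f) x e₂ =
        2 * (conv (discKer ε) f x - conv (discKer R) f x) := by
    intro x
    rw [fderiv_conv_cauchyDiff hε h hf hfs, fderiv_conv_cauchyDiff hε h hf hfs, ← conv_const_mul,
      ← conv_add (hi _) ((hi _).const_mul _) hf.continuous hfs,
      ← conv_sub (integrable_discKer _) (integrable_discKer _) hf.continuous hfs, ← conv_const_mul]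
    congr 1; ext t
    linear_combination cauchyRegDeriv_add_wirtinger ε t - cauchyRegDeriv_add_wirtinger R t
  simp only [e1, e2, norm_mul, mul_pow, norm_neg] at hw
  rw [integral_const_mul, integral_const_mul] at hw
  exact mul_left_cancel₀ (by norm_num) hw
end DDA

end

/-! ### L² bounds for convolution with the disc and annulus kernels. -/

noncomputable section
namespace DDA
open scoped ComplexConjugate NNReal Convolution ContDiff

lemma eLpNorm_two_eq {g : Plane → ℂ} (hg : MemLp g 2) :
    eLpNorm g 2 = ENNReal.ofReal (Real.sqrt (∫ x, ‖g x‖ ^ 2)) := by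
  rw [hg.eLpNorm_eq_integral_rpow_norm (by norm_num) (by norm_num), Real.sqrt_eq_rpow]
  norm_num

lemma eLpNorm_two_le {g : Plane → ℂ} (hg : MemLp g 2) {c : ℝ} (hc : 0 ≤ c)
    (h : ∫ x, ‖g x‖ ^ 2 ≤ c ^ 2) : eLpNorm g 2 ≤ ENNReal.ofReal c := by
  rw [eLpNorm_two_eq hg]
  exact ENNReal.ofReal_le_ofReal (Real.sqrt_le_iff.mpr ⟨hc, h⟩)

lemma annulusKer_eq_zero {ε R : ℝ} {x : Plane} (hx : R < ‖x‖) : annulusKer ε R x = 0 :=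
  if_neg fun h => not_lt.mpr h.2 hx

lemma discKer_eq_zero {r : ℝ} {x : Plane} (hx : r < ‖x‖) : discKer r x = 0 :=
  if_neg (not_le.mpr hx)

lemma continuous_conv {k f : Plane → ℂ} (hk : Integrable k) (hf : Continuous f)
    (hfs : HasCompactSupport f) : Continuous (conv k f) :=
  hfs.continuous_convolution_right _ hk.locallyIntegrable hf

lemma memLp_conv {k f : Plane → ℂ} (hk : Integrable k) (hks : HasCompactSupport k)
    (hf : Continuous f) (hfs : HasCompactSupport f) : MemLp (conv k f) 2 :=
  (continuous_conv hk hf hfs).memLp_of_hasCompactSupport (hks.convolution _ hfs)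

lemma hasCompactSupport_discKer (r : ℝ) : HasCompactSupport (discKer r) :=
  hasCompactSupport_of_norm fun _ => discKer_eq_zero

lemma hasCompactSupport_annulusKer (ε R : ℝ) : HasCompactSupport (annulusKer ε R) :=
  hasCompactSupport_of_norm fun _ => annulusKer_eq_zero

open Classical in
lemma integral_norm_discKer {r : ℝ} (hr : 0 < r) : ∫ x, ‖discKer r x‖ = Real.pi := by
  have e : (fun x => ‖discKer r x‖) = (Metric.closedBall 0 r).indicator fun _ => (r ^ 2)⁻¹ := by
    ext x
    rw [discKer, Set.indicator_apply]
    simp only [mem_closedBall_zero_iff]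
    split_ifs
    · rw [Complex.norm_real, Real.norm_of_nonneg (by positivity)]
    · simp
  rw [e, integral_indicator measurableSet_closedBall, setIntegral_const, smul_eq_mul, Measure.real,
    EuclideanSpace.volume_closedBall_fin_two, ENNReal.toReal_mul, ENNReal.toReal_pow,
    ENNReal.toReal_ofReal hr.le]
  rw [ENNReal.toReal_ofReal Real.pi_pos.le]
  field_simp

lemma integral_discKer {r : ℝ} (hr : 0 < r) : ∫ x, discKer r x = Real.pi := by
  rw [← integral_norm_discKer hr, ← integral_complex_ofReal]
  congr 1; ext x
  rw [discKer]
  split_ifs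
  · rw [Complex.norm_real, Real.norm_of_nonneg (by positivity)]
  · simp

lemma norm_conv_le (k f : Plane → ℂ) (x : Plane) : ‖conv k f x‖ ≤ ∫ t, ‖k t‖ * ‖f (x - t)‖ := by
  rw [conv_apply]
  refine (norm_integral_le_integral_norm _).trans (le_of_eq ?_)
  simp only [norm_mul]

lemma integral_integral_mul_translate {k g : Plane → ℝ} (hk : Integrable k) (hg : Integrable g) :
    ∫ x, ∫ t, k t * g (x - t) = (∫ t, k t) * ∫ t, g t :=
  integral_convolution (μ := volume) (ν := volume) (ContinuousLinearMap.mul ℝ ℝ) hk hg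

lemma integrable_integral_mul_translate {k g : Plane → ℝ} (hk : Integrable k) (hg : Integrable g) :
    Integrable fun x => ∫ t, k t * g (x - t) :=
  Integrable.integrable_convolution (μ := volume) (ContinuousLinearMap.mul ℝ ℝ) hk hg

lemma integrable_norm_mul_translate {k : Plane → ℂ} {g : Plane → ℝ} (hk : Integrable k)
    (hg : Continuous g) (hgs : HasCompactSupport g) (x : Plane) :
    Integrable fun t => ‖k t‖ * g (x - t) := by
  obtain ⟨B, hB⟩ := hg.bounded_above_of_compact_support hgs
  refine hk.norm.mul_bdd (c := B) ?_ ?_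
  · exact (hg.comp (continuous_sub_left x)).aestronglyMeasurable
  · exact Eventually.of_forall fun t => hB _

lemma integral_norm_conv_le {k f : Plane → ℂ} (hk : Integrable k) (hks : HasCompactSupport k)
    (hf : Continuous f) (hfs : HasCompactSupport f) :
    ∫ x, ‖conv k f x‖ ≤ (∫ x, ‖k x‖) * ∫ x, ‖f x‖ := by
  have hfi : Integrable fun x => ‖f x‖ := (hf.integrable_of_hasCompactSupport hfs).norm
  rw [← integral_integral_mul_translate hk.norm hfi]
  exact integral_mono ((continuous_conv hk hf hfs).integrable_of_hasCompactSupport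
    (hks.convolution _ hfs)).norm (integrable_integral_mul_translate hk.norm hfi)
    (norm_conv_le k f)

/-- Young's inequality for convolution with an integrable kernel in `L²`. -/
lemma integral_norm_sq_conv_le {k f : Plane → ℂ} (hk : Integrable k) (hks : HasCompactSupport k)
    (hk0 : 0 < ∫ x, ‖k x‖) (hf : Continuous f) (hfs : HasCompactSupport f) :
    ∫ x, ‖conv k f x‖ ^ 2 ≤ (∫ x, ‖k x‖) ^ 2 * ∫ x, ‖f x‖ ^ 2 := by
  set K := ∫ x, ‖k x‖
  have h2s : HasCompactSupport fun x => ‖f x‖ ^ 2 := hfs.comp_left (g := fun z : ℂ => ‖z‖ ^ 2) (by simp)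
  have h2 : Integrable fun x => ‖f x‖ ^ 2 :=
    Continuous.integrable_of_hasCompactSupport (by fun_prop) h2s
  have hpt : ∀ x, ‖conv k f x‖ ^ 2 ≤ K * ∫ t, ‖k t‖ * ‖f (x - t)‖ ^ 2 := by
    intro x
    set a := ‖conv k f x‖
    have i1 := integrable_norm_mul_translate hk hf.norm hfs.norm x
    have i2 := integrable_norm_mul_translate hk (g := fun x => ‖f x‖ ^ 2) (by fun_prop) h2s x
    -- The inequality 2uv ≤ u² + v² with u = a/K, integrated against ‖k‖, takes the place of
    -- Cauchy-Schwarz.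
    have h3 : ∫ t, (2 * (a / K)) * (‖k t‖ * ‖f (x - t)‖) ≤
        ∫ t, ((a / K) ^ 2 * ‖k t‖ + ‖k t‖ * ‖f (x - t)‖ ^ 2) := by
      refine integral_mono (i1.const_mul _) ((hk.norm.const_mul _).add i2) fun t => ?_
      have := mul_nonneg (norm_nonneg (k t)) (sq_nonneg (a / K - ‖f (x - t)‖))
      simp only
      nlinarith
    rw [integral_const_mul, integral_add (hk.norm.const_mul _) i2, integral_const_mul] at h3
    have h4 : 2 * (a / K) * a ≤ 2 * (a / K) * ∫ t, ‖k t‖ * ‖f (x - t)‖ :=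
      mul_le_mul_of_nonneg_left (norm_conv_le k f x) (by positivity)
    have h5 : 2 * (a / K) * a ≤ (a / K) ^ 2 * K + ∫ t, ‖k t‖ * ‖f (x - t)‖ ^ 2 := h4.trans h3
    have h6 : (a / K) ^ 2 * K = a ^ 2 / K := by field_simp
    have h7 : 2 * (a / K) * a = 2 * (a ^ 2 / K) := by ring
    have h8 : a ^ 2 / K ≤ ∫ t, ‖k t‖ * ‖f (x - t)‖ ^ 2 := by linarith
    rwa [div_le_iff₀' hk0] at h8
  calc ∫ x, ‖conv k f x‖ ^ 2 ≤ ∫ x, K * ∫ t, ‖k t‖ * ‖f (x - t)‖ ^ 2 :=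
        integral_mono ((memLp_conv hk hks hf hfs).integrable_norm_pow (by norm_num))
          ((integrable_integral_mul_translate hk.norm h2).const_mul K) hpt
    _ = K ^ 2 * ∫ x, ‖f x‖ ^ 2 := by
        rw [integral_const_mul, integral_integral_mul_translate hk.norm h2]; ring

lemma eLpNorm_conv_discKer_le {r : ℝ} (hr : 0 < r) {f : Plane → ℂ} (hf : Continuous f)
    (hfs : HasCompactSupport f) :
    eLpNorm (conv (discKer r) f) 2 ≤ ENNReal.ofReal Real.pi * eLpNorm f 2 := by
  rw [eLpNorm_two_eq (hf.memLp_of_hasCompactSupport hfs), ← ENNReal.ofReal_mul Real.pi_pos.le]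
  have hpi := Real.pi_pos
  refine eLpNorm_two_le (memLp_conv (integrable_discKer r) (hasCompactSupport_discKer r) hf hfs)
    (by positivity) ?_
  have h := integral_norm_sq_conv_le (integrable_discKer r) (hasCompactSupport_discKer r)
    (by rw [integral_norm_discKer hr]; exact hpi) hf hfs
  rw [mul_pow, Real.sq_sqrt (integral_nonneg fun x => by positivity)]
  rwa [integral_norm_discKer hr] at h

/-- The squared L² norm is at most the sup norm, of order R⁻², times the L¹ norm, which stays
bounded. -/
lemma exists_eLpNorm_conv_discKer_le_div {f : Plane → ℂ} (hf : Continuous f)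
    (hfs : HasCompactSupport f) :
    ∃ c, ∀ R, 0 < R → eLpNorm (conv (discKer R) f) 2 ≤ ENNReal.ofReal (c / R) := by
  have hpi := Real.pi_pos
  set I := ∫ x, ‖f x‖ with hI'
  have hI : 0 ≤ I := integral_nonneg fun x => norm_nonneg _
  have hfi := hf.integrable_of_hasCompactSupport hfs (μ := volume)
  refine ⟨2 * I, fun R hR => ?_⟩
  have hm := memLp_conv (integrable_discKer R) (hasCompactSupport_discKer R) hf hfs
  refine eLpNorm_two_le hm (by positivity) ?_
  have h1 : ∀ x, ‖conv (discKer R) f x‖ ≤ (R ^ 2)⁻¹ * I := by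
    intro x
    refine (norm_conv_le _ _ x).trans ?_
    rw [hI', ← integral_sub_left_eq_self (fun t => ‖f t‖) volume x, ← integral_const_mul]
    refine integral_mono (integrable_norm_mul_translate (integrable_discKer R) hf.norm hfs.norm x)
      ((hfi.norm.comp_sub_left x).const_mul _) fun t => ?_
    refine mul_le_mul_of_nonneg_right ?_ (norm_nonneg _)
    rw [discKer]
    split_ifs
    · rw [Complex.norm_real, Real.norm_of_nonneg (by positivity)]
    · simpa using sq_nonneg R
  have h2 := integral_norm_conv_le (integrable_discKer R) (hasCompactSupport_discKer R) hf hfs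
  rw [integral_norm_discKer hR] at h2
  have h3 : ∫ x, ‖conv (discKer R) f x‖ ^ 2 ≤ ∫ x, (R ^ 2)⁻¹ * I * ‖conv (discKer R) f x‖ := by
    refine integral_mono (hm.integrable_norm_pow (by norm_num))
      (((continuous_conv (integrable_discKer R) hf hfs).integrable_of_hasCompactSupport
      ((hasCompactSupport_discKer R).convolution _ hfs)).norm.const_mul _) fun x => ?_
    simp only
    rw [sq]
    exact mul_le_mul_of_nonneg_right (h1 x) (norm_nonneg _)
  rw [integral_const_mul] at h3
  refine h3.trans ((mul_le_mul_of_nonneg_left h2 (by positivity)).trans ?_)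
  have h4 := Real.pi_lt_four
  have : (R ^ 2)⁻¹ * I * (Real.pi * I) = Real.pi * (I / R) ^ 2 := by field_simp
  rw [this, mul_div_assoc, mul_pow]
  nlinarith [sq_nonneg (I / R)]

/-- `discKer r` has mass π and support of radius `r`, so for Lipschitz `f` the error is O(r)
pointwise, and for r ≤ 1 it lives in a fixed ball. -/
lemma exists_eLpNorm_conv_discKer_sub_le {f : Plane → ℂ} (hf : ContDiff ℝ ∞ f)
    (hfs : HasCompactSupport f) :
    ∃ c, 0 ≤ c ∧ ∀ r, 0 < r → r ≤ 1 →
      eLpNorm (fun x => conv (discKer r) f x - Real.pi * f x) 2 ≤ ENNReal.ofReal (c * r) := by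
  have hpi := Real.pi_pos
  obtain ⟨D, hD⟩ := hf.lipschitzWith_of_hasCompactSupport hfs (by simp)
  obtain ⟨ρ, hρ⟩ := hfs.isCompact.isBounded.subset_closedBall 0
  set V := (volume : Measure Plane).real (Metric.closedBall 0 (ρ + 1))
  refine ⟨Real.pi * D * Real.sqrt V, by positivity, fun r hr hr1 => ?_⟩
  have hk := integrable_discKer r
  have hm := (memLp_conv hk (hasCompactSupport_discKer r) hf.continuous hfs).sub
    ((hf.continuous.memLp_of_hasCompactSupport hfs (p := 2) (μ := volume)).const_mul (Real.pi : ℂ))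
  refine eLpNorm_two_le hm (by positivity) ?_
  have h1 : ∀ x, ‖conv (discKer r) f x - Real.pi * f x‖ ≤ Real.pi * (D * r) := by
    intro x
    rw [conv_apply, ← integral_discKer hr, ← integral_mul_const, ← integral_norm_discKer hr,
      ← integral_sub (integrable_mul_translate hk hf.continuous hfs x) (hk.mul_const _),
      ← integral_mul_const]
    refine norm_integral_le_of_norm_le (hk.norm.mul_const _) (Eventually.of_forall fun t => ?_)
    rw [← mul_sub, norm_mul]
    by_cases ht : ‖t‖ ≤ r
    · refine mul_le_mul_of_nonneg_left ?_ (norm_nonneg _)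
      rw [← dist_eq_norm]
      refine (hD.dist_le_mul _ _).trans ?_
      rw [dist_eq_norm, sub_sub_cancel_left, norm_neg]
      gcongr
    · rw [discKer_eq_zero (not_le.mp ht)]; simp
  have h2 : ∀ x, ρ + 1 < ‖x‖ → conv (discKer r) f x - Real.pi * f x = 0 := by
    intro x hx
    have hf0 : ∀ y, ρ < ‖y‖ → f y = 0 := fun y hy => by
      by_contra h
      have := hρ (subset_tsupport _ h)
      rw [mem_closedBall_zero_iff] at this
      linarith
    rw [hf0 x (by linarith), mul_zero, sub_zero, conv_apply]
    refine integral_eq_zero_of_ae (Eventually.of_forall fun t => ?_)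
    by_cases ht : ‖t‖ ≤ r
    · have := norm_sub_norm_le x t
      simp only [Pi.zero_apply]
      rw [hf0 _ (by linarith), mul_zero]
    · simp [discKer_eq_zero (not_le.mp ht)]
  have h3 : ∫ x, ‖conv (discKer r) f x - Real.pi * f x‖ ^ 2 ≤
      ∫ x, (Metric.closedBall (0 : Plane) (ρ + 1)).indicator
        (fun _ => (Real.pi * (D * r)) ^ 2) x := by
    refine integral_mono (hm.integrable_norm_pow (by norm_num))
      (IntegrableOn.integrable_indicator (integrableOn_const measure_closedBall_lt_top.ne)
        measurableSet_closedBall) fun x => ?_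
    by_cases hx : ‖x‖ ≤ ρ + 1
    · rw [Set.indicator_of_mem (by simpa using hx)]
      exact pow_le_pow_left₀ (norm_nonneg _) (h1 x) 2
    · simp only
      rw [h2 x (not_le.mp hx), Set.indicator_of_notMem (by simpa using hx)]
      simp
  refine h3.trans (le_of_eq ?_)
  rw [integral_indicator measurableSet_closedBall, setIntegral_const, smul_eq_mul]
  rw [mul_pow _ r, mul_pow _ (Real.sqrt V), Real.sq_sqrt measureReal_nonneg]
  ring

lemma eLpNorm_conv_annulusKer {ε R : ℝ} (hε : 0 < ε) (h : ε < R) {f : Plane → ℂ}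
    (hf : ContDiff ℝ ∞ f) (hfs : HasCompactSupport f) :
    eLpNorm (conv (annulusKer ε R) f) 2 =
      eLpNorm (fun x => conv (discKer ε) f x - conv (discKer R) f x) 2 := by
  have hd := fun r => memLp_conv (integrable_discKer r) (hasCompactSupport_discKer r)
    hf.continuous hfs
  rw [eLpNorm_two_eq (memLp_conv (integrable_annulusKer hε R) (hasCompactSupport_annulusKer ε R)
    hf.continuous hfs), integral_norm_sq_conv_annulusKer hε h hf hfs]
  exact (eLpNorm_two_eq ((hd ε).sub (hd R))).symm

/-- The small disc contributes at most π‖f‖ and the large one only O(1/R). This is why the final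
constant is π and not 2π. -/
lemma exists_eLpNorm_conv_annulusKer_le {f : Plane → ℂ} (hf : ContDiff ℝ ∞ f)
    (hfs : HasCompactSupport f) : ∃ c, ∀ ε R, 0 < ε → ε < R →
      eLpNorm (conv (annulusKer ε R) f) 2 ≤
        ENNReal.ofReal Real.pi * eLpNorm f 2 + ENNReal.ofReal (c / R) := by
  obtain ⟨c, hc⟩ := exists_eLpNorm_conv_discKer_le_div hf.continuous hfs
  refine ⟨c, fun ε R hε h => ?_⟩
  have hd := fun r => (memLp_conv (integrable_discKer r) (hasCompactSupport_discKer r)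
    hf.continuous hfs).1
  rw [eLpNorm_conv_annulusKer hε h hf hfs]
  exact (eLpNorm_sub_le (hd ε) (hd R) (by norm_num)).trans
    (add_le_add (eLpNorm_conv_discKer_le hε hf.continuous hfs) (hc R (hε.trans h)))

/-- Both disc averages are within O(δ) of πf. -/
lemma exists_eLpNorm_conv_annulusKer_le_mul {f : Plane → ℂ} (hf : ContDiff ℝ ∞ f)
    (hfs : HasCompactSupport f) : ∃ c, 0 ≤ c ∧ ∀ ε δ, 0 < ε → ε < δ → δ ≤ 1 →
      eLpNorm (conv (annulusKer ε δ) f) 2 ≤ ENNReal.ofReal (c * δ) := by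
  obtain ⟨c, hc0, hc⟩ := exists_eLpNorm_conv_discKer_sub_le hf hfs
  refine ⟨2 * c, by positivity, fun ε δ hε h hδ => ?_⟩
  have hd := fun r => ((memLp_conv (integrable_discKer r) (hasCompactSupport_discKer r)
    hf.continuous hfs).sub ((hf.continuous.memLp_of_hasCompactSupport hfs (p := 2)
      (μ := volume)).const_mul (Real.pi : ℂ))).1
  rw [eLpNorm_conv_annulusKer hε h hf hfs]
  have e : (fun x => conv (discKer ε) f x - conv (discKer δ) f x) =
      (fun x => conv (discKer ε) f x - Real.pi * f x) -
        fun x => conv (discKer δ) f x - Real.pi * f x := by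
    ext x; simp
  rw [e]
  refine (eLpNorm_sub_le (hd ε) (hd δ) (by norm_num)).trans
    ((add_le_add (hc ε hε (h.le.trans hδ)) (hc δ (hε.trans h) hδ)).trans ?_)
  rw [← ENNReal.ofReal_add (by positivity) (by have := hε.trans h; positivity)]
  refine ENNReal.ofReal_le_ofReal ?_
  nlinarith
end DDA

end

/-! ### Truncated Beurling integrals, strong limits and the Neumann series. -/

noncomputable section
namespace DDA
open scoped ComplexConjugate NNReal Convolution ContDiff

/-- The truncated Beurling integral over `Ω`. -/
def truncatedBeurling (Ω : Set Plane) (ε : ℝ) (f : Plane → ℂ) (x : Plane) : ℂ :=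
  ∫ y in Ω ∩ {y | ε < ‖x - y‖}, (toC (x - y) ^ 2)⁻¹ * f y

lemma measurableSet_far (ε : ℝ) (x : Plane) : MeasurableSet {y : Plane | ε < ‖x - y‖} :=
  measurableSet_lt measurable_const (measurable_norm.comp (measurable_const.sub measurable_id))

/-- An outer cut-off beyond all distances from `x` to `Ω` is invisible, which leaves the outer
radius free to tend to infinity. -/
lemma truncatedBeurling_eq_conv {Ω : Set Plane} (hΩ : MeasurableSet Ω) {ε R : ℝ} {f : Plane → ℂ}
    (hfs : Function.support f ⊆ Ω) {x : Plane} (hR : ∀ y ∈ Ω, ‖x - y‖ ≤ R) :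
    truncatedBeurling Ω ε f x = conv (annulusKer ε R) f x := by
  rw [truncatedBeurling, conv_apply, ← integral_sub_left_eq_self _ volume x,
    ← integral_indicator (hΩ.inter (measurableSet_far ε x))]
  congr 1; ext y
  rw [sub_sub_cancel]
  by_cases hy : y ∈ Ω
  · by_cases h : ε < ‖x - y‖
    · rw [Set.indicator_of_mem (Set.mem_inter hy h), annulusKer, if_pos ⟨h, hR y hy⟩]
    · rw [Set.indicator_of_notMem fun hh => h hh.2, annulusKer, if_neg fun hh => h hh.1, zero_mul]
  · rw [Set.indicator_of_notMem fun hh => hy hh.1, Function.notMem_support.mp fun hh => hy (hfs hh),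
      mul_zero]

lemma exists_norm_sub_le_of_isBounded {Ω : Set Plane} (hΩ : Bornology.IsBounded Ω) :
    ∃ R, 0 < R ∧ ∀ x ∈ Ω, ∀ y ∈ Ω, ‖x - y‖ ≤ R := by
  obtain ⟨C, hC⟩ := Metric.isBounded_iff.mp hΩ
  refine ⟨max C 1, by positivity, fun x hx y hy => ?_⟩
  rw [← dist_eq_norm]; exact (hC hx hy).trans (le_max_left _ _)

lemma eLpNorm_truncatedBeurling_le {Ω : Set Plane} (hΩb : Bornology.IsBounded Ω)
    (hΩ : MeasurableSet Ω) {ε : ℝ} (hε : 0 < ε) {f : Plane → ℂ} (hf : ContDiff ℝ ∞ f)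
    (hfs : HasCompactSupport f) (hfΩ : Function.support f ⊆ Ω) :
    eLpNorm (truncatedBeurling Ω ε f) 2 (volume.restrict Ω) ≤
      ENNReal.ofReal Real.pi * eLpNorm f 2 (volume.restrict Ω) := by
  obtain ⟨R₀, hR₀, hR⟩ := exists_norm_sub_le_of_isBounded hΩb
  obtain ⟨c, hc⟩ := exists_eLpNorm_conv_annulusKer_le hf hfs
  -- The left side does not depend on `R`, so the O(1/R) term can be sent to 0.
  have h1 : ∀ᶠ R in atTop, eLpNorm (truncatedBeurling Ω ε f) 2 (volume.restrict Ω) ≤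
      ENNReal.ofReal Real.pi * eLpNorm f 2 + ENNReal.ofReal (c / R) := by
    filter_upwards [eventually_ge_atTop R₀, eventually_gt_atTop ε] with R h1 h2
    refine le_trans (le_of_eq ?_) ((eLpNorm_mono_measure _ (Measure.restrict_le_self (s := Ω))).trans
      (hc ε R hε h2))
    exact eLpNorm_congr_ae ((ae_restrict_mem hΩ).mono fun x hx =>
      truncatedBeurling_eq_conv hΩ hfΩ fun y hy => (hR x hx y hy).trans h1)
  have h2 : Tendsto (fun R : ℝ => ENNReal.ofReal Real.pi * eLpNorm f 2 + ENNReal.ofReal (c / R))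
      atTop (𝓝 (ENNReal.ofReal Real.pi * eLpNorm f 2 + ENNReal.ofReal 0)) :=
    tendsto_const_nhds.add (ENNReal.tendsto_ofReal (tendsto_const_nhds.div_atTop tendsto_id))
  rw [ENNReal.ofReal_zero, add_zero] at h2
  rw [eLpNorm_restrict_eq_of_support_subset hfΩ]
  exact ge_of_tendsto h2 h1

lemma exists_eLpNorm_truncatedBeurling_sub_le {Ω : Set Plane} (hΩb : Bornology.IsBounded Ω)
    (hΩ : MeasurableSet Ω) {f : Plane → ℂ} (hf : ContDiff ℝ ∞ f)
    (hfs : HasCompactSupport f) (hfΩ : Function.support f ⊆ Ω) :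
    ∃ c, 0 ≤ c ∧ ∀ ε δ, 0 < ε → ε < δ → δ ≤ 1 →
      eLpNorm (fun x => truncatedBeurling Ω ε f x - truncatedBeurling Ω δ f x) 2
        (volume.restrict Ω) ≤ ENNReal.ofReal (c * δ) := by
  obtain ⟨R₀, hR₀, hR⟩ := exists_norm_sub_le_of_isBounded hΩb
  obtain ⟨c, hc0, hc⟩ := exists_eLpNorm_conv_annulusKer_le_mul hf hfs
  refine ⟨c, hc0, fun ε δ hε hεδ hδ => ?_⟩
  refine le_trans (le_of_eq ?_) ((eLpNorm_mono_measure _ (Measure.restrict_le_self (s := Ω))).trans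
    (hc ε δ hε hεδ hδ))
  refine eLpNorm_congr_ae ((ae_restrict_mem hΩ).mono fun x hx => ?_)
  have hR' : ∀ y ∈ Ω, ‖x - y‖ ≤ max R₀ 1 := fun y hy => (hR x hx y hy).trans (le_max_left _ _)
  simp only
  rw [truncatedBeurling_eq_conv hΩ hfΩ hR', truncatedBeurling_eq_conv hΩ hfΩ hR',
    ← conv_sub (integrable_annulusKer hε _) (integrable_annulusKer (hε.trans hεδ) _) hf.continuous
      hfs]
  congr 1; ext t
  have hδR : δ ≤ max R₀ 1 := hδ.trans (le_max_right _ _)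
  simp only [annulusKer]
  rcases le_or_gt ‖t‖ ε with h1 | h1
  · simp [h1.not_gt, (h1.trans hεδ.le).not_gt]
  rcases le_or_gt ‖t‖ δ with h2 | h2
  · simp only [h1, h2.not_gt, h2, h2.trans hδR, and_self, false_and, if_true, if_false, sub_zero]
  · simp only [h1, h2, true_and, h2.not_ge, if_false, sub_self]

/-- Strong convergence of uniformly bounded operators follows from convergence on a dense set. -/
lemma exists_strong_limit {E : Type*} [NormedAddCommGroup E] [NormedSpace ℂ E] [CompleteSpace E]
    (A : ℝ → E →L[ℂ] E) {D : Set E} (hD : Dense D) {M : ℝ} (hM : 0 ≤ M)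
    (hb : ∀ ε, 0 < ε → ∀ d ∈ D, ‖A ε d‖ ≤ M * ‖d‖)
    (hc : ∀ d ∈ D, ∃ c : ℝ, ∀ ε δ, 0 < ε → ε < δ → δ ≤ 1 → ‖A ε d - A δ d‖ ≤ c * δ) :
    ∃ A₀ : E →L[ℂ] E, ‖A₀‖ ≤ M ∧ ∀ u, Tendsto (fun ε => A ε u) (𝓝[>] 0) (𝓝 (A₀ u)) := by
  have hb' : ∀ ε, 0 < ε → ∀ u, ‖A ε u‖ ≤ M * ‖u‖ := fun ε hε u =>
    have hcl : IsClosed {u | ‖A ε u‖ ≤ M * ‖u‖} := isClosed_le (by fun_prop) (by fun_prop)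
    hcl.closure_subset_iff.mpr (hb ε hε) (hD u)
  have hcauchy : ∀ u, Cauchy (map (fun ε => A ε u) (𝓝[>] 0)) := by
    intro u
    refine Metric.cauchy_iff.mpr ⟨inferInstance, fun η hη => ?_⟩
    -- Three-term argument: `u` is replaced by a nearby `d` in the dense set, where the family is
    -- Cauchy with a linear rate.
    obtain ⟨d, hd, hud⟩ := Metric.dense_iff.mp hD u (η / (4 * (M + 1))) (by positivity)
    obtain ⟨c, hc⟩ := hc d hud
    have hdu : ‖u - d‖ * (4 * (M + 1)) < η := by
      rw [Metric.mem_ball, dist_comm, dist_eq_norm, lt_div_iff₀ (by positivity)] at hd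
      exact hd
    set r := min 1 (η / (4 * (|c| + 1)))
    have hr : 0 < r := by positivity
    have hcr : c * r < η / 2 := by
      have h1 : r ≤ η / (4 * (|c| + 1)) := min_le_right _ _
      rw [le_div_iff₀ (by positivity)] at h1
      nlinarith [mul_le_mul_of_nonneg_right (le_abs_self c) hr.le]
    have key : ∀ ε δ, 0 < ε → ε < δ → δ ≤ r → ‖A ε d - A δ d‖ < η / 2 := by
      intro ε δ h1 h2 h3
      have h4 := hc ε δ h1 h2 (h3.trans (min_le_left _ _))
      by_cases hc0 : 0 ≤ c
      · nlinarith
      · have := norm_nonneg (A ε d - A δ d)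
        nlinarith
    refine ⟨(fun ε => A ε u) '' Set.Ioc 0 r, image_mem_map (Ioc_mem_nhdsGT hr), ?_⟩
    rintro _ ⟨ε, hε, rfl⟩ _ ⟨δ, hδ, rfl⟩
    have h1 : ‖A ε d - A δ d‖ < η / 2 := by
      rcases lt_trichotomy ε δ with h | h | h
      · exact key ε δ hε.1 h hδ.2
      · rw [h, sub_self, norm_zero]; positivity
      · rw [norm_sub_rev]; exact key δ ε hδ.1 h hε.2
    have e : A ε u - A δ u = A ε (u - d) + (A ε d - A δ d) - A δ (u - d) := by
      simp only [map_sub]; abel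
    rw [dist_eq_norm, e]
    have h2 := norm_sub_le (A ε (u - d) + (A ε d - A δ d)) (A δ (u - d))
    have h3 := norm_add_le (A ε (u - d)) (A ε d - A δ d)
    have h4 := hb' ε hε.1 (u - d)
    have h5 := hb' δ hδ.1 (u - d)
    nlinarith [norm_nonneg (u - d)]
  choose L hL using fun u => CompleteSpace.complete (hcauchy u)
  have hL' : ∀ u, Tendsto (fun ε => A ε u) (𝓝[>] 0) (𝓝 (L u)) := hL
  let A₁ : E →ₗ[ℂ] E :=
    { toFun := L
      map_add' := fun u v => tendsto_nhds_unique (hL' (u + v))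
        (((hL' u).add (hL' v)).congr fun ε => (map_add _ _ _).symm)
      map_smul' := fun c u => tendsto_nhds_unique (hL' (c • u))
        (((hL' u).const_smul c).congr fun ε => (map_smul _ _ _).symm) }
  have hA₁ : ∀ u, ‖A₁ u‖ ≤ M * ‖u‖ := fun u => le_of_tendsto (hL' u).norm
    (by filter_upwards [self_mem_nhdsWithin] with ε hε using hb' ε hε u)
  exact ⟨A₁.mkContinuous M hA₁, A₁.mkContinuous_norm_le hM hA₁, hL'⟩

/-- Neumann series. -/
lemma existsUnique_of_norm_lt {E : Type*} [NormedAddCommGroup E] [NormedSpace ℂ E]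
    [CompleteSpace E] {A : E →L[ℂ] E} {l : ℂ} (h : ‖A‖ < ‖l‖) :
    (∀ f, ∃! u, l • u - A u = f) ∧ ∃ C : ℝ, ∀ u, ‖u‖ ≤ C * ‖l • u - A u‖ := by
  have hest : ∀ u, (‖l‖ - ‖A‖) * ‖u‖ ≤ ‖l • u - A u‖ := fun u => by
    have h1 := norm_sub_norm_le (l • u) (A u)
    rw [norm_smul] at h1
    nlinarith [A.le_opNorm u]
  have hpos : 0 < ‖l‖ - ‖A‖ := sub_pos.mpr h
  have hu : IsUnit (algebraMap ℂ (E →L[ℂ] E) l - A) := by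
    rcases subsingleton_or_nontrivial E with hE | hE
    · have : Subsingleton (E →L[ℂ] E) := ⟨fun a b => ContinuousLinearMap.ext fun x => Subsingleton.elim _ _⟩
      exact isUnit_of_subsingleton _
    · exact spectrum.mem_resolventSet_iff.mp (spectrum.mem_resolventSet_of_norm_lt h)
  obtain ⟨B, hB⟩ := hu.exists_right_inv
  have happ : ∀ u, (algebraMap ℂ (E →L[ℂ] E) l - A) u = l • u - A u := fun u => by
    simp [Algebra.algebraMap_eq_smul_one]
  refine ⟨fun f => ⟨B f, ?_, fun u hu => ?_⟩, (‖l‖ - ‖A‖)⁻¹, fun u => ?_⟩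
  · simp only
    rw [← happ, ← mul_apply_eq_comp, hB, one_apply_eq_self]
  · have h2 : l • B f - A (B f) = f := by
      rw [← happ, ← mul_apply_eq_comp, hB, one_apply_eq_self]
    have h3 := hest (u - B f)
    rw [smul_sub, map_sub, show l • u - l • B f - (A u - A (B f)) =
      (l • u - A u) - (l • B f - A (B f)) by abel, hu, h2, sub_self, norm_zero] at h3
    exact sub_eq_zero.mp (norm_eq_zero.mp (le_antisymm (by nlinarith) (norm_nonneg _)))
  · rw [← div_eq_inv_mul, le_div_iff₀ hpos, mul_comm]; exact hest u
end DDA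

end

noncomputable section
namespace DDA
open scoped ComplexConjugate NNReal ContDiff

/-! ### Reduction to scalar kernels -/

/-- The coordinate `w₁ + i w₂`. -/
def plusPart : C2 →L[ℂ] ℂ := EuclideanSpace.proj 0 + Complex.I • EuclideanSpace.proj 1

/-- The coordinate `w₁ - i w₂`. -/
def minusPart : C2 →L[ℂ] ℂ := EuclideanSpace.proj 0 - Complex.I • EuclideanSpace.proj 1

lemma plusPart_apply (w : C2) : plusPart w = w 0 + Complex.I * w 1 := rfl

lemma minusPart_apply (w : C2) : minusPart w = w 0 - Complex.I * w 1 := rfl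

lemma two_mul_norm_sq (w : C2) : 2 * ‖w‖ ^ 2 = ‖plusPart w‖ ^ 2 + ‖minusPart w‖ ^ 2 := by
  rw [EuclideanSpace.norm_sq_eq, Fin.sum_univ_two, plusPart_apply, minusPart_apply]
  simp only [Complex.sq_norm, Complex.normSq_apply]
  simp
  ring

lemma inv_toC_sq (x : Plane) :
    (toC x ^ 2)⁻¹ = ((x 0 : ℂ) - x 1 * Complex.I) ^ 2 * ((‖x‖ ^ 4)⁻¹ : ℝ) := by
  have hc : conj (toC x) = (x 0 : ℂ) - x 1 * Complex.I := by
    rw [toC_apply]; simp [sub_eq_add_neg]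
  rw [Complex.inv_def, map_pow, hc, Complex.normSq_eq_norm_sq, norm_pow, toC.norm_map, ← pow_mul]

lemma kernel_apply_coord (x : Plane) (w : C2) (i : Fin 2) :
    Matrix.toEuclideanCLM (𝕜 := ℂ) (kernel x) w i = kernel x i 0 * w 0 + kernel x i 1 * w 1 := by
  rw [Matrix.ofLp_toEuclideanCLM, Matrix.mulVec, dotProduct, Fin.sum_univ_two]

lemma kernel_entries (x : Plane) :
    kernel x 0 0 = -(1 / (2 * Real.pi)) * ((x 0 : ℂ) ^ 2 - x 1 ^ 2) * ((‖x‖ ^ 4)⁻¹ : ℝ) ∧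
    kernel x 0 1 = -(1 / (2 * Real.pi)) * (2 * x 0 * x 1) * ((‖x‖ ^ 4)⁻¹ : ℝ) ∧
    kernel x 1 0 = -(1 / (2 * Real.pi)) * (2 * x 0 * x 1) * ((‖x‖ ^ 4)⁻¹ : ℝ) ∧
    kernel x 1 1 = (1 / (2 * Real.pi)) * ((x 0 : ℂ) ^ 2 - x 1 ^ 2) * ((‖x‖ ^ 4)⁻¹ : ℝ) := by
  have h : ‖x‖ ^ 2 = x 0 ^ 2 + x 1 ^ 2 := by
    rw [EuclideanSpace.norm_sq_eq, Fin.sum_univ_two]; simp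
  simp only [kernel, Matrix.of_apply, h]
  generalize ‖x‖ ^ 4 = D
  refine ⟨?_, ?_, ?_, ?_⟩ <;> simp [div_eq_mul_inv, -mul_eq_mul_right_iff] <;> ring

/-- The matrix with rows (a, b) and (b, -a) sends w₁ + i w₂ to w₁ - i w₂ with the factor a - ib,
here -(1/2π)z⁻². So the vector kernel decouples into the Beurling kernel and its conjugate. -/
lemma minusPart_kernel (x : Plane) (w : C2) :
    minusPart (Matrix.toEuclideanCLM (𝕜 := ℂ) (kernel x) w) =
      -(1 / (2 * Real.pi)) * ((toC x ^ 2)⁻¹ * plusPart w) := by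
  obtain ⟨h1, h2, h3, h4⟩ := kernel_entries x
  rw [minusPart_apply, plusPart_apply, kernel_apply_coord, kernel_apply_coord, h1, h2, h3, h4,
    inv_toC_sq]
  generalize ((‖x‖ ^ 4)⁻¹ : ℝ) = D
  linear_combination (-(1 / (2 * Real.pi)) * D * (2 * (x 0 : ℂ) * x 1 * w 1 -
    (x 1 : ℂ) ^ 2 * w 0 - Complex.I * (x 1 : ℂ) ^ 2 * w 1)) * Complex.I_sq

lemma plusPart_kernel (x : Plane) (w : C2) :
    plusPart (Matrix.toEuclideanCLM (𝕜 := ℂ) (kernel x) w) =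
      -(1 / (2 * Real.pi)) * (conj (toC x ^ 2)⁻¹ * minusPart w) := by
  obtain ⟨h1, h2, h3, h4⟩ := kernel_entries x
  rw [minusPart_apply, plusPart_apply, kernel_apply_coord, kernel_apply_coord, h1, h2, h3, h4,
    inv_toC_sq]
  generalize ((‖x‖ ^ 4)⁻¹ : ℝ) = D
  simp only [map_mul, map_pow, map_sub, Complex.conj_ofReal, Complex.conj_I]
  linear_combination (-(1 / (2 * Real.pi)) * D * (2 * (x 0 : ℂ) * x 1 * w 1 -
    (x 1 : ℂ) ^ 2 * w 0 + Complex.I * (x 1 : ℂ) ^ 2 * w 1)) * Complex.I_sq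

lemma norm_kernel_apply (x : Plane) (w : C2) :
    ‖Matrix.toEuclideanCLM (𝕜 := ℂ) (kernel x) w‖ = 1 / (2 * Real.pi) * (‖x‖ ^ 2)⁻¹ * ‖w‖ := by
  have hpi := Real.pi_pos
  refine (sq_eq_sq₀ (norm_nonneg _) (by positivity)).mp ?_
  have h := two_mul_norm_sq (Matrix.toEuclideanCLM (𝕜 := ℂ) (kernel x) w)
  rw [plusPart_kernel, minusPart_kernel] at h
  simp only [norm_mul, RCLike.norm_conj, norm_inv, norm_pow, toC.norm_map, norm_neg, norm_div,
    norm_one, Complex.norm_real, Complex.norm_ofNat, Real.norm_of_nonneg hpi.le] at h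
  have h2 := two_mul_norm_sq w
  linear_combination h / 2 - (1 / (2 * Real.pi) * (‖x‖ ^ 2)⁻¹) ^ 2 / 2 * h2

lemma two_mul_eLpNorm_sq {μ : Measure Plane} {g : Plane → C2} (hg : AEStronglyMeasurable g μ) :
    2 * eLpNorm g 2 μ ^ 2 =
      eLpNorm (fun x => plusPart (g x)) 2 μ ^ 2 + eLpNorm (fun x => minusPart (g x)) 2 μ ^ 2 := by
  have e : ∀ {E : Type} [NormedAddCommGroup E] (h : Plane → E),
      eLpNorm h 2 μ ^ 2 = ∫⁻ x, ‖h x‖ₑ ^ 2 ∂μ := fun h => by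
    have := eLpNorm_nnreal_pow_eq_lintegral (f := h) (p := 2) (μ := μ) (by norm_num)
    simpa using this
  rw [e, e, e, ← lintegral_const_mul' _ _ (by norm_num), ← lintegral_add_left']
  · refine lintegral_congr fun x => ?_
    have h := two_mul_norm_sq (g x)
    simp only [← ofReal_norm]
    rw [← ENNReal.ofReal_pow (norm_nonneg _), ← ENNReal.ofReal_pow (norm_nonneg _),
      ← ENNReal.ofReal_pow (norm_nonneg _), ← ENNReal.ofReal_add (by positivity) (by positivity),
      ← h, ENNReal.ofReal_mul (by norm_num)]
    simp
  · exact (plusPart.continuous.comp_aestronglyMeasurable hg).enorm.pow_const 2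

lemma eLpNorm_le_of_parts {μ : Measure Plane} {g : Plane → C2} (hg : AEStronglyMeasurable g μ)
    {A B C : ENNReal} (hA : eLpNorm (fun x => plusPart (g x)) 2 μ ≤ A)
    (hB : eLpNorm (fun x => minusPart (g x)) 2 μ ≤ B) (h : A ^ 2 + B ^ 2 ≤ 2 * C ^ 2) :
    eLpNorm g 2 μ ≤ C := by
  have h1 : 2 * eLpNorm g 2 μ ^ 2 ≤ 2 * C ^ 2 := by
    rw [two_mul_eLpNorm_sq hg]
    exact (add_le_add (pow_le_pow_left' hA 2) (pow_le_pow_left' hB 2)).trans h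
  exact (ENNReal.pow_le_pow_left_iff two_ne_zero).mp
    ((ENNReal.mul_le_mul_iff_right (by norm_num) (by norm_num)).mp h1)

/-! ### The truncated operators -/

/-- The kernel, set to zero in the disc of radius `ε`. -/
def truncKer (ε : ℝ) (x : Plane) : C2 →L[ℂ] C2 :=
  if ε < ‖x‖ then Matrix.toEuclideanCLM (𝕜 := ℂ) (kernel x) else 0

lemma truncated_eq (Ω : Set Plane) (ε : ℝ) (u : Plane → C2) (x : Plane) :
    truncated Ω ε u x = ∫ y in Ω, truncKer ε (x - y) (u y) := by
  rw [truncated, ← setIntegral_indicator (measurableSet_far ε x)]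
  congr 1; ext1 y
  by_cases h : y ∈ {y | ε < ‖x - y‖}
  · rw [Set.indicator_of_mem h, truncKer, if_pos (show ε < ‖x - y‖ from h)]
  · rw [Set.indicator_of_notMem h, truncKer, if_neg (show ¬ε < ‖x - y‖ from h)]; rfl

lemma norm_truncKer_le {ε : ℝ} (hε : 0 < ε) (x : Plane) (w : C2) :
    ‖truncKer ε x w‖ ≤ 1 / (2 * Real.pi) * (ε ^ 2)⁻¹ * ‖w‖ := by
  have hpi := Real.pi_pos
  rw [truncKer]
  split_ifs with h
  · rw [norm_kernel_apply]
    gcongr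
  · simp only [zero_apply, norm_zero]; positivity

lemma measurable_truncKer (ε : ℝ) : Measurable fun p : Plane × C2 => truncKer ε p.1 p.2 := by
  have hk : ∀ i j, Measurable fun p : Plane × C2 => kernel p.1 i j := fun i j => by
    simp only [kernel, Matrix.of_apply]
    refine Complex.measurable_ofReal.comp ?_
    have h0 : ∀ i, Measurable fun p : Plane × C2 => p.1 i := fun i =>
      (Continuous.measurable (by fun_prop))
    have hn : Measurable fun p : Plane × C2 => ‖p.1‖ := measurable_fst.norm
    refine (measurable_const.mul (((h0 i).mul (h0 j)).sub ?_)).div (hn.pow_const 4)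
    split_ifs
    · exact (hn.pow_const 2).div_const 2
    · exact measurable_const
  have hw : ∀ i, Measurable fun p : Plane × C2 => p.2 i := fun i =>
    (Continuous.measurable (by fun_prop))
  have e : (fun p : Plane × C2 => truncKer ε p.1 p.2) = fun p => if ε < ‖p.1‖ then
      WithLp.toLp 2 (fun i => kernel p.1 i 0 * p.2 0 + kernel p.1 i 1 * p.2 1) else 0 := by
    ext1 p
    rw [truncKer]
    split_ifs
    · ext i; exact kernel_apply_coord _ _ _
    · rfl
  rw [e]
  refine Measurable.ite (measurableSet_lt measurable_const measurable_fst.norm) ?_ measurable_const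
  refine (PiLp.continuous_toLp 2 _).measurable.comp (measurable_pi_lambda _ fun i => ?_)
  exact ((hk i 0).mul (hw 0)).add ((hk i 1).mul (hw 1))

lemma integrable_truncKer {ε : ℝ} (hε : 0 < ε) {μ : Measure Plane} {u : Plane → C2}
    (hu : Integrable u μ) (x : Plane) : Integrable (fun y => truncKer ε (x - y) (u y)) μ := by
  refine (hu.norm.const_mul (1 / (2 * Real.pi) * (ε ^ 2)⁻¹)).mono' ?_
    (Eventually.of_forall fun y => norm_truncKer_le hε _ _)
  exact ((measurable_truncKer ε).comp_aemeasurable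
    ((measurable_const.sub measurable_id).aemeasurable.prodMk hu.1.aemeasurable)).aestronglyMeasurable

lemma stronglyMeasurable_truncated (Ω : Set Plane) (ε : ℝ) {u : Plane → C2}
    (hu : StronglyMeasurable u) : StronglyMeasurable (truncated Ω ε u) := by
  have e : truncated Ω ε u = fun x => ∫ y in Ω, truncKer ε (x - y) (u y) := by
    ext1 x; exact truncated_eq Ω ε u x
  rw [e]
  refine StronglyMeasurable.integral_prod_right (f := fun x y => truncKer ε (x - y) (u y)) ?_
  exact ((measurable_truncKer ε).comp ((measurable_fst.sub measurable_snd).prodMk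
    (hu.measurable.comp measurable_snd))).stronglyMeasurable

lemma truncated_congr {Ω : Set Plane} {ε : ℝ} {u v : Plane → C2}
    (h : u =ᵐ[volume.restrict Ω] v) : truncated Ω ε u = truncated Ω ε v := by
  ext1 x
  rw [truncated_eq, truncated_eq]
  refine integral_congr_ae ?_
  filter_upwards [h] with y hy
  rw [hy]

section Bounded

variable {Ω : Set Plane}

lemma integrable_coe_L2 (hΩ : Bornology.IsBounded Ω) (u : L2 Ω) :
    Integrable u (volume.restrict Ω) :=
  haveI : IsFiniteMeasure (volume.restrict Ω) := ⟨by simpa using hΩ.measure_lt_top⟩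
  (Lp.memLp u).integrable (by norm_num)

lemma norm_truncated_le {ε : ℝ} (hε : 0 < ε) {u : Plane → C2}
    (hu : Integrable u (volume.restrict Ω)) (x : Plane) :
    ‖truncated Ω ε u x‖ ≤ 1 / (2 * Real.pi) * (ε ^ 2)⁻¹ * ∫ y in Ω, ‖u y‖ := by
  rw [truncated_eq, ← integral_const_mul]
  exact norm_integral_le_of_norm_le (hu.norm.const_mul _)
    (Eventually.of_forall fun y => norm_truncKer_le hε _ _)

lemma memLp_truncated (hΩ : Bornology.IsBounded Ω) {ε : ℝ} (hε : 0 < ε) (u : L2 Ω) :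
    MemLp (truncated Ω ε u) 2 (volume.restrict Ω) :=
  haveI : IsFiniteMeasure (volume.restrict Ω) := ⟨by simpa using hΩ.measure_lt_top⟩
  MemLp.of_bound (stronglyMeasurable_truncated Ω ε (Lp.stronglyMeasurable u)).aestronglyMeasurable
    _ (Eventually.of_forall fun x => norm_truncated_le hε (integrable_coe_L2 hΩ u) x)

lemma exists_integral_norm_le (hΩ : Bornology.IsBounded Ω) :
    ∃ M : ℝ, ∀ u : L2 Ω, ∫ y in Ω, ‖u y‖ ≤ M * ‖u‖ := by
  have : IsFiniteMeasure (volume.restrict Ω) := ⟨by simpa using hΩ.measure_lt_top⟩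
  refine ⟨((volume.restrict Ω) Set.univ ^ (1 / (1 : ENNReal).toReal - 1 / (2 : ENNReal).toReal)).toReal, fun u => ?_⟩
  have h := eLpNorm_le_eLpNorm_mul_rpow_measure_univ (p := 1) (q := 2) (μ := volume.restrict Ω)
    (by norm_num) (Lp.memLp u).1
  rw [integral_norm_eq_lintegral_enorm (Lp.memLp u).1, ← eLpNorm_one_eq_lintegral_enorm, Lp.norm_def,
    mul_comm, ← ENNReal.toReal_mul]
  refine ENNReal.toReal_mono (ENNReal.mul_ne_top (Lp.eLpNorm_ne_top u) ?_) h
  exact ENNReal.rpow_ne_top_of_nonneg (by norm_num) (measure_ne_top _ _)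

end Bounded
end DDA

end

/-! ### The principal value operator and its norm. -/

noncomputable section
namespace DDA
open scoped ComplexConjugate NNReal ContDiff InnerProductSpace

variable {Ω : Set Plane}

/-- The truncated kernel is bounded and `Ω` has finite measure. The norm obtained here blows up with
ε; the uniform bound comes from smooth functions. -/
lemma exists_truncCLM (hΩ : Bornology.IsBounded Ω) {ε : ℝ} (hε : 0 < ε) :
    ∃ A : L2 Ω →L[ℂ] L2 Ω, ∀ u : L2 Ω, A u =ᵐ[volume.restrict Ω] truncated Ω ε u := by
  have : IsFiniteMeasure (volume.restrict Ω) := ⟨by simpa using hΩ.measure_lt_top⟩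
  obtain ⟨M, hM⟩ := exists_integral_norm_le hΩ
  let T : L2 Ω → L2 Ω := fun u => (memLp_truncated hΩ hε u).toLp _
  have hT : ∀ u, T u =ᵐ[volume.restrict Ω] truncated Ω ε u := fun u => MemLp.coeFn_toLp _
  have hi := fun u : L2 Ω => fun x => integrable_truncKer hε (integrable_coe_L2 hΩ u) x
  let L : L2 Ω →ₗ[ℂ] L2 Ω :=
    { toFun := T
      map_add' := fun u v => by
        refine Lp.ext ?_
        have e : truncated Ω ε (u + v : L2 Ω) = truncated Ω ε u + truncated Ω ε v := by
          rw [truncated_congr (Lp.coeFn_add u v)]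
          ext1 x
          simp only [Pi.add_apply, truncated_eq, map_add]
          exact integral_add (hi u x) (hi v x)
        filter_upwards [hT (u + v), hT u, hT v, Lp.coeFn_add (T u) (T v)] with x h1 h2 h3 h4
        rw [h1, h4, Pi.add_apply, h2, h3, e, Pi.add_apply]
      map_smul' := fun c u => by
        refine Lp.ext ?_
        have e : truncated Ω ε (c • u : L2 Ω) = c • truncated Ω ε u := by
          rw [truncated_congr (Lp.coeFn_smul c u)]
          ext1 x
          simp only [Pi.smul_apply, truncated_eq, map_smul]
          exact integral_smul c _
        filter_upwards [hT (c • u), hT u, Lp.coeFn_smul c (T u)] with x h1 h2 h3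
        rw [RingHom.id_apply, h1, h3, Pi.smul_apply, h2, e, Pi.smul_apply] }
  have hpi := Real.pi_pos
  refine ⟨L.mkContinuous ((measureUnivNNReal (volume.restrict Ω) : ℝ) ^ ((2 : ENNReal).toReal)⁻¹ *
    (1 / (2 * Real.pi) * (ε ^ 2)⁻¹ * M)) fun u => ?_, hT⟩
  have h1 : ∀ᵐ x ∂(volume.restrict Ω), ‖T u x‖ ≤ 1 / (2 * Real.pi) * (ε ^ 2)⁻¹ * (M * ‖u‖) := by
    filter_upwards [hT u] with x hx
    rw [hx]
    exact (norm_truncated_le hε (integrable_coe_L2 hΩ u) x).trans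
      (mul_le_mul_of_nonneg_left (hM u) (by positivity))
  have h0 : 0 ≤ M * ‖u‖ := (integral_nonneg fun x => norm_nonneg _).trans (hM u)
  refine (Lp.norm_le_of_ae_bound (by positivity) h1).trans (le_of_eq ?_)
  ring

/-- The classes of smooth functions with compact support, vanishing off `Ω`. -/
def smoothSubmodule (Ω : Set Plane) : Submodule ℂ (L2 Ω) where
  carrier := {u | ∃ d : Plane → C2, ContDiff ℝ ∞ d ∧ HasCompactSupport d ∧
    Function.support d ⊆ Ω ∧ u =ᵐ[volume.restrict Ω] d}
  add_mem' := by
    rintro u v ⟨d, h1, h2, h3, h4⟩ ⟨d', h1', h2', h3', h4'⟩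
    refine ⟨d + d', h1.add h1', h2.add h2',
      (Function.support_add d d').trans (Set.union_subset h3 h3'), ?_⟩
    exact (Lp.coeFn_add u v).trans (h4.add h4')
  zero_mem' := ⟨0, contDiff_const, HasCompactSupport.zero, by simp, Lp.coeFn_zero _ _ _⟩
  smul_mem' := by
    rintro c u ⟨d, h1, h2, h3, h4⟩
    refine ⟨c • d, h1.const_smul c, h2.smul_left (f := fun _ => c),
      (Function.support_const_smul_subset c d).trans h3, ?_⟩
    exact (Lp.coeFn_smul c u).trans (h4.const_smul c)

/-- An element orthogonal to all test functions times unit vectors has vanishing components, by the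
fundamental lemma of the calculus of variations. -/
lemma dense_smoothSubmodule (hΩb : Bornology.IsBounded Ω) (hΩ : IsOpen Ω) :
    Dense (smoothSubmodule Ω : Set (L2 Ω)) := by
  rw [Submodule.dense_iff_topologicalClosure_eq_top, Submodule.topologicalClosure_eq_top_iff,
    Submodule.eq_bot_iff]
  intro u hu
  have hui := integrable_coe_L2 hΩb u
  have key : ∀ j, ∀ᵐ x ∂(volume.restrict Ω), u x j = 0 := by
    intro j
    have hj : Integrable (fun x => u x j) (volume.restrict Ω) :=
      (EuclideanSpace.proj (𝕜 := ℂ) j).integrable_comp hui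
    have h := hΩ.ae_eq_zero_of_integral_contDiff_smul_eq_zero (μ := volume.restrict Ω)
      (hj.locallyIntegrable.locallyIntegrableOn Ω) fun g hg hgs hgΩ => ?_
    · filter_upwards [h, ae_restrict_mem hΩ.measurableSet] with x hx hxΩ using hx hxΩ
    · let d : Plane → C2 := fun x => (g x : ℂ) • EuclideanSpace.single j 1
      have hgc : ContDiff ℝ ∞ fun x => (g x : ℂ) := Complex.ofRealCLM.contDiff.comp hg
      have hd : ContDiff ℝ ∞ d := hgc.smul contDiff_const
      have hds : HasCompactSupport d :=
        hgs.mono fun x hx h0 => hx (by simp [d, h0])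
      have hdm : MemLp d 2 (volume.restrict Ω) := hd.continuous.memLp_of_hasCompactSupport hds
      have hmem : hdm.toLp d ∈ smoothSubmodule Ω := by
        refine ⟨d, hd, hds, fun x hx => hgΩ (subset_tsupport _ fun h0 => hx ?_), hdm.coeFn_toLp⟩
        simp [d, h0]
      have h0 := (Submodule.mem_orthogonal _ _).mp hu _ hmem
      rw [L2.inner_def] at h0
      rw [← h0]
      refine integral_congr_ae ?_
      filter_upwards [hdm.coeFn_toLp] with x hx
      rw [hx]
      simp only [d, inner_smul_left, EuclideanSpace.inner_single_left, Complex.conj_ofReal, map_one,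
        one_mul, Complex.real_smul]
  refine Lp.ext ?_
  filter_upwards [key 0, key 1, Lp.coeFn_zero C2 2 (volume.restrict Ω)] with x h0 h1 h2
  rw [h2]
  ext i
  fin_cases i
  · exact h0
  · exact h1

lemma truncatedBeurling_eq (Ω : Set Plane) (ε : ℝ) (f : Plane → ℂ) (x : Plane) :
    truncatedBeurling Ω ε f x =
      ∫ y in Ω, if ε < ‖x - y‖ then (toC (x - y) ^ 2)⁻¹ * f y else 0 := by
  rw [truncatedBeurling, ← setIntegral_indicator (measurableSet_far ε x)]
  congr 1

lemma minusPart_truncated {ε : ℝ} (hε : 0 < ε) {d : Plane → C2}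
    (hd : Integrable d (volume.restrict Ω)) (x : Plane) :
    minusPart (truncated Ω ε d x) =
      -(1 / (2 * Real.pi)) * truncatedBeurling Ω ε (fun y => plusPart (d y)) x := by
  rw [truncated_eq, ← minusPart.integral_comp_comm (integrable_truncKer hε hd x),
    truncatedBeurling_eq, ← integral_const_mul]
  congr 1; ext1 y
  rw [truncKer]
  split_ifs
  · exact minusPart_kernel _ _
  · simp

lemma plusPart_truncated {ε : ℝ} (hε : 0 < ε) {d : Plane → C2}
    (hd : Integrable d (volume.restrict Ω)) (x : Plane) :
    plusPart (truncated Ω ε d x) =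
      -(1 / (2 * Real.pi)) * conj (truncatedBeurling Ω ε (fun y => conj (minusPart (d y))) x) := by
  rw [truncated_eq, ← plusPart.integral_comp_comm (integrable_truncKer hε hd x),
    truncatedBeurling_eq, ← integral_conj, ← integral_const_mul]
  congr 1; ext1 y
  rw [truncKer]
  split_ifs
  · rw [plusPart_kernel, map_mul, Complex.conj_conj]
  · simp

lemma eLpNorm_conj {μ : Measure Plane} (g : Plane → ℂ) :
    eLpNorm (fun x => conj (g x)) 2 μ = eLpNorm g 2 μ :=
  eLpNorm_congr_norm_ae (Eventually.of_forall fun _ => RCLike.norm_conj _)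

lemma eLpNorm_kernel_const_mul {μ : Measure Plane} (g : Plane → ℂ) :
    eLpNorm (fun x => -(1 / (2 * (Real.pi : ℂ))) * g x) 2 μ =
      ENNReal.ofReal (1 / (2 * Real.pi)) * eLpNorm g 2 μ := by
  have h := eLpNorm_const_smul (-(1 / (2 * (Real.pi : ℂ)))) g 2 μ
  have hpi := Real.pi_pos
  rw [← ofReal_norm, norm_neg, norm_div, norm_one, norm_mul, Complex.norm_real,
    Complex.norm_ofNat, Real.norm_of_nonneg hpi.le] at h
  exact h

variable {d : Plane → C2}

lemma contDiff_plusPart (hd : ContDiff ℝ ∞ d) : ContDiff ℝ ∞ fun x => plusPart (d x) :=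
  (plusPart.restrictScalars ℝ).contDiff.comp hd

lemma contDiff_conj_minusPart (hd : ContDiff ℝ ∞ d) :
    ContDiff ℝ ∞ fun x => conj (minusPart (d x)) :=
  Complex.conjCLE.contDiff.comp ((minusPart.restrictScalars ℝ).contDiff.comp hd)

lemma aestronglyMeasurable_truncated (hd : ContDiff ℝ ∞ d) (ε : ℝ) (μ : Measure Plane) :
    AEStronglyMeasurable (truncated Ω ε d) μ :=
  (stronglyMeasurable_truncated Ω ε hd.continuous.stronglyMeasurable).aestronglyMeasurable

/-- The factor 1/(2π) of the kernel times the Beurling bound π is 1/2. The kernel exchanges the two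
parts, but the norm is symmetric in them. -/
lemma eLpNorm_truncated_le (hΩb : Bornology.IsBounded Ω) (hΩ : MeasurableSet Ω) {ε : ℝ}
    (hε : 0 < ε) (hd : ContDiff ℝ ∞ d) (hds : HasCompactSupport d)
    (hdΩ : Function.support d ⊆ Ω) :
    eLpNorm (truncated Ω ε d) 2 (volume.restrict Ω) ≤
      ENNReal.ofReal (1 / 2) * eLpNorm d 2 (volume.restrict Ω) := by
  have hdi : Integrable d (volume.restrict Ω) := hd.continuous.integrable_of_hasCompactSupport hds
  have hp := eLpNorm_truncatedBeurling_le hΩb hΩ hε (contDiff_plusPart hd)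
    (hds.comp_left (g := plusPart) (map_zero _)) fun x hx => hdΩ fun h => hx (by simp [h])
  have hm := eLpNorm_truncatedBeurling_le hΩb hΩ hε (contDiff_conj_minusPart hd)
    (hds.comp_left (g := fun w => conj (minusPart w)) (by simp))
    fun x hx => hdΩ fun h => hx (by simp [h])
  have hpi := Real.pi_pos
  have hc : ENNReal.ofReal (1 / (2 * Real.pi)) * ENNReal.ofReal Real.pi = ENNReal.ofReal (1 / 2) := by
    rw [← ENNReal.ofReal_mul (by positivity)]; congr 1; field_simp
  refine eLpNorm_le_of_parts (aestronglyMeasurable_truncated hd ε _)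
    (A := ENNReal.ofReal (1 / 2) * eLpNorm (fun x => minusPart (d x)) 2 (volume.restrict Ω))
    (B := ENNReal.ofReal (1 / 2) * eLpNorm (fun x => plusPart (d x)) 2 (volume.restrict Ω)) ?_ ?_ ?_
  · simp only [plusPart_truncated hε hdi]
    rw [eLpNorm_kernel_const_mul, eLpNorm_conj, ← hc, mul_assoc]
    rw [eLpNorm_conj] at hm
    gcongr
  · simp only [minusPart_truncated hε hdi]
    rw [eLpNorm_kernel_const_mul, ← hc, mul_assoc]
    gcongr
  · rw [mul_pow, mul_pow, ← mul_add, add_comm, ← two_mul_eLpNorm_sq hd.continuous.aestronglyMeasurable]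
    exact le_of_eq (by ring)

lemma exists_eLpNorm_truncated_sub_le (hΩb : Bornology.IsBounded Ω) (hΩ : MeasurableSet Ω)
    (hd : ContDiff ℝ ∞ d) (hds : HasCompactSupport d) (hdΩ : Function.support d ⊆ Ω) :
    ∃ c : ℝ, 0 ≤ c ∧ ∀ ε δ, 0 < ε → ε < δ → δ ≤ 1 →
      eLpNorm (fun x => truncated Ω ε d x - truncated Ω δ d x) 2 (volume.restrict Ω) ≤
        ENNReal.ofReal (c * δ) := by
  have hdi : Integrable d (volume.restrict Ω) := hd.continuous.integrable_of_hasCompactSupport hds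
  obtain ⟨c₁, hc₁, h₁⟩ := exists_eLpNorm_truncatedBeurling_sub_le hΩb hΩ (contDiff_plusPart hd)
    (hds.comp_left (g := plusPart) (map_zero _)) fun x hx => hdΩ fun h => hx (by simp [h])
  obtain ⟨c₂, hc₂, h₂⟩ := exists_eLpNorm_truncatedBeurling_sub_le hΩb hΩ
    (contDiff_conj_minusPart hd) (hds.comp_left (g := fun w => conj (minusPart w)) (by simp))
    fun x hx => hdΩ fun h => hx (by simp [h])
  have hpi := Real.pi_pos
  refine ⟨1 / (2 * Real.pi) * (c₁ + c₂), by positivity, fun ε δ hε hεδ hδ => ?_⟩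
  have hδ0 := hε.trans hεδ
  have hle : ∀ {c'}, 0 ≤ c' → c' ≤ c₁ + c₂ → ENNReal.ofReal (1 / (2 * Real.pi)) *
      ENNReal.ofReal (c' * δ) ≤ ENNReal.ofReal (1 / (2 * Real.pi) * (c₁ + c₂) * δ) := by
    intro c' h0 h
    rw [← ENNReal.ofReal_mul (by positivity), mul_assoc]
    gcongr
  refine eLpNorm_le_of_parts ((aestronglyMeasurable_truncated hd ε _).sub
    (aestronglyMeasurable_truncated hd δ _)) ((?_ : _ ≤ _).trans (hle hc₂ (by linarith)))
    ((?_ : _ ≤ _).trans (hle hc₁ (by linarith))) (two_mul _).ge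
  · simp only [Pi.sub_apply, map_sub, plusPart_truncated hε hdi, plusPart_truncated hδ0 hdi, ← mul_sub]
    simp only [← map_sub]
    rw [eLpNorm_kernel_const_mul, eLpNorm_conj]
    have := h₂ ε δ hε hεδ hδ
    gcongr
  · simp only [Pi.sub_apply, map_sub, minusPart_truncated hε hdi, minusPart_truncated hδ0 hdi, ← mul_sub]
    rw [eLpNorm_kernel_const_mul]
    have := h₁ ε δ hε hεδ hδ
    gcongr

/-- The principal value integral defines an operator of norm at most `1 / 2`. -/
theorem exists_isPVOperator (hΩb : Bornology.IsBounded Ω) (hΩ : IsOpen Ω) :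
    ∃ A : L2 Ω →L[ℂ] L2 Ω, IsPVOperator Ω A ∧ ‖A‖ ≤ 1 / 2 := by
  -- For ε ≤ 0 the operator is set to 0; only the limit from the right is taken.
  have hA : ∀ ε : ℝ, ∃ A : L2 Ω →L[ℂ] L2 Ω, 0 < ε →
      ∀ u : L2 Ω, A u =ᵐ[volume.restrict Ω] truncated Ω ε u := fun ε => by
    by_cases hε : 0 < ε
    · obtain ⟨A, hA⟩ := exists_truncCLM hΩb hε
      exact ⟨A, fun _ => hA⟩
    · exact ⟨0, fun h => absurd h hε⟩
  choose A hA using hA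
  suffices hs : ∃ A₀ : L2 Ω →L[ℂ] L2 Ω, ‖A₀‖ ≤ 1 / 2 ∧
      ∀ u, Tendsto (fun ε => A ε u) (𝓝[>] 0) (𝓝 (A₀ u)) by
    obtain ⟨A₀, hA₀, hlim⟩ := hs
    refine ⟨A₀, fun u => ?_, hA₀⟩
    have h2 : Tendsto (fun ε => edist (A ε u) (A₀ u)) (𝓝[>] 0) (𝓝 0) :=
      tendsto_iff_edist_tendsto_0.mp (hlim u)
    refine h2.congr' ?_
    filter_upwards [self_mem_nhdsWithin] with ε hε
    rw [Lp.edist_def]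
    refine eLpNorm_congr_ae ?_
    filter_upwards [hA ε hε u] with x hx
    rw [Pi.sub_apply, hx]
  refine exists_strong_limit A (dense_smoothSubmodule hΩb hΩ) (by norm_num) ?_ ?_
  · rintro ε hε u ⟨d, h1, h2, h3, h4⟩
    have e := (hA ε hε u).trans (Eventually.of_forall (congrFun (truncated_congr h4)))
    rw [Lp.norm_def, Lp.norm_def, eLpNorm_congr_ae e, eLpNorm_congr_ae h4,
      ← ENNReal.toReal_ofReal (show (0 : ℝ) ≤ 1 / 2 by norm_num), ← ENNReal.toReal_mul]
    refine ENNReal.toReal_mono (ENNReal.mul_ne_top ENNReal.ofReal_ne_top ?_)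
      (eLpNorm_truncated_le hΩb hΩ.measurableSet hε h1 h2 h3)
    rw [← eLpNorm_congr_ae h4]
    exact Lp.eLpNorm_ne_top u
  · rintro u ⟨d, h1, h2, h3, h4⟩
    obtain ⟨c, hc0, hc⟩ := exists_eLpNorm_truncated_sub_le hΩb hΩ.measurableSet h1 h2 h3
    refine ⟨c, fun ε δ hε hεδ hδ => ?_⟩
    have hδ0 := hε.trans hεδ
    have e : ∀ ε, 0 < ε → A ε u =ᵐ[volume.restrict Ω] truncated Ω ε d := fun ε hε =>
      (hA ε hε u).trans (Eventually.of_forall (congrFun (truncated_congr h4)))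
    have e2 : (A ε u - A δ u : L2 Ω) =ᵐ[volume.restrict Ω]
        fun x => truncated Ω ε d x - truncated Ω δ d x := by
      filter_upwards [Lp.coeFn_sub (A ε u) (A δ u), e ε hε, e δ hδ0] with x h5 h6 h7
      rw [h5, Pi.sub_apply, h6, h7]
    rw [Lp.norm_def, eLpNorm_congr_ae e2]
    exact ENNReal.toReal_le_of_le_ofReal (by positivity) (hc ε δ hε hεδ hδ)

theorem ieWellPosed_of_half_lt (hΩb : Bornology.IsBounded Ω) (hΩ : IsOpen Ω) {lam : ℝ}
    (h : 1 / 2 < |lam|) : IEWellPosed Ω (lam : ℂ) := by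
  obtain ⟨A, hA, hn⟩ := exists_isPVOperator hΩb hΩ
  refine ⟨A, hA, existsUnique_of_norm_lt ?_⟩
  rw [Complex.norm_real, Real.norm_eq_abs]
  exact hn.trans_lt h
end DDA

end

theorem mainTheorem8 :
    -- the value of `Λ₀`
    ((0.5471 : ℝ) < DDA.Lambda0 ∧ DDA.Lambda0 < 0.5472) ∧
    -- the numerical symbol: existence, form, eigenvalues, and the numbers `Λ₊`, `Λ₋`
    (∃ F, DDA.IsNumericalSymbol F) ∧
    (∀ F, DDA.IsNumericalSymbol F →
      (∃ a b : DDA.Plane → ℝ,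
        DDA.IsFourierSum DDA.coeffA (fun τ => (a τ : ℂ)) ∧
        DDA.IsFourierSum DDA.coeffB (fun τ => (b τ : ℂ)) ∧
        (∀ τ ∈ DDA.Q, τ ≠ 0 →
          F τ = !![(a τ : ℂ), (b τ : ℂ); (b τ : ℂ), -(a τ : ℂ)] ∧
          ∀ μ : ℂ, Module.End.HasEigenvalue (Matrix.toLin' (F τ)) μ ↔
            μ = (Real.sqrt (a τ ^ 2 + b τ ^ 2) : ℝ) ∨
            μ = -(Real.sqrt (a τ ^ 2 + b τ ^ 2) : ℝ)) ∧
        (∀ τ ∈ frontier DDA.Q, b τ = 0) ∧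
        a !₂[Real.pi, 0] = DDA.Lambda0) ∧
      (∀ μ : ℂ, Module.End.HasEigenvalue (Matrix.toLin' (F !₂[Real.pi, 0])) μ ↔
        μ = (DDA.Lambda0 : ℝ) ∨ μ = -(DDA.Lambda0 : ℝ)) ∧
      ∃ Lm Lp : ℝ, DDA.IsLambdaMinus F Lm ∧ DDA.IsLambdaPlus F Lp ∧
        DDA.Lambda0 ≤ Lp ∧ Lm = -Lp) ∧
    -- instability of the scheme and well-posedness of the integral equation
    (∀ (Ω : Set DDA.Plane) (hΩb : Bornology.IsBounded Ω), IsOpen Ω → Ω.Nonempty →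
      ∀ lam : ℝ, lam ∈ Set.Ioo (-0.5471 : ℝ) (-0.5) ∪ Set.Ioo (0.5 : ℝ) 0.5471 →
        (∀ o : ℕ+ → DDA.Plane, ¬ DDA.SchemeStable hΩb o (lam : ℂ)) ∧
        DDA.IEWellPosed Ω (lam : ℂ)) := by
  refine ⟨DDA.exists_weierstrassP_half_eq_Lambda0.2, ⟨_, DDA.isNumericalSymbol_symbolMatrix⟩,
    fun F hF => ⟨⟨fun τ => DDA.symbA (DDA.proj τ), fun τ => DDA.symbB (DDA.proj τ),
      DDA.isFourierSum_symbA, DDA.isFourierSum_symbB, fun τ hτ h0 => ?_,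
      fun τ hτ => DDA.symbB_frontier hτ, DDA.symbA_pi_zero⟩, fun μ => ?_, DDA.exists_lambda hF⟩,
    fun Ω hΩb hΩ hne lam hlam => ⟨fun o => DDA.not_schemeStable hΩb hΩ hne ?_ o,
      DDA.ieWellPosed_of_half_lt hΩb hΩ ?_⟩⟩
  · rw [hF.eq_symbolMatrix hτ h0]
    exact ⟨rfl, DDA.hasEigenvalue_symm_trace_zero _ _⟩
  · rw [hF.eq_symbolMatrix DDA.pi_zero_mem_Q DDA.pi_zero_ne_zero, ← DDA.symbolRadius_pi_zero]
    exact DDA.hasEigenvalue_symm_trace_zero _ _ μ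
  · have := DDA.exists_weierstrassP_half_eq_Lambda0.2.1
    rcases hlam with h | h
    · rw [abs_of_neg (by linarith [h.2])]; linarith [h.1]
    · rw [abs_of_pos (by linarith [h.1])]; linarith [h.2]
  · rcases hlam with h | h
    · rw [abs_of_neg (by linarith [h.2])]; linarith [h.2]
    · rw [abs_of_pos (by linarith [h.1])]; linarith [h.1]
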